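/- Let $\hbar>0$ and let $K$ be any complex symmetric $2\times 2$ matrix. Write $\rho=\sqrt{1+u^2+v^2}$ on $\mathbb R^2$, and let $\tilde\Sigma^0(\mathbb R^2)$ be the complex vector space of $C^\infty$ functions $f:\mathbb R^2\to\mathbb C$ with an asymptotic expansion $f\sim f_0(\theta)+\rho^{-1}f_{-1}(\theta)+\rho^{-2}f_{-2}(\theta)+\cdots$, $f_{-k}\in C^\infty(S^1)$, in the sense of symbols: for all $N,m\ge 0$ the derivatives of order $m$ of $f-\sum_{k<N}\rho^{-k}f_{-k}(\theta)$ are $O(\rho^{-N-m})$ on $\{u^2+v^2\ge1\}$. An oscillatory integral $\mathrm{os}\text{-}\!\int a(z)\,dz$ is the limit of $\int\chi(\varepsilon z)a(z)\,dz$ as $\varepsilon\downarrow0$, required to exist (with absolutely convergent integrals for every $\varepsilon>0$) and to be the same for all Schwartz functions $\chi$ with $\chi(0)=1$. A generalised function is a linear functional on the space of Schwartz functions on $\mathbb R^2$ whose Fourier transform has compact support; a function $f$ acts by $\varphi\mapsto\int f\varphi$. The $K$-ordered product formula is $f*_Kg=f\exp\big(\tfrac{i\hbar}{2}\sum_{ij}\overleftarrow{\partial_i}(K+J)_{ij}\overrightarrow{\partial_j}\big)g$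 with $J=\begin{pmatrix}0&-1\\1&0\end{pmatrix}$, and the $K$-ordered expression of the star-exponential of a linear form is ${:}e_*^{\frac1{i\hbar}\langle\xi,\boldsymbol u\rangle}{:}_K=e^{\frac1{4i\hbar}\langle\xi K,\xi\rangle}e^{\frac1{i\hbar}\langle\xi,\boldsymbol u\rangle}$. The $K$-ordered expression of the star-function $f_*$ of $f\in\tilde\Sigma^0(\mathbb R^2)$ is the generalised function $${:}f_*{:}_K=(2\pi\hbar)^{-2}\,\mathrm{os}\text{-}\!\!\iint f(x)\,e^{-\frac1{i\hbar}\langle\xi,x\rangle}\,{:}e_*^{\frac1{i\hbar}\langle\xi,\boldsymbol u\rangle}{:}_K\,dx\,d\xi ,$$ and $\tilde\Sigma^0(\mathbb R^2)_{*,K}$ is the set of all these. The product ${:}f_*{:}_K*_K{:}g_*{:}_K$ is the corresponding superposition of the products of star-exponentials, $$(2\pi\hbar)^{-4}\,\mathrm{os}\text{-}\!\!\iiiint f(x)e^{-\frac1{i\hbar}\langle\xi,x\rangle}g(y)e^{-\frac1{i\hbar}\langle\eta,y\rangle}\Big({:}e_*^{\frac1{i\hbar}\langle\xi,\boldsymbol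 u\rangle}{:}_K*_K{:}e_*^{\frac1{i\hbar}\langle\eta,\boldsymbol u\rangle}{:}_K\Big)dx\,d\xi\,dy\,d\eta .$$ (Both are tested under the oscillatory integral against test functions $\varphi(\boldsymbol u)\,d\boldsymbol u$.) Proposition. (a) ${:}f_*{:}_K$ exists for every $f\in\tilde\Sigma^0(\mathbb R^2)$, $\tilde\Sigma^0(\mathbb R^2)_{*,K}$ is a complex vector space, and $f\mapsto{:}f_*{:}_K$ is a linear bijection $\tilde\Sigma^0(\mathbb R^2)\to\tilde\Sigma^0(\mathbb R^2)_{*,K}$. Its inverse is given by the Weyl ordered ($K=0$) expression: ${:}f_*{:}_0=f$; the intertwiner $I_K^0=\exp\big(-\tfrac{i\hbar}{4}\sum_{ij}K_{ij}\partial_i\partial_j\big)$ maps ${:}f_*{:}_K$ to ${:}f_*{:}_0$; and for $F\in\tilde\Sigma^0(\mathbb R^2)_{*,K}$ and $f\in\tilde\Sigma^0(\mathbb R^2)$ one has $I_K^0F=f$ if and only if $F={:}f_*{:}_K$. (b) The product $*_K$ is everywhere defined and single-valued on $\tilde\Sigma^0(\mathbb R^2)_{*,K}$, takes values in it, and makes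 it an associative algebra over $\mathbb C$ with unit ${:}1_*{:}_K$. (c) The product is given by the Moyal formula: for $f,g\in\tilde\Sigma^0(\mathbb R^2)$ the oscillatory integral $$(f*_0g)(u,v)=(2\pi)^{-2}\,\mathrm{os}\text{-}\!\!\int_{\mathbb R^4}f\big(u+\tfrac\hbar2s,v+\tfrac\hbar2t\big)\,g(u+s',v+t')\,e^{i(ts'-st')}\,ds\,dt\,ds'\,dt'$$ exists for every $(u,v)\in\mathbb R^2$, $f*_0g\in\tilde\Sigma^0(\mathbb R^2)$, and ${:}f_*{:}_K*_K{:}g_*{:}_K={:}(f*_0g)_*{:}_K$. -/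

import Mathlib

open scoped SchwartzMap FourierTransform ContDiff Topology

noncomputable section

namespace StarAlg

/-- The plane `ℝ²` with coordinate functions `(u, v) = (x 0, x 1)`. -/
abbrev Plane : Type := EuclideanSpace ℝ (Fin 2)

/-- The standard basis vector `e_i` of the plane. -/
def basisVec (i : Fin 2) : Plane := EuclideanSpace.single i (1 : ℝ)

/-! ### The symbol class -/

/-- `ρ(u,v) = √(1 + u² + v²)`. -/
def rho (x : Plane) : ℝ := Real.sqrt (1 + x 0 ^ 2 + x 1 ^ 2)

/-- A smooth function `a(θ)` on the circle, regarded as a smooth function on `ℝ² ∖ {0}` that is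
constant along open rays (the value at the origin is irrelevant). -/
def IsAngular (a : Plane → ℂ) : Prop :=
  ContDiffOn ℝ ∞ a {0}ᶜ ∧ ∀ (r : ℝ) (x : Plane), 0 < r → x ≠ 0 → a (r • x) = a x

/-- The remainder `f - ∑_{k < N} ρ^{-k} a_k(θ)`; here `a k` is the coefficient `f_{-k}`. -/
def remainder (f : Plane → ℂ) (a : ℕ → Plane → ℂ) (N : ℕ) (x : Plane) : ℂ :=
  f x - ∑ k ∈ Finset.range N, ((rho x)⁻¹ ^ k : ℝ) * a k x

/-- The asymptotic expansion `f ∼ f₀(θ) + ρ⁻¹ f₋₁(θ) + ρ⁻² f₋₂(θ) + ⋯` in the sense of symbols: for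
all `N` and `m` the `m`-th derivative of the `N`-th remainder is `O(ρ^{-N-m})` at infinity. -/
def HasExpansion (f : Plane → ℂ) (a : ℕ → Plane → ℂ) : Prop :=
  ∀ N m : ℕ, ∃ C : ℝ, ∀ x : Plane, 1 ≤ ‖x‖ →
    ‖iteratedFDeriv ℝ m (remainder f a N) x‖ ≤ C * (rho x)⁻¹ ^ (N + m)

lemma contDiff_rho : ContDiff ℝ ∞ rho := by
  unfold rho
  apply ContDiff.sqrt
  · fun_prop
  · intro x
    positivity

lemma rho_pos (x : Plane) : 0 < rho x := by
  unfold rho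
  positivity

lemma contDiffAt_remainder {f : Plane → ℂ} {a : ℕ → Plane → ℂ} (hf : ContDiff ℝ ∞ f)
    (ha : ∀ k, IsAngular (a k)) (N m : ℕ) {x : Plane} (hx : x ≠ 0) :
    ContDiffAt ℝ m (remainder f a N) x := by
  have h : ContDiffAt ℝ ∞ (remainder f a N) x := by
    unfold remainder
    refine hf.contDiffAt.sub (ContDiffAt.sum fun k _ => ContDiffAt.mul ?_ ?_)
    · exact Complex.ofRealCLM.contDiff.contDiffAt.comp x
        ((contDiff_rho.contDiffAt.inv (rho_pos x).ne').pow k)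
    · exact (ha k).1.contDiffAt (isOpen_compl_singleton.mem_nhds hx)
  exact h.of_le (by exact_mod_cast le_top)

/-- The class `Σ̃⁰(ℝ²)` of complex-valued symbols, with pointwise addition and scalar
multiplication. -/
def symbolClass : Submodule ℂ (Plane → ℂ) where
  carrier := {f | ContDiff ℝ ∞ f ∧
    ∃ a : ℕ → Plane → ℂ, (∀ k, IsAngular (a k)) ∧ HasExpansion f a}
  zero_mem' := by
    refine ⟨contDiff_const, fun _ _ => 0, fun k => ⟨contDiffOn_const, fun _ _ _ _ => rfl⟩, ?_⟩
    intro N m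
    refine ⟨0, fun x _ => ?_⟩
    have : remainder 0 (fun _ _ => 0) N = fun _ => (0 : ℂ) := by
      funext y
      simp [remainder]
    rw [this]
    simp
  add_mem' := by
    rintro f g ⟨hf, a, ha, hfa⟩ ⟨hg, b, hb, hgb⟩
    refine ⟨hf.add hg, fun k x => a k x + b k x,
      fun k => ⟨(ha k).1.add (hb k).1, fun r x hr hx => ?_⟩, ?_⟩
    · simp only [(ha k).2 r x hr hx, (hb k).2 r x hr hx]
    intro N m
    obtain ⟨C, hC⟩ := hfa N m
    obtain ⟨D, hD⟩ := hgb N m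
    refine ⟨C + D, fun x hx => ?_⟩
    have hx0 : x ≠ 0 := by
      rintro rfl
      norm_num at hx
    have e : remainder (f + g) (fun k x => a k x + b k x) N
        = remainder f a N + remainder g b N := by
      funext y
      simp only [remainder, Pi.add_apply, mul_add, Finset.sum_add_distrib]
      ring
    rw [e, iteratedFDeriv_add_apply (contDiffAt_remainder hf ha N m hx0)
      (contDiffAt_remainder hg hb N m hx0), add_mul]
    exact (norm_add_le _ _).trans (add_le_add (hC x hx) (hD x hx))
  smul_mem' := by
    rintro c f ⟨hf, a, ha, hfa⟩
    refine ⟨hf.const_smul c, fun k x => c * a k x,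
      fun k => ⟨contDiffOn_const.mul (ha k).1, fun r x hr hx => ?_⟩, ?_⟩
    · simp only [(ha k).2 r x hr hx]
    intro N m
    obtain ⟨C, hC⟩ := hfa N m
    refine ⟨‖c‖ * C, fun x hx => ?_⟩
    have hx0 : x ≠ 0 := by
      rintro rfl
      norm_num at hx
    have e : remainder (c • f) (fun k x => c * a k x) N = c • remainder f a N := by
      funext y
      simp only [remainder, Pi.smul_apply, smul_eq_mul, mul_sub, Finset.mul_sum]
      congr 1
      exact Finset.sum_congr rfl fun k _ => by ring
    rw [e, iteratedFDeriv_const_smul_apply (contDiffAt_remainder hf ha N m hx0), norm_smul,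
      mul_assoc]
    exact mul_le_mul_of_nonneg_left (hC x hx) (norm_nonneg c)

/-! ### Oscillatory integrals -/

/-- The oscillatory integral `os-∫ a(z) dz` exists and equals `I`: for every Schwartz function `χ`
with `χ(0) = 1` the regularised integrals `∫ χ(εz) a(z) dz` converge absolutely, and they tend
to `I` as `ε ↓ 0`. -/
def HasOscIntegral {V : Type*} [NormedAddCommGroup V] [NormedSpace ℝ V]
    [MeasureTheory.MeasureSpace V] (a : V → ℂ) (I : ℂ) : Prop :=
  ∀ χ : 𝓢(V, ℂ), χ 0 = 1 →
    (∀ ε : ℝ, 0 < ε → MeasureTheory.Integrable (fun z => χ (ε • z) * a z)) ∧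
    Filter.Tendsto (fun ε : ℝ => ∫ z, χ (ε • z) * a z) (𝓝[>] 0) (𝓝 I)

/-- The value at the point `w = (u,v)` of the Moyal product of `f` and `g` in integral form exists
and equals `I`. Here `p = (s,t)`, `q = (s',t')`, and each of the four one-dimensional measures is
Lebesgue measure divided by `√(2π)`:
`os-∬ f(u + ħs/2, v + ħt/2) g(u + s', v + t') e^{i(ts' - st')}`. -/
def HasMoyalValue (ħ : ℝ) (f g : Plane → ℂ) (w : Plane) (I : ℂ) : Prop :=
  HasOscIntegral (V := Plane × Plane) (fun z =>
    (1 / (2 * (Real.pi : ℂ)) ^ 2) * (f (w + (ħ / 2) • z.1) * g (w + z.2) *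
      Complex.exp (Complex.I * ((z.1 1 * z.2 0 - z.1 0 * z.2 1 : ℝ) : ℂ)))) I

/-! ### The product formula and star-exponentials of linear forms -/

/-- The matrix `J` with rows `(0, -1)` and `(1, 0)`. -/
def matJ : Matrix (Fin 2) (Fin 2) ℂ := !![0, -1; 1, 0]

/-- The product formula
`f *_K g = f exp((iħ/2) ∑ ∂_i^← (K + J)_{ij} ∂_j^→) g = ∑_n (iħ/2)ⁿ/n! ·
∑ Λ_{i₁j₁}⋯Λ_{iₙjₙ} (∂_{i₁}⋯∂_{iₙ} f) (∂_{j₁}⋯∂_{jₙ} g)`, `Λ = K + J`.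
It is used below only for exponentials of linear forms, where the series converges absolutely. -/
def starFormula (ħ : ℝ) (K : Matrix (Fin 2) (Fin 2) ℂ) (f g : Plane → ℂ) (w : Plane) : ℂ :=
  ∑' n : ℕ, (Complex.I * ħ / 2) ^ n / (n.factorial : ℂ) *
    ∑ i : Fin n → Fin 2, ∑ j : Fin n → Fin 2, (∏ k, (K + matJ) (i k) (j k)) *
      (iteratedFDeriv ℝ n f w (fun k => basisVec (i k)) *
        iteratedFDeriv ℝ n g w (fun k => basisVec (j k)))

/-- `e^{(1/iħ)⟨ξ, x⟩}`. -/
def planeWave (ħ : ℝ) (ξ x : Plane) : ℂ :=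
  Complex.exp (1 / (Complex.I * ħ) * ((inner ℝ ξ x : ℝ) : ℂ))

/-- The quadratic form `⟨ξM, ξ⟩ = ∑ M_{ij} ξ_i ξ_j`. -/
def quad (M : Matrix (Fin 2) (Fin 2) ℂ) (ξ : Plane) : ℂ :=
  ∑ i, ∑ j, M i j * (ξ i : ℂ) * (ξ j : ℂ)

/-- The `K`-ordered expression of the star-exponential `e_*^{(1/iħ)⟨ξ, u⟩}`, that is
`exp((iħ/4) ∑ K_{ij} ∂_i ∂_j)` applied to `e^{(1/iħ)⟨ξ, u⟩}`:
`:e_*^{(1/iħ)⟨ξ, u⟩}:_K = e^{(1/4iħ)⟨ξK, ξ⟩} e^{(1/iħ)⟨ξ, u⟩}`. -/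
def starExp (ħ : ℝ) (K : Matrix (Fin 2) (Fin 2) ℂ) (ξ w : Plane) : ℂ :=
  Complex.exp (1 / (4 * Complex.I * ħ) * quad K ξ) * planeWave ħ ξ w

/-! ### Generalised functions

For a general complex symmetric `K` the factor `e^{(1/4iħ)⟨ξK, ξ⟩}` grows like a Gaussian in some
directions, so that a `K`-ordered expression need not be a tempered distribution. It is a
functional on the band-limited Schwartz functions (Fourier transform in `C_c^∞`), which are dense
in the Schwartz space. -/

/-- The Schwartz functions on `ℝ²` whose Fourier transform has compact support. -/
def testSpace : Submodule ℂ 𝓢(Plane, ℂ) where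
  carrier := {φ | HasCompactSupport (𝓕 φ : 𝓢(Plane, ℂ))}
  zero_mem' := by
    change HasCompactSupport (𝓕 (0 : 𝓢(Plane, ℂ)) : 𝓢(Plane, ℂ))
    rw [FourierTransform.fourier_zero]
    exact HasCompactSupport.zero
  add_mem' := by
    intro φ ψ hφ hψ
    change HasCompactSupport (𝓕 (φ + ψ) : 𝓢(Plane, ℂ))
    rw [FourierTransform.fourier_add]
    exact hφ.add hψ
  smul_mem' := by
    intro c φ hφ
    change HasCompactSupport (𝓕 (c • φ) : 𝓢(Plane, ℂ))
    rw [FourierTransform.fourier_smul]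
    exact hφ.smul_left (f := fun _ => c)

/-- Generalised functions: linear functionals on the band-limited test functions. -/
abbrev GenFun : Type := testSpace →ₗ[ℂ] ℂ

/-- The generalised function `F` is given by the function `f`. -/
def Represents (F : GenFun) (f : Plane → ℂ) : Prop :=
  ∀ φ : testSpace, MeasureTheory.Integrable (fun x => f x * φ.1 x) ∧
    F φ = ∫ x, f x * φ.1 x

/-- The symbol of `exp((iħ/4) ∑ M_{ij} ∂_i ∂_j)` in the frequency variable `w`, where
`∂_j` acts on `e^{2πi⟨w, x⟩}` as multiplication by `2πi w_j`. -/
def intertwinerSymbol (ħ : ℝ) (M : Matrix (Fin 2) (Fin 2) ℂ) (w : Plane) : ℂ :=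
  Complex.exp (Complex.I * ħ / 4 * (2 * Real.pi * Complex.I) ^ 2 * quad M w)

lemma contDiff_intertwinerSymbol (ħ : ℝ) (M : Matrix (Fin 2) (Fin 2) ℂ) :
    ContDiff ℝ ∞ (intertwinerSymbol ħ M) := by
  unfold intertwinerSymbol quad
  have h : ∀ i : Fin 2, ContDiff ℝ ∞ (fun w : Plane => ((w i : ℝ) : ℂ)) := fun i =>
    Complex.ofRealCLM.contDiff.comp (by fun_prop)
  refine ContDiff.cexp (contDiff_const.mul (ContDiff.sum fun i _ => ContDiff.sum fun j _ => ?_))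
  exact (contDiff_const.mul (h i)).mul (h j)

/-- The Fourier transform of a test function times the symbol of the intertwiner. -/
def multiplied (ħ : ℝ) (M : Matrix (Fin 2) (Fin 2) ℂ) (φ : testSpace) : 𝓢(Plane, ℂ) :=
  HasCompactSupport.toSchwartzMap
    (f := fun w => intertwinerSymbol ħ M w * (𝓕 φ.1 : 𝓢(Plane, ℂ)) w)
    (HasCompactSupport.mul_left φ.2)
    ((contDiff_intertwinerSymbol ħ M).mul (SchwartzMap.smooth (𝓕 φ.1 : 𝓢(Plane, ℂ)) ⊤))

/-- `exp((iħ/4) ∑ M_{ij} ∂_i ∂_j)` on band-limited test functions. -/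
def testIntertwiner (ħ : ℝ) (M : Matrix (Fin 2) (Fin 2) ℂ) : testSpace →ₗ[ℂ] testSpace where
  toFun φ := ⟨𝓕⁻ (multiplied ħ M φ), by
    change HasCompactSupport (𝓕 (𝓕⁻ (multiplied ħ M φ)) : 𝓢(Plane, ℂ))
    rw [FourierTransform.fourier_fourierInv_eq]
    exact HasCompactSupport.mul_left φ.2⟩
  map_add' φ ψ := by
    have : multiplied ħ M (φ + ψ) = multiplied ħ M φ + multiplied ħ M ψ := by
      ext w
      change intertwinerSymbol ħ M w * (𝓕 (φ.1 + ψ.1) : 𝓢(Plane, ℂ)) w =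
        intertwinerSymbol ħ M w * (𝓕 φ.1 : 𝓢(Plane, ℂ)) w +
        intertwinerSymbol ħ M w * (𝓕 ψ.1 : 𝓢(Plane, ℂ)) w
      rw [FourierTransform.fourier_add, add_apply, mul_add]
    apply Subtype.ext
    simp only [this, FourierTransform.fourierInv_add, Submodule.coe_add]
  map_smul' c φ := by
    have : multiplied ħ M (c • φ) = c • multiplied ħ M φ := by
      ext w
      change intertwinerSymbol ħ M w * (𝓕 (c • φ.1) : 𝓢(Plane, ℂ)) w =
        c * (intertwinerSymbol ħ M w * (𝓕 φ.1 : 𝓢(Plane, ℂ)) w)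
      rw [FourierTransform.fourier_smul, smul_apply, smul_eq_mul]
      ring
    apply Subtype.ext
    simp only [this, FourierTransform.fourierInv_smul, RingHom.id_apply, Submodule.coe_smul]

/-- The intertwiner `I_K^{K'} = exp((iħ/4) ∑ (K' - K)_{ij} ∂_i ∂_j)` from `K`-ordered to
`K'`-ordered expressions, acting on generalised functions by transposition (the operator has
constant coefficients and even order, so it is its own transpose). -/
def intertwiner (ħ : ℝ) (K K' : Matrix (Fin 2) (Fin 2) ℂ) (F : GenFun) : GenFun :=
  F ∘ₗ testIntertwiner ħ (K' - K)

/-! ### Star-functions and their product -/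

/-- `F` is the `K`-ordered expression `:f_*:_K` of the star-function of `f`:
`:f_*:_K = ∬ f(x) e^{-(1/iħ)⟨ξ, x⟩} :e_*^{(1/iħ)⟨ξ, u⟩}:_K đx đξ`, tested against `φ(u) du`, as an
oscillatory integral in `z = (x, ξ)`, with `đx = dx/(2πħ)` and `đξ = dξ/(2πħ)` on `ℝ²`. -/
def IsStarFunction (ħ : ℝ) (K : Matrix (Fin 2) (Fin 2) ℂ) (f : Plane → ℂ) (F : GenFun) : Prop :=
  ∀ φ : testSpace, HasOscIntegral (V := Plane × Plane) (fun z =>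
    (1 / (2 * (Real.pi : ℂ) * ħ) ^ 2) * (f z.1 * (planeWave ħ z.2 z.1)⁻¹ *
      ∫ w, starExp ħ K z.2 w * φ.1 w)) (F φ)

/-- The set `Σ̃⁰(ℝ²)_{*,K}` of `K`-ordered expressions of star-functions of symbols. -/
def starFunctions (ħ : ℝ) (K : Matrix (Fin 2) (Fin 2) ℂ) : Set GenFun :=
  {F | ∃ f ∈ symbolClass, IsStarFunction ħ K f F}

/-- `H = F *_K G` for star-functions `F = :f_*:_K` and `G = :g_*:_K`: the product is the
superposition of the products of the star-exponentials that make up `F` and `G`,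
`∬∬ f(x) e^{-(1/iħ)⟨ξ, x⟩} g(y) e^{-(1/iħ)⟨η, y⟩}
  (:e_*^{(1/iħ)⟨ξ, u⟩}:_K *_K :e_*^{(1/iħ)⟨η, u⟩}:_K) đx đξ đy đη`,
tested against `φ(u) du`, as an oscillatory integral in `z = ((x, ξ), (y, η))`. -/
def IsStarProduct (ħ : ℝ) (K : Matrix (Fin 2) (Fin 2) ℂ) (F G H : GenFun) : Prop :=
  ∃ f ∈ symbolClass, ∃ g ∈ symbolClass, IsStarFunction ħ K f F ∧ IsStarFunction ħ K g G ∧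
    ∀ φ : testSpace, HasOscIntegral (V := (Plane × Plane) × (Plane × Plane)) (fun z =>
      (1 / (2 * (Real.pi : ℂ) * ħ) ^ 4) *
        (f z.1.1 * (planeWave ħ z.1.2 z.1.1)⁻¹ * (g z.2.1 * (planeWave ħ z.2.2 z.2.1)⁻¹) *
          ∫ w, starFormula ħ K (starExp ħ K z.1.2) (starExp ħ K z.2.2) w * φ.1 w)) (H φ)

end StarAlg

end

open StarAlg

/-!
A star-exponential tested against `φ` is, up to scaling, a value of the Fourier transform of `T_K φ`,
where `T_K = exp((iħ/4) ∑ K_{ij} ∂_i ∂_j)` acts on band-limited functions. By Fourier inversion the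
star-function of `f` is therefore the functional `φ ↦ ∫ f · T_K φ` (`starFun`,
`isStarFunction_iff`). As `T_K` is invertible with inverse `T_{-K}`, the intertwiner carries it to
`φ ↦ ∫ f φ`, which determines `f` because band-limited functions are dense enough
(`exists_tendsto_testSpace`, `starFun_injective`).

The product of two star-exponentials is the star-exponential of the sum times a phase
(`starFormula_starExp_eq`), so the integral that defines the product of star-functions has the form
`∫ a e^{iΦ}` with a nondegenerate quadratic phase `Φ` on `ℝ⁸`. Its value is `∫ (f * g) · T_K φ` with the
Moyal product `f * g` (`oscInt_prodAmp`, `hasOscIntegral_starProduct`). For Schwartz functions this is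
a matter of Fubini's theorem and Fourier inversion. The general case follows by approximation, and so
does the associativity of the Moyal product (`moyal_assoc`).

What makes this work is an estimate of oscillatory integrals. Along each of its directions the phase has
a linear form as derivative, and integrating by parts in all directions gains a factor `⟨z⟩⁻¹`
(`Phase.exists_gain`). Hence amplitudes of any polynomial growth have an oscillatory integral,
independent of the cutoff, and bounded by the constants of the amplitude (`Phase.hasOscIntegral`,
`Phase.exists_norm_oscInt_le`). All amplitudes are treated in families with uniform constants, so that
limits and derivatives with respect to parameters are instances of the same estimate.

It remains to see that the Moyal product of two symbols is a symbol. Its derivative in the deformation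
parameter `c = ħ/2` is `i (∂₁f * ∂₀g - ∂₀f * ∂₁g)` (`hasDerivAt_moyal`), whence a Taylor expansion in `c`
whose terms are bidifferential operators, and whose remainders decay by two more orders with each step
(`extSymbol_moyalRem`). The terms have asymptotic expansions because symbols may equally be expanded
into homogeneous functions, which are stable under derivatives and products. The passage between these
expansions and those in `ρ⁻ᵏ a_k(θ)` is the binomial series (`mem_symbolClass_iff`), and
`IsTermClass.hasTermExp_of_sum` resums the expansions of the terms (`moyal_mem_symbolClass`).
-/

open scoped SchwartzMap FourierTransform ContDiff Topology

noncomputable section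

namespace StarAlg

/-! ### Pointwise bounds for iterated derivatives -/

section Pointwise

variable {V : Type*} [NormedAddCommGroup V] [NormedSpace ℝ V]

/-- The Leibniz bound for functions that are smooth on an open set only. -/
lemma norm_iteratedFDeriv_mul_le_of_isOpen {U : Set V} (hU : IsOpen U) {f g : V → ℂ}
    (hf : ContDiffOn ℝ ∞ f U) (hg : ContDiffOn ℝ ∞ g U) {x : V} (hx : x ∈ U) (n : ℕ) :
    ‖iteratedFDeriv ℝ n (fun y => f y * g y) x‖ ≤ ∑ i ∈ Finset.range (n + 1),
      (n.choose i : ℝ) * ‖iteratedFDeriv ℝ i f x‖ * ‖iteratedFDeriv ℝ (n - i) g x‖ := by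
  have h := norm_iteratedFDerivWithin_mul_le hf hg hU.uniqueDiffOn hx (n := n)
    (by exact_mod_cast le_top)
  simpa only [iteratedFDerivWithin_of_isOpen _ hU hx] using h

/-- The derivative of order `n + 1` is controlled by the derivatives of order `n` of the
directional derivatives along a basis. -/
lemma exists_norm_iteratedFDeriv_succ_le [FiniteDimensional ℝ V] :
    ∃ (K : ℝ) (d : ℕ) (e : Fin d → V), 0 ≤ K ∧ ∀ (f : V → ℂ) (x : V) (n : ℕ),
      ContDiffAt ℝ ∞ f x → ‖iteratedFDeriv ℝ (n + 1) f x‖ ≤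
        K * ∑ j, ‖iteratedFDeriv ℝ n (fun y => fderiv ℝ f y (e j)) x‖ := by
  classical
  let b := Module.finBasis ℝ V
  let c : Fin (Module.finrank ℝ V) → (V →L[ℝ] ℝ) := fun j => LinearMap.toContinuousLinearMap (b.coord j)
  let L : Fin (Module.finrank ℝ V) → (ℂ →L[ℝ] (V →L[ℝ] ℂ)) :=
    fun j => ContinuousLinearMap.smulRightL ℝ V ℂ (c j)
  refine ⟨∑ j, ‖L j‖, _, b, Finset.sum_nonneg fun j _ => norm_nonneg (L j), fun f x n hf => ?_⟩
  have hd : fderiv ℝ f = fun y => ∑ j, (L j ∘ fun y => fderiv ℝ f y (b j)) y := by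
    funext y
    ext v
    conv_lhs => rw [← b.sum_repr v, map_sum]
    simp [L, c]
  have hs : ∀ j, ContDiffAt ℝ ∞ (fun y => fderiv ℝ f y (b j)) x := fun j =>
    (hf.fderiv_right (m := ∞) (by simp)).clm_apply contDiffAt_const
  rw [← norm_iteratedFDeriv_fderiv]
  have hn : iteratedFDeriv ℝ n (fderiv ℝ f) x =
      ∑ j, iteratedFDeriv ℝ n (L j ∘ fun y => fderiv ℝ f y (b j)) x := by
    conv_lhs => rw [hd]
    refine iteratedFDeriv_fun_sum_apply fun j _ => ?_
    exact ((L j).contDiff.contDiffAt.comp x (hs j)).of_le (by exact_mod_cast le_top)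
  rw [hn]
  · refine (norm_sum_le _ _).trans ?_
    rw [Finset.sum_mul]
    refine Finset.sum_le_sum fun j _ => ?_
    refine ((L j).norm_iteratedFDeriv_comp_left (hs j) (by exact_mod_cast le_top)).trans ?_
    refine mul_le_mul_of_nonneg_left ?_ (norm_nonneg _)
    exact Finset.single_le_sum (f := fun j => ‖iteratedFDeriv ℝ n (fun y => fderiv ℝ f y (b j)) x‖)
      (fun _ _ => norm_nonneg _) (Finset.mem_univ j)

lemma norm_iteratedFDeriv_fderiv_apply_le {f : V → ℂ} {x : V} (hf : ContDiffAt ℝ ∞ f x) (v : V)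
    (n : ℕ) : ‖iteratedFDeriv ℝ n (fun y => fderiv ℝ f y v) x‖ ≤
      ‖v‖ * ‖iteratedFDeriv ℝ (n + 1) f x‖ := by
  rw [← norm_iteratedFDeriv_fderiv]
  exact norm_iteratedFDeriv_clm_apply_const (hf.fderiv_right (m := ∞) (by simp))
    (by exact_mod_cast le_top)

end Pointwise

/-! ### Families of amplitudes -/

section Families

variable {ι κ V W : Type*} [NormedAddCommGroup V] [NormedSpace ℝ V]
  [NormedAddCommGroup W] [NormedSpace ℝ W]

/-- The derivatives of order `n` of the members of the family `a` are uniformly `O(w)`. -/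
def DerivBound (w : ι → V → ℝ) (n : ℕ) (a : ι → V → ℂ) : Prop :=
  ∃ C : ℝ, 0 ≤ C ∧ ∀ i z, ‖iteratedFDeriv ℝ n (a i) z‖ ≤ C * w i z

/-- A family of smooth amplitudes all of whose derivatives are bounded by the weight `w`, with
constants that depend on the order only and not on the member of the family. -/
structure AmpFamily (w : ι → V → ℝ) (a : ι → V → ℂ) : Prop where
  smooth : ∀ i, ContDiff ℝ ∞ (a i)
  bound : ∀ n, DerivBound w n a

/-- A single amplitude, as a family indexed by a point. -/
abbrev Amp (w : V → ℝ) (a : V → ℂ) : Prop := AmpFamily (ι := Unit) (fun _ => w) (fun _ => a)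

lemma DerivBound.mono {w w' : ι → V → ℝ} {n : ℕ} {a : ι → V → ℂ} (h : DerivBound w n a)
    {K : ℝ} (hK : 0 ≤ K) (hw : ∀ i z, w i z ≤ K * w' i z) : DerivBound w' n a := by
  obtain ⟨C, hC, h⟩ := h
  refine ⟨C * K, by positivity, fun i z => (h i z).trans ?_⟩
  rw [mul_assoc]
  exact mul_le_mul_of_nonneg_left (hw i z) hC

lemma DerivBound.add {w : ι → V → ℝ} {n : ℕ} {a b : ι → V → ℂ} (ha : DerivBound w n a)
    (hb : DerivBound w n b) (sa : ∀ i, ContDiff ℝ ∞ (a i)) (sb : ∀ i, ContDiff ℝ ∞ (b i)) :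
    DerivBound w n (fun i z => a i z + b i z) := by
  obtain ⟨C, hC, ha⟩ := ha
  obtain ⟨D, hD, hb⟩ := hb
  refine ⟨C + D, by positivity, fun i z => ?_⟩
  have e : iteratedFDeriv ℝ n (fun z => a i z + b i z) z =
      iteratedFDeriv ℝ n (a i) z + iteratedFDeriv ℝ n (b i) z :=
    iteratedFDeriv_add_apply ((sa i).contDiffAt.of_le (by exact_mod_cast le_top))
      ((sb i).contDiffAt.of_le (by exact_mod_cast le_top))
  rw [e, add_mul]
  exact (norm_add_le _ _).trans (add_le_add (ha i z) (hb i z))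

lemma DerivBound.mul {w w' : ι → V → ℝ} {n : ℕ} {a b : ι → V → ℂ}
    (ha : ∀ m ≤ n, DerivBound w m a) (hb : ∀ m ≤ n, DerivBound w' m b)
    (sa : ∀ i, ContDiff ℝ ∞ (a i)) (sb : ∀ i, ContDiff ℝ ∞ (b i)) :
    DerivBound (fun i z => w i z * w' i z) n (fun i z => a i z * b i z) := by
  choose! C hC ha using ha
  choose! D hD hb using hb
  refine ⟨∑ i ∈ Finset.range (n + 1), (n.choose i : ℝ) * C i * D (n - i),
    Finset.sum_nonneg fun i hi => ?_, fun i z => ?_⟩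
  · have h1 := hC i (Finset.mem_range_succ_iff.1 hi)
    have h2 := hD (n - i) (Nat.sub_le _ _)
    positivity
  · refine (norm_iteratedFDeriv_mul_le (sa i) (sb i) z (by exact_mod_cast le_top)).trans ?_
    rw [Finset.sum_mul]
    refine Finset.sum_le_sum fun k hk => ?_
    have h1 := ha k (Finset.mem_range_succ_iff.1 hk) i z
    have h2 := hb (n - k) (Nat.sub_le _ _) i z
    calc _ ≤ (n.choose k : ℝ) * (C k * w i z) * (D (n - k) * w' i z) := by
          have h0 := (norm_nonneg _).trans h1
          gcongr
      _ = _ := by ring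

/-- A bound of order `n + 1` follows from bounds of order `n` for all directional derivatives. -/
lemma DerivBound.succ [FiniteDimensional ℝ V] {w : ι → V → ℝ} {n : ℕ} {a : ι → V → ℂ}
    (sa : ∀ i, ContDiff ℝ ∞ (a i))
    (h : ∀ v, DerivBound w n (fun i z => fderiv ℝ (a i) z v)) : DerivBound w (n + 1) a := by
  obtain ⟨K, d, e, hK, hle⟩ := exists_norm_iteratedFDeriv_succ_le (V := V)
  choose C hC h using h
  refine ⟨K * ∑ j, C (e j), mul_nonneg hK (Finset.sum_nonneg fun j _ => hC _), fun i z => ?_⟩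
  refine (hle (a i) z n (sa i).contDiffAt).trans ?_
  rw [mul_assoc, Finset.sum_mul]
  exact mul_le_mul_of_nonneg_left (Finset.sum_le_sum fun j _ => h (e j) i z) hK

lemma DerivBound.zero_of_le {w : ι → V → ℝ} {a : ι → V → ℂ} {C : ℝ} (hC : 0 ≤ C)
    (h : ∀ i z, ‖a i z‖ ≤ C * w i z) : DerivBound w 0 a :=
  ⟨C, hC, fun i z => by simpa using h i z⟩

namespace AmpFamily

variable {w w' : ι → V → ℝ} {a b : ι → V → ℂ}

lemma exists_norm_le (h : AmpFamily w a) : ∃ C, 0 ≤ C ∧ ∀ i z, ‖a i z‖ ≤ C * w i z := by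
  simpa [DerivBound] using h.bound 0

lemma mono (h : AmpFamily w a) {K : ℝ} (hK : 0 ≤ K) (hw : ∀ i z, w i z ≤ K * w' i z) :
    AmpFamily w' a :=
  ⟨h.smooth, fun n => (h.bound n).mono hK hw⟩

lemma congr_weight (h : AmpFamily w a) (hw : ∀ i z, w i z = w' i z) : AmpFamily w' a :=
  h.mono zero_le_one fun i z => by rw [one_mul, hw]

lemma reindex (h : AmpFamily w a) (e : κ → ι) :
    AmpFamily (fun i => w (e i)) (fun i => a (e i)) :=
  ⟨fun i => h.smooth _, fun n => by
    obtain ⟨C, hC, h⟩ := h.bound n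
    exact ⟨C, hC, fun i z => h _ z⟩⟩

lemma single (h : AmpFamily w a) (i : ι) : Amp (w i) (a i) := h.reindex fun _ => i

lemma add (ha : AmpFamily w a) (hb : AmpFamily w b) :
    AmpFamily w (fun i z => a i z + b i z) :=
  ⟨fun i => (ha.smooth i).add (hb.smooth i),
    fun n => (ha.bound n).add (hb.bound n) ha.smooth hb.smooth⟩

lemma mul (ha : AmpFamily w a) (hb : AmpFamily w' b) :
    AmpFamily (fun i z => w i z * w' i z) (fun i z => a i z * b i z) :=
  ⟨fun i => (ha.smooth i).mul (hb.smooth i), fun _ =>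
    DerivBound.mul (fun m _ => ha.bound m) (fun m _ => hb.bound m) ha.smooth hb.smooth⟩

/-- Constants, one for each member of the family. -/
lemma const (c : ι → ℂ) : AmpFamily (V := V) (fun i _ => ‖c i‖) (fun i _ => c i) := by
  refine ⟨fun i => contDiff_const, fun n => ⟨1, zero_le_one, fun i z => ?_⟩⟩
  cases n with
  | zero => simp
  | succ n => simp [iteratedFDeriv_succ_const]

lemma const_mul (c : ι → ℂ) (ha : AmpFamily w a) :
    AmpFamily (fun i z => ‖c i‖ * w i z) (fun i z => c i * a i z) :=
  (AmpFamily.const c).mul ha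

lemma neg (ha : AmpFamily w a) : AmpFamily w (fun i z => - a i z) := by
  simpa using ha.const_mul fun _ => (-1 : ℂ)

lemma sub (ha : AmpFamily w a) (hb : AmpFamily w b) :
    AmpFamily w (fun i z => a i z - b i z) := by
  simpa only [sub_eq_add_neg] using ha.add hb.neg

lemma fderiv_apply (ha : AmpFamily w a) (v : V) :
    AmpFamily w (fun i z => fderiv ℝ (a i) z v) := by
  refine ⟨fun i => ((ha.smooth i).fderiv_right (m := ∞) (by simp)).clm_apply contDiff_const,
    fun n => ?_⟩
  obtain ⟨C, hC, h⟩ := ha.bound (n + 1)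
  refine ⟨‖v‖ * C, by positivity, fun i z => ?_⟩
  refine (norm_iteratedFDeriv_fderiv_apply_le (ha.smooth i).contDiffAt v n).trans ?_
  rw [mul_assoc]
  exact mul_le_mul_of_nonneg_left (h i z) (norm_nonneg v)

/-- Composition with affine maps whose linear parts are uniformly bounded. -/
lemma comp_affine (ha : AmpFamily w a) (T : ι → W →L[ℝ] V) (c : ι → V) {K : ℝ}
    (hT : ∀ i, ‖T i‖ ≤ K) :
    AmpFamily (fun i z => w i (T i z + c i)) (fun i z => a i (T i z + c i)) := by
  refine ⟨fun i => (ha.smooth i).comp ((T i).contDiff.add contDiff_const), fun n => ?_⟩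
  obtain ⟨C, hC, h⟩ := ha.bound n
  refine ⟨C * (max K 0) ^ n, by positivity, fun i z => ?_⟩
  have e := (T i).iteratedFDeriv_comp_right (f := fun y => a i (y + c i)) (n := ∞)
    ((ha.smooth i).comp (contDiff_id.add contDiff_const)) z (i := n) (by exact_mod_cast le_top)
  change ‖iteratedFDeriv ℝ n ((fun y => a i (y + c i)) ∘ T i) z‖ ≤ _
  rw [e, iteratedFDeriv_comp_add_right]
  refine (ContinuousMultilinearMap.norm_compContinuousLinearMap_le _ _).trans ?_
  simp only [Finset.prod_const, Finset.card_univ, Fintype.card_fin]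
  have h1 := h i (T i z + c i)
  have h2 : ‖T i‖ ≤ max K 0 := (hT i).trans (le_max_left _ _)
  have h0 := (norm_nonneg _).trans h1
  calc _ ≤ (C * w i (T i z + c i)) * (max K 0) ^ n := by gcongr
    _ = _ := by ring

end AmpFamily

end Families

/-! ### Weights -/

section Weights

variable {V W : Type*} [NormedAddCommGroup V] [NormedAddCommGroup W]

/-- The weight `⟨z⟩ = 1 + ‖z‖`. It is comparable with `√(1 + ‖z‖²)`; its lack of smoothness is
harmless, since it is used in bounds only. -/
def jap (z : V) : ℝ := 1 + ‖z‖

lemma one_le_jap (z : V) : 1 ≤ jap z := by simp [jap]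

lemma jap_pos (z : V) : 0 < jap z := zero_lt_one.trans_le (one_le_jap z)

lemma norm_le_jap (z : V) : ‖z‖ ≤ jap z := by simp [jap]

lemma jap_add_le (x y : V) : jap (x + y) ≤ jap x * jap y := by
  have := norm_add_le x y
  simp only [jap]
  nlinarith [norm_nonneg x, norm_nonneg y]

lemma jap_zpow_nonneg (z : V) (k : ℤ) : 0 ≤ jap z ^ k := zpow_nonneg (jap_pos z).le k

lemma jap_zpow_le_of_le (z : V) {k l : ℤ} (h : k ≤ l) : jap z ^ k ≤ jap z ^ l :=
  zpow_le_zpow_right₀ (one_le_jap z) h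

/-- Peetre's inequality. -/
lemma jap_add_zpow_le (x y : V) (k : ℤ) : jap (x + y) ^ k ≤ jap x ^ k * jap y ^ |k| := by
  have hx := jap_pos x
  have hy := jap_pos y
  obtain ⟨n, rfl | rfl⟩ := k.eq_nat_or_neg
  · simp only [Nat.abs_cast, zpow_natCast, ← mul_pow]
    exact pow_le_pow_left₀ (jap_pos _).le (jap_add_le x y) n
  · simp only [abs_neg, Nat.abs_cast, zpow_neg, zpow_natCast]
    have h : jap x ≤ jap (x + y) * jap y := by
      have := jap_add_le (x + y) (-y)
      simpa [jap] using this
    have h2 := pow_le_pow_left₀ hx.le h n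
    rw [mul_pow] at h2
    have h3 : 0 < jap (x + y) ^ n := pow_pos (jap_pos _) n
    rw [inv_mul_eq_div, le_div_iff₀ (by positivity), inv_mul_le_iff₀ h3]
    exact h2

lemma jap_le_of_norm_le {x : V} {y : W} {K : ℝ} (hK : 1 ≤ K) (h : ‖x‖ ≤ K * ‖y‖) :
    jap x ≤ K * jap y := by
  simp only [jap]
  nlinarith [norm_nonneg y]

end Weights

lemma amp_linear {V : Type*} [NormedAddCommGroup V] [NormedSpace ℝ V] [FiniteDimensional ℝ V]
    (ℓ : V →L[ℝ] ℝ) : Amp jap (fun z => (ℓ z : ℂ)) := by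
  have hs : ContDiff ℝ ∞ (fun z => (ℓ z : ℂ)) := Complex.ofRealCLM.contDiff.comp ℓ.contDiff
  refine ⟨fun _ => hs, fun n => ?_⟩
  cases n with
  | zero =>
    refine DerivBound.zero_of_le (norm_nonneg ℓ) fun _ z => ?_
    rw [Complex.norm_real]
    exact (ℓ.le_opNorm z).trans (mul_le_mul_of_nonneg_left (norm_le_jap z) (norm_nonneg ℓ))
  | succ n =>
    refine DerivBound.succ (fun _ => hs) fun v => ?_
    have hd : ∀ z, fderiv ℝ (fun z => (ℓ z : ℂ)) z v = (ℓ v : ℂ) := fun z => by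
      have h : fderiv ℝ (fun z => (ℓ z : ℂ)) z = _ :=
        (Complex.ofRealCLM.hasFDerivAt.comp z ℓ.hasFDerivAt).fderiv
      rw [h]
      simp
    simp only [hd]
    exact ((AmpFamily.const fun _ : Unit => (ℓ v : ℂ)).bound n).mono (norm_nonneg (ℓ v : ℂ))
      fun _ z => le_mul_of_one_le_right (norm_nonneg _) (one_le_jap z)

/-! ### Cutoffs -/

section Cutoff

variable {V : Type*} [NormedAddCommGroup V] [NormedSpace ℝ V]

/-- The scaling parameters `0 < ε ≤ 1`. -/
abbrev Scale : Type := {ε : ℝ // 0 < ε ∧ ε ≤ 1}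

/-- The sequence of scales `1, 1/2, 1/3, …`. -/
def scaleSeq (n : ℕ) : Scale := ⟨1 / ((n : ℝ) + 1), by positivity, by
  rw [div_le_one (by positivity)]
  have : (0 : ℝ) ≤ n := n.cast_nonneg
  linarith⟩

lemma tendsto_scaleSeq : Filter.Tendsto (fun n => (scaleSeq n).1) Filter.atTop (𝓝 0) :=
  tendsto_one_div_add_atTop_nhds_zero_nat

lemma scaleSeq_anti {n m : ℕ} (h : n ≤ m) : (scaleSeq m).1 ≤ (scaleSeq n).1 := by
  have : (n : ℝ) ≤ m := by exact_mod_cast h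
  simp only [scaleSeq]
  gcongr

lemma amp_schwartz (χ : 𝓢(V, ℂ)) (N : ℕ) : Amp (fun z => jap z ^ (-(N : ℤ))) χ := by
  refine ⟨fun _ => χ.smooth ⊤, fun n => ?_⟩
  refine ⟨2 ^ N * (Finset.Iic (N, n)).sup (fun m => SchwartzMap.seminorm ℂ m.1 m.2) χ,
    by positivity, fun _ z => ?_⟩
  have h := SchwartzMap.one_add_le_sup_seminorm_apply (𝕜 := ℂ) (m := (N, n)) le_rfl le_rfl χ z
  beta_reduce
  rw [zpow_neg, zpow_natCast, ← div_eq_mul_inv, le_div_iff₀ (pow_pos (jap_pos z) N), mul_comm]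
  exact h

lemma amp_schwartz_one (χ : 𝓢(V, ℂ)) : Amp (fun _ => 1) χ :=
  (amp_schwartz χ 0).congr_weight fun _ _ => by simp

lemma norm_scale_le (ε : Scale) : ‖ε.1 • ContinuousLinearMap.id ℝ V‖ ≤ 1 := by
  rw [norm_smul, Real.norm_of_nonneg ε.2.1.le]
  exact mul_le_one₀ ε.2.2 (norm_nonneg _) ContinuousLinearMap.norm_id_le

lemma ampFamily_cutoff (χ : 𝓢(V, ℂ)) :
    AmpFamily (fun (_ : Scale) _ => 1) (fun ε z => χ (ε.1 • z)) := by
  have h := ((amp_schwartz_one χ).reindex (fun _ : Scale => ())).comp_affine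
    (fun ε => ε.1 • ContinuousLinearMap.id ℝ V) (fun _ => 0) (K := 1) norm_scale_le
  simpa using h

lemma amp_cutoff (χ : 𝓢(V, ℂ)) {ε : ℝ} (hε : 0 < ε) (N : ℕ) :
    Amp (fun z => jap z ^ (-(N : ℤ))) (fun z => χ (ε • z)) := by
  have h := (amp_schwartz χ N).comp_affine (fun _ => ε • ContinuousLinearMap.id ℝ V) (fun _ => 0)
    (fun _ => le_rfl)
  have h' : Amp (fun z => jap (ε • z) ^ (-(N : ℤ))) (fun z => χ (ε • z)) := by simpa using h
  have h1 : 1 ≤ max 1 ε⁻¹ := le_max_left _ _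
  refine h'.mono (K := (max 1 ε⁻¹) ^ N) (by positivity) fun _ z => ?_
  have : jap z ≤ max 1 ε⁻¹ * jap (ε • z) := by
    refine jap_le_of_norm_le h1 ?_
    rw [norm_smul, Real.norm_of_nonneg hε.le, ← mul_assoc]
    refine le_mul_of_one_le_left (norm_nonneg z) ?_
    calc (1 : ℝ) = ε⁻¹ * ε := by field_simp
      _ ≤ _ := by gcongr; exact le_max_right _ _
  have h2 := pow_le_pow_left₀ (jap_pos z).le this N
  rw [mul_pow] at h2
  have h3 := pow_pos (jap_pos z) N
  have h4 := pow_pos (jap_pos (ε • z)) N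
  rw [zpow_neg, zpow_neg, zpow_natCast, zpow_natCast, inv_le_iff_one_le_mul₀ h4, mul_right_comm,
    ← div_eq_mul_inv, one_le_div h3]
  exact h2

lemma fderiv_comp_smul (χ : 𝓢(V, ℂ)) (ε : ℝ) (z v : V) :
    fderiv ℝ (fun z => χ (ε • z)) z v = ε * fderiv ℝ χ (ε • z) v := by
  have h1 : HasFDerivAt (fun z : V => ε • z) (ε • ContinuousLinearMap.id ℝ V) z :=
    (ContinuousLinearMap.id ℝ V).hasFDerivAt.const_smul ε
  have h2 := (χ.differentiableAt (x := ε • z)).hasFDerivAt.comp z h1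
  have h3 := h2.fderiv
  change fderiv ℝ (fun z => χ (ε • z)) z = _ at h3
  rw [h3]
  simp

lemma ampFamily_fderiv_cutoff (χ : 𝓢(V, ℂ)) (v : V) :
    AmpFamily (fun (ε : Scale) _ => ε.1) (fun ε z => fderiv ℝ (fun z => χ (ε.1 • z)) z v) := by
  have h := (((amp_schwartz_one χ).fderiv_apply v).reindex (fun _ : Scale => ())).comp_affine
    (fun ε => ε.1 • ContinuousLinearMap.id ℝ V) (fun _ => 0) (K := 1) norm_scale_le
  have h2 := h.const_mul fun ε => (ε.1 : ℂ)
  simp only [fderiv_comp_smul]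
  simpa [abs_of_pos, fun ε : Scale => ε.2.1] using h2

/-- A cutoff differs from its value at the origin by `O(ε⟨z⟩)`, with all derivatives. -/
lemma ampFamily_cutoff_sub [FiniteDimensional ℝ V] (χ : 𝓢(V, ℂ)) :
    AmpFamily (fun (ε : Scale) z => ε.1 * jap z) (fun ε z => χ (ε.1 • z) - χ 0) := by
  have hs : ∀ ε : Scale, ContDiff ℝ ∞ (fun z => χ (ε.1 • z) - χ 0) := fun ε =>
    ((ampFamily_cutoff χ).smooth ε).sub contDiff_const
  refine ⟨hs, fun n => ?_⟩
  cases n with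
  | zero =>
    obtain ⟨C, hC, h⟩ := (amp_schwartz_one χ).bound 1
    refine DerivBound.zero_of_le hC fun ε z => ?_
    have h1 := Convex.norm_image_sub_le_of_norm_fderiv_le (𝕜 := ℝ) (f := χ) (s := Set.univ)
      (C := C) (fun x _ => χ.differentiableAt)
      (fun x _ => by simpa [← norm_iteratedFDeriv_one] using h () x) convex_univ
      (Set.mem_univ 0) (Set.mem_univ (ε.1 • z))
    refine h1.trans ?_
    rw [sub_zero, norm_smul, Real.norm_of_nonneg ε.2.1.le]
    have := norm_le_jap z
    have := ε.2.1
    gcongr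
  | succ n =>
    refine DerivBound.succ hs fun v => ?_
    have := ((ampFamily_fderiv_cutoff χ v).bound n).mono (w' := fun ε z => ε.1 * jap z) zero_le_one
      (fun ε z => by
        have := one_le_jap z
        have := ε.2.1
        nlinarith)
    simpa only [fderiv_sub_const] using this

lemma exists_schwartz_hasCompactSupport (V : Type*) [NormedAddCommGroup V] [NormedSpace ℝ V]
    [FiniteDimensional ℝ V] : ∃ χ : 𝓢(V, ℂ), χ 0 = 1 ∧ HasCompactSupport χ := by
  let f : ContDiffBump (0 : V) := ⟨1, 2, one_pos, one_lt_two⟩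
  have h1 : HasCompactSupport (fun x => ((f x : ℝ) : ℂ)) :=
    f.hasCompactSupport.comp_left (g := Complex.ofReal) (by simp)
  refine ⟨h1.toSchwartzMap (Complex.ofRealCLM.contDiff.comp f.contDiff), ?_, h1⟩
  change ((f 0 : ℝ) : ℂ) = 1
  rw [f.one_of_mem_closedBall (by simp [f])]
  simp

lemma exists_schwartz_eq_one (V : Type*) [NormedAddCommGroup V] [NormedSpace ℝ V]
    [FiniteDimensional ℝ V] : ∃ χ : 𝓢(V, ℂ), χ 0 = 1 :=
  (exists_schwartz_hasCompactSupport V).imp fun _ h => h.1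

end Cutoff

/-! ### Oscillatory integrals with a nondegenerate quadratic phase -/

section Osc

open MeasureTheory

variable {V : Type*} [NormedAddCommGroup V] [NormedSpace ℝ V]

/-- A phase function with directions `dir j` along which its derivative is a linear form `form j`,
such that the forms have no common zero. Every nondegenerate quadratic form is one. -/
structure Phase (V : Type*) [NormedAddCommGroup V] [NormedSpace ℝ V] where
  toFun : V → ℝ
  contDiff : ContDiff ℝ ∞ toFun
  card : ℕ
  dir : Fin card → V
  form : Fin card → V →L[ℝ] ℝ
  fderiv_apply : ∀ j z, fderiv ℝ toFun z (dir j) = form j z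
  eq_zero : ∀ z, (∀ j, form j z = 0) → z = 0

namespace Phase

variable (P : Phase V)

/-- The oscillating factor `e^{iΦ}`. -/
def osc (z : V) : ℂ := Complex.exp (Complex.I * (P.toFun z : ℂ))

lemma norm_osc (z : V) : ‖P.osc z‖ = 1 := by
  rw [osc, mul_comm, Complex.norm_exp_ofReal_mul_I]

lemma contDiff_osc : ContDiff ℝ ∞ P.osc :=
  (contDiff_const.mul (Complex.ofRealCLM.contDiff.comp P.contDiff)).cexp

lemma fderiv_osc (j : Fin P.card) (z : V) :
    fderiv ℝ P.osc z (P.dir j) = Complex.I * P.form j z * P.osc z := by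
  have h1 := (P.contDiff.differentiable (by simp) z).hasFDerivAt
  have h2 := (Complex.ofRealCLM.hasFDerivAt.comp z h1).const_mul Complex.I
  have h3 := h2.cexp.fderiv
  change fderiv ℝ P.osc z = _ at h3
  rw [h3]
  simp [P.fderiv_apply, osc]
  ring

lemma fderiv_mul_osc {b : V → ℂ} (hb : ContDiff ℝ ∞ b) (j : Fin P.card) (z : V) :
    fderiv ℝ (fun z => b z * P.osc z) z (P.dir j) =
      (fderiv ℝ b z (P.dir j) + Complex.I * P.form j z * b z) * P.osc z := by
  have h1 := (hb.differentiable (by simp) z).hasFDerivAt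
  have h2 := (P.contDiff_osc.differentiable (by simp) z).hasFDerivAt
  have h3 : fderiv ℝ (fun z => b z * P.osc z) z = _ := (h1.mul h2).fderiv
  rw [h3]
  simp [P.fderiv_osc]
  ring

/-- As the forms have no common zero, the product of the gains along all of them is a gain of one
power of `⟨z⟩`. -/
lemma exists_jap_le_prod [FiniteDimensional ℝ V] : ∃ K : ℝ, 0 ≤ K ∧ ∀ z,
    (∏ j, (1 + |P.form j z|)⁻¹) ≤ K * (jap z)⁻¹ := by
  let T : V →L[ℝ] (Fin P.card → ℝ) := ContinuousLinearMap.pi P.form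
  have hT : Function.Injective T := by
    rw [injective_iff_map_eq_zero]
    exact fun z hz => P.eq_zero z fun j => congrFun hz j
  obtain ⟨K, hK, h⟩ := T.toLinearMap.injective_iff_antilipschitz.1 hT
  refine ⟨max 1 K, by positivity, fun z => ?_⟩
  have h1 : ‖z‖ ≤ K * ‖T z‖ := by simpa using h.le_mul_dist z 0
  have h2 : jap z ≤ max 1 (K : ℝ) * (1 + ‖T z‖) := by
    refine jap_le_of_norm_le (le_max_left _ _) (h1.trans ?_)
    gcongr
    exact le_max_right _ _
  have h4 : ∀ j, (1 : ℝ) ≤ 1 + |P.form j z| := fun j => by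
    have := abs_nonneg (P.form j z)
    linarith
  have h5 : (1 : ℝ) ≤ ∏ j, (1 + |P.form j z|) := Finset.one_le_prod fun j _ => h4 j
  have h3 : 1 + ‖T z‖ ≤ ∏ j, (1 + |P.form j z|) := by
    rw [← le_sub_iff_add_le', pi_norm_le_iff_of_nonneg (by linarith)]
    intro j
    rw [le_sub_iff_add_le']
    rw [← Finset.mul_prod_erase _ _ (Finset.mem_univ j)]
    exact le_mul_of_one_le_right (zero_le_one.trans (h4 j)) (Finset.one_le_prod fun i _ => h4 i)
  rw [Finset.prod_inv_distrib, ← div_eq_mul_inv, inv_eq_one_div, div_le_div_iff₀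
    (by linarith) (jap_pos z), one_mul]
  refine h2.trans ?_
  gcongr

end Phase

/-- The multiplier `(1 + iℓ)⁻¹` gains one power of the linear form `ℓ`. -/
lemma amp_inv_one_add [FiniteDimensional ℝ V] (ℓ : V →L[ℝ] ℝ) :
    Amp (fun z => (1 + |ℓ z|)⁻¹) (fun z => (1 + Complex.I * (ℓ z : ℂ))⁻¹) := by
  set m : V → ℂ := fun z => (1 + Complex.I * (ℓ z : ℂ))⁻¹ with hm
  have hne : ∀ z, 1 + Complex.I * (ℓ z : ℂ) ≠ 0 := fun z h => by
    have := congrArg Complex.re h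
    simp at this
  have hs : ContDiff ℝ ∞ m := by
    refine ContDiff.inv ?_ hne
    exact contDiff_const.add (contDiff_const.mul (Complex.ofRealCLM.contDiff.comp ℓ.contDiff))
  have hd : ∀ v z, fderiv ℝ m z v = -(Complex.I * ℓ v) * (m z * m z) := fun v z => by
    have h1 : HasFDerivAt (fun z => 1 + Complex.I * (ℓ z : ℂ))
        (Complex.I • (Complex.ofRealCLM.comp ℓ)) z := by
      simpa using ((Complex.ofRealCLM.hasFDerivAt.comp z ℓ.hasFDerivAt).const_mul
        Complex.I).const_add 1
    have h2 := (hasDerivAt_inv (hne z)).comp_hasFDerivAt z h1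
    have h3 := h2.fderiv
    change fderiv ℝ m z = _ at h3
    rw [h3]
    simp only [hm, FunLike.coe_smul, Pi.smul_apply, ContinuousLinearMap.comp_apply, smul_eq_mul,
      Complex.ofRealCLM_apply]
    field_simp [hne z]
  -- the derivatives of the multiplier are multiples of its square, so that the Leibniz rule for
  -- the square carries the induction over the order
  refine ⟨fun _ => hs, fun n => ?_⟩
  induction n using Nat.strong_induction_on with
  | _ n ih =>
    cases n with
    | zero =>
      refine DerivBound.zero_of_le (C := 2) (by norm_num) fun _ z => ?_
      have h1 := Complex.abs_re_le_norm (1 + Complex.I * (ℓ z : ℂ))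
      have h2 := Complex.abs_im_le_norm (1 + Complex.I * (ℓ z : ℂ))
      simp at h1 h2
      have h3 : 0 < ‖1 + Complex.I * (ℓ z : ℂ)‖ := by positivity [hne z]
      rw [hm, norm_inv, ← div_eq_mul_inv, inv_eq_one_div, div_le_div_iff₀ h3 (by positivity)]
      linarith
    | succ n =>
      refine DerivBound.succ (fun _ => hs) fun v => ?_
      simp only [hd]
      have h1 := DerivBound.mul (n := n) (fun k hk => ih k (Nat.lt_succ_of_le hk))
        (fun k hk => ih k (Nat.lt_succ_of_le hk)) (fun _ => hs) (fun _ => hs)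
      have h2 : ∀ k ≤ n, DerivBound (fun (_ : Unit) z => (1 + |ℓ z|)⁻¹) k
          (fun _ z => m z * m z) := fun k hk => by
        refine (DerivBound.mul (n := k) (fun j hj => ih j (by omega))
          (fun j hj => ih j (by omega)) (fun _ => hs) (fun _ => hs)).mono zero_le_one
          fun _ z => ?_
        rw [one_mul]
        refine mul_le_of_le_one_left (by positivity) (inv_le_one_of_one_le₀ ?_)
        have := abs_nonneg (ℓ z)
        linarith
      have h3 := DerivBound.mul (n := n)
        (fun k _ => (AmpFamily.const (V := V) fun _ : Unit => -(Complex.I * ℓ v)).bound k)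
        h2 (fun _ => contDiff_const) (fun _ => hs.mul hs)
      exact h3.mono (norm_nonneg (-(Complex.I * (ℓ v : ℂ)))) fun _ z => le_rfl

lemma integrable_mul_osc [MeasureSpace V] [BorelSpace V] (P : Phase V) {a : V → ℂ} (ha : Integrable a) :
    Integrable (fun z => a z * P.osc z) :=
  ha.mul_bdd (c := 1) P.contDiff_osc.continuous.aestronglyMeasurable
    (Filter.Eventually.of_forall fun z => (P.norm_osc z).le)

variable [FiniteDimensional ℝ V]

/-- A decay exponent that makes amplitudes integrable. -/
def decayExp (V : Type*) [NormedAddCommGroup V] [NormedSpace ℝ V] : ℤ :=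
  -((Module.finrank ℝ V + 1 : ℕ) : ℤ)

variable [MeasureSpace V] [BorelSpace V] [(volume : Measure V).IsAddHaarMeasure]

lemma integrable_jap : Integrable (fun z : V => jap z ^ decayExp V) := by
  have h := integrable_one_add_norm (E := V) (μ := volume)
    (r := ((Module.finrank ℝ V + 1 : ℕ) : ℝ)) (by push_cast; linarith)
  refine h.congr (Filter.Eventually.of_forall fun z => ?_)
  simp only [decayExp, jap]
  rw [Real.rpow_neg (by positivity), Real.rpow_natCast, zpow_neg, zpow_natCast]

lemma AmpFamily.integrable {a : V → ℂ} (ha : Amp (fun z => jap z ^ decayExp V) a) : Integrable a := by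
  obtain ⟨C, hC, h⟩ := ha.exists_norm_le
  exact (integrable_jap.const_mul C).mono' (ha.smooth ()).continuous.aestronglyMeasurable
    (Filter.Eventually.of_forall fun z => h () z)

lemma integral_fderiv_apply_eq_zero {g : V → ℂ} (hg : Differentiable ℝ g) (v : V)
    (h1 : Integrable g) (h2 : Integrable (fun z => fderiv ℝ g z v)) :
    ∫ z, fderiv ℝ g z v = 0 := by
  have := integral_mul_fderiv_eq_neg_fderiv_mul_of_integrable (μ := (volume : Measure V))
    (f := fun _ => (1 : ℂ)) (g := g) (v := v) (by simp) (by simpa using h2) (by simpa using h1)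
    (fun _ _ => differentiableAt_const _) (fun _ _ => hg _)
  simpa using this

namespace Phase

variable (P : Phase V)

/-- One integration by parts: since `(1 + ∂_v) e^{iΦ} = (1 + iℓ_v) e^{iΦ}`, the amplitude may be
replaced by `b - ∂_v b` with `b = (1 + iℓ_v)⁻¹ a`, which gains one power of `ℓ_v`. -/
lemma exists_gain_one {ι : Type*} {w : ι → V → ℝ} {a : ι → V → ℂ} (ha : AmpFamily w a)
    (hd : ∀ i, Amp (fun z => jap z ^ decayExp V) (a i)) (j : Fin P.card) :
    ∃ b : ι → V → ℂ, AmpFamily (fun i z => (1 + |P.form j z|)⁻¹ * w i z) b ∧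
      (∀ i, Amp (fun z => jap z ^ decayExp V) (b i)) ∧
      ∀ i, ∫ z, b i z * P.osc z = ∫ z, a i z * P.osc z := by
  set m : V → ℂ := fun z => (1 + Complex.I * (P.form j z : ℂ))⁻¹ with hm
  have hA := amp_inv_one_add (P.form j)
  have h1 := (hA.reindex (fun _ : ι => ())).mul ha
  have h2 : ∀ i, Amp (fun z => jap z ^ decayExp V) (fun z => m z * a i z) := fun i =>
    (hA.mul (hd i)).mono zero_le_one fun _ z => by
      rw [one_mul]
      refine mul_le_of_le_one_left (jap_zpow_nonneg z _) (inv_le_one_of_one_le₀ ?_)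
      have := abs_nonneg (P.form j z)
      linarith
  refine ⟨fun i z => m z * a i z - fderiv ℝ (fun z => m z * a i z) z (P.dir j),
    h1.sub (h1.fderiv_apply _), fun i => (h2 i).sub ((h2 i).fderiv_apply _), fun i => ?_⟩
  have hs := (h2 i).smooth ()
  have hI := integrable_mul_osc P (h2 i).integrable
  have hI' := integrable_mul_osc P ((h2 i).fderiv_apply (P.dir j)).integrable
  have hI'' := integrable_mul_osc P (hd i).integrable
  have key : ∀ z, fderiv ℝ (fun z => (m z * a i z) * P.osc z) z (P.dir j) =
      a i z * P.osc z -
        (m z * a i z - fderiv ℝ (fun z => m z * a i z) z (P.dir j)) * P.osc z := fun z => by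
    rw [P.fderiv_mul_osc hs]
    have hne : 1 + Complex.I * (P.form j z : ℂ) ≠ 0 := fun h => by
      have := congrArg Complex.re h
      simp at this
    have : (1 + Complex.I * (P.form j z : ℂ)) * m z = 1 := mul_inv_cancel₀ hne
    linear_combination (a i z * P.osc z) * this
  have hI3 : Integrable (fun z =>
      (m z * a i z - fderiv ℝ (fun z => m z * a i z) z (P.dir j)) * P.osc z) := by
    simp only [sub_mul]
    exact hI.sub hI'
  have h0 := integral_fderiv_apply_eq_zero (g := fun z => (m z * a i z) * P.osc z)
    ((hs.mul P.contDiff_osc).differentiable (by simp)) (P.dir j) hI (by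
      simp only [key]
      exact hI''.sub hI3)
  simp only [key] at h0
  rw [integral_sub hI'' hI3, sub_eq_zero] at h0
  exact h0.symm

/-- Integrating by parts once in every direction gains a factor `⟨z⟩⁻¹`. -/
lemma exists_gain {ι : Type*} {w : ι → V → ℝ} {a : ι → V → ℂ} (ha : AmpFamily w a)
    (hw : ∀ i z, 0 ≤ w i z) (hd : ∀ i, Amp (fun z => jap z ^ decayExp V) (a i)) :
    ∃ b : ι → V → ℂ, AmpFamily (fun i z => (jap z)⁻¹ * w i z) b ∧
      (∀ i, Amp (fun z => jap z ^ decayExp V) (b i)) ∧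
      ∀ i, ∫ z, b i z * P.osc z = ∫ z, a i z * P.osc z := by
  classical
  have key : ∀ s : Finset (Fin P.card), ∃ b : ι → V → ℂ,
      AmpFamily (fun i z => (∏ j ∈ s, (1 + |P.form j z|)⁻¹) * w i z) b ∧
      (∀ i, Amp (fun z => jap z ^ decayExp V) (b i)) ∧
      ∀ i, ∫ z, b i z * P.osc z = ∫ z, a i z * P.osc z := by
    intro s
    induction s using Finset.induction_on with
    | empty => exact ⟨a, by simpa using ha, hd, fun _ => rfl⟩
    | insert j s hj ih =>
      obtain ⟨b, h1, h2, h3⟩ := ih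
      obtain ⟨b', h1', h2', h3'⟩ := P.exists_gain_one h1 h2 j
      refine ⟨b', ?_, h2', fun i => (h3' i).trans (h3 i)⟩
      simpa only [Finset.prod_insert hj, mul_assoc] using h1'
  obtain ⟨b, h1, h2, h3⟩ := key Finset.univ
  obtain ⟨K, hK, h⟩ := P.exists_jap_le_prod
  refine ⟨b, h1.mono hK fun i z => ?_, h2, h3⟩
  rw [← mul_assoc]
  exact mul_le_mul_of_nonneg_right (h z) (hw i z)

/-- The main estimate: an integral with integrable amplitude is bounded by the constants of a
polynomial bound of the amplitude and its derivatives. The bound may have any order `k`, and only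
the factors `lam i` enter the estimate, so it survives the removal of cutoffs. -/
lemma exists_norm_integral_le {ι : Type*} {lam : ι → ℝ} {k : ℤ} {a : ι → V → ℂ}
    (hl : ∀ i, 0 ≤ lam i) (ha : AmpFamily (fun i z => lam i * jap z ^ k) a)
    (hd : ∀ i, Amp (fun z => jap z ^ decayExp V) (a i)) :
    ∃ C, 0 ≤ C ∧ ∀ i, ‖∫ z, a i z * P.osc z‖ ≤ C * lam i := by
  have key : ∀ n : ℕ, ∃ b : ι → V → ℂ, AmpFamily (fun i z => lam i * jap z ^ (k - n)) b ∧
      (∀ i, Amp (fun z => jap z ^ decayExp V) (b i)) ∧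
      ∀ i, ∫ z, b i z * P.osc z = ∫ z, a i z * P.osc z := by
    intro n
    induction n with
    | zero => exact ⟨a, by simpa using ha, hd, fun _ => rfl⟩
    | succ n ih =>
      obtain ⟨b, h1, h2, h3⟩ := ih
      obtain ⟨b', h1', h2', h3'⟩ := P.exists_gain h1
        (fun i z => mul_nonneg (hl i) (jap_zpow_nonneg z _)) h2
      refine ⟨b', h1'.congr_weight fun i z => ?_, h2', fun i => (h3' i).trans (h3 i)⟩
      have : k - ((n + 1 : ℕ) : ℤ) = -1 + (k - n) := by push_cast; ring
      rw [this, zpow_add₀ (jap_pos z).ne', zpow_neg_one]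
      ring
  -- as many gains as lead from the order `k` to an integrable order
  obtain ⟨b, h1, -, h3⟩ := key (k - decayExp V).toNat
  obtain ⟨C, hC, h⟩ := h1.exists_norm_le
  have h0 : 0 ≤ ∫ z : V, jap z ^ decayExp V := integral_nonneg fun z => jap_zpow_nonneg z _
  refine ⟨C * ∫ z : V, jap z ^ decayExp V, by positivity, fun i => ?_⟩
  rw [← h3 i, mul_right_comm, ← integral_const_mul]
  refine norm_integral_le_of_norm_le (integrable_jap.const_mul _)
    (Filter.Eventually.of_forall fun z => ?_)
  rw [norm_mul, P.norm_osc, mul_one, mul_assoc]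
  refine (h i z).trans ?_
  have := hl i
  refine mul_le_mul_of_nonneg_left (mul_le_mul_of_nonneg_left ?_ this) hC
  exact jap_zpow_le_of_le z (by have := Int.self_le_toNat (k - decayExp V); linarith)

end Phase

end Osc

/-! ### Existence and continuity of oscillatory integrals -/

section OscIntegral

open MeasureTheory Filter

variable {V : Type*} [NormedAddCommGroup V] [NormedSpace ℝ V]

lemma amp_decay_cutoff_mul (χ : 𝓢(V, ℂ)) {ε : ℝ} (hε : 0 < ε) {k : ℤ} {a : V → ℂ}
    (ha : Amp (fun z => jap z ^ k) a) :
    Amp (fun z => jap z ^ decayExp V) (fun z => χ (ε • z) * a z) := by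
  refine ((amp_cutoff χ hε (k - decayExp V).toNat).mul ha).mono zero_le_one fun _ z => ?_
  rw [one_mul, ← zpow_add₀ (jap_pos z).ne']
  refine jap_zpow_le_of_le z ?_
  have := Int.self_le_toNat (k - decayExp V)
  linarith

variable [MeasureSpace V]

lemma HasOscIntegral.unique [FiniteDimensional ℝ V] {a : V → ℂ} {I J : ℂ}
    (hI : HasOscIntegral a I) (hJ : HasOscIntegral a J) : I = J := by
  obtain ⟨χ, hχ⟩ := exists_schwartz_eq_one V
  exact tendsto_nhds_unique (hI χ hχ).2 (hJ χ hχ).2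

lemma HasOscIntegral.add {a b : V → ℂ} {I J : ℂ}
    (hI : HasOscIntegral a I) (hJ : HasOscIntegral b J) :
    HasOscIntegral (fun z => a z + b z) (I + J) := fun χ hχ => by
  have h1 := hI χ hχ
  have h2 := hJ χ hχ
  refine ⟨fun ε hε => ?_, (h1.2.add h2.2).congr' ?_⟩
  · simp only [mul_add]
    exact (h1.1 ε hε).add (h2.1 ε hε)
  · filter_upwards [self_mem_nhdsWithin] with ε hε
    simp only [mul_add]
    exact (integral_add (h1.1 ε hε) (h2.1 ε hε)).symm

lemma HasOscIntegral.const_mul {a : V → ℂ} {I : ℂ} (c : ℂ)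
    (hI : HasOscIntegral a I) : HasOscIntegral (fun z => c * a z) (c * I) := fun χ hχ => by
  have h1 := hI χ hχ
  refine ⟨fun ε hε => ?_, (h1.2.const_mul c).congr fun ε => ?_⟩
  · simpa only [mul_left_comm] using (h1.1 ε hε).const_mul c
  · simp only [mul_left_comm _ c, integral_const_mul]

/-- For an absolutely convergent integral the regularisation changes nothing. -/
lemma hasOscIntegral_of_integrable {a : V → ℂ} [BorelSpace V] [SecondCountableTopology V]
    (ha : Integrable a) : HasOscIntegral a (∫ z, a z) := fun χ hχ => by
  obtain ⟨C, hC, h⟩ := (amp_schwartz_one χ).exists_norm_le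
  have h' : ∀ z, ‖χ z‖ ≤ C := fun z => by simpa using h () z
  have hm : ∀ ε : ℝ, AEStronglyMeasurable (fun z => χ (ε • z)) (volume : Measure V) := fun ε =>
    (χ.continuous.comp (continuous_const_smul ε)).aestronglyMeasurable
  refine ⟨fun ε _ => ha.bdd_mul (hm ε) (Eventually.of_forall fun z => h' _), ?_⟩
  refine tendsto_integral_filter_of_dominated_convergence (fun z => C * ‖a z‖)
    (Eventually.of_forall fun ε => (hm ε).mul ha.1)
    (Eventually.of_forall fun ε => Eventually.of_forall fun z => ?_) (ha.norm.const_mul C)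
    (Eventually.of_forall fun z => ?_)
  · rw [norm_mul]
    exact mul_le_mul_of_nonneg_right (h' _) (norm_nonneg _)
  · have h1 : Tendsto (fun ε : ℝ => χ (ε • z) * a z) (𝓝 0) (𝓝 (χ ((0 : ℝ) • z) * a z)) :=
      Continuous.tendsto (f := fun ε : ℝ => χ (ε • z) * a z)
        ((χ.continuous.comp (continuous_id.smul continuous_const)).mul continuous_const) 0
    rw [zero_smul, hχ, one_mul] at h1
    exact h1.mono_left nhdsWithin_le_nhds

namespace Phase

variable (P : Phase V)

open Classical in
/-- The oscillatory integral `os-∫ a(z) e^{iΦ(z)} dz` (zero if it does not exist). -/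
def oscInt (a : V → ℂ) : ℂ :=
  if h : ∃ I, HasOscIntegral (fun z => a z * P.osc z) I then h.choose else 0

variable {P} in
lemma _root_.StarAlg.HasOscIntegral.oscInt_eq [FiniteDimensional ℝ V] {a : V → ℂ} {I : ℂ}
    (h : HasOscIntegral (fun z => a z * P.osc z) I) : P.oscInt a = I := by
  have h' : ∃ I, HasOscIntegral (fun z => a z * P.osc z) I := ⟨I, h⟩
  rw [oscInt, dif_pos h']
  exact h'.choose_spec.unique h

lemma oscInt_eq_integral [FiniteDimensional ℝ V] [BorelSpace V] {a : V → ℂ} (ha : Integrable a) :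
    P.oscInt a = ∫ z, a z * P.osc z :=
  (hasOscIntegral_of_integrable (integrable_mul_osc P ha)).oscInt_eq

end Phase

variable [FiniteDimensional ℝ V] [BorelSpace V] [(volume : Measure V).IsAddHaarMeasure]

namespace Phase

variable (P : Phase V)

/-- Two regularisations differ by `O(ε + ε')`: the amplitude times the difference of the cutoffs is
of one order higher, with constant `ε + ε'`, and the order does not matter. -/
lemma exists_norm_cutoff_sub_le {χ χ' : 𝓢(V, ℂ)} (h : χ 0 = χ' 0) {k : ℤ} {a : V → ℂ}
    (ha : Amp (fun z => jap z ^ k) a) :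
    ∃ C, 0 ≤ C ∧ ∀ ε ε' : Scale, ‖(∫ z, χ (ε.1 • z) * (a z * P.osc z)) -
      ∫ z, χ' (ε'.1 • z) * (a z * P.osc z)‖ ≤ C * (ε.1 + ε'.1) := by
  have h1 := ((ampFamily_cutoff_sub χ).reindex (Prod.fst : Scale × Scale → Scale)).mono
    (w' := fun e z => (e.1.1 + e.2.1) * jap z) zero_le_one fun e z => by
      rw [one_mul]
      exact mul_le_mul_of_nonneg_right (le_add_of_nonneg_right e.2.2.1.le) (jap_pos z).le
  have h2 := ((ampFamily_cutoff_sub χ').reindex (Prod.snd : Scale × Scale → Scale)).mono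
    (w' := fun e z => (e.1.1 + e.2.1) * jap z) zero_le_one fun e z => by
      rw [one_mul]
      exact mul_le_mul_of_nonneg_right (le_add_of_nonneg_left e.1.2.1.le) (jap_pos z).le
  have h3 := ((h1.sub h2).mul (ha.reindex fun _ : Scale × Scale => ())).congr_weight
    (w' := fun e z => (e.1.1 + e.2.1) * jap z ^ (k + 1)) fun e z => by
      rw [zpow_add_one₀ (jap_pos z).ne']
      ring
  have h4 : ∀ e : Scale × Scale, ∀ z, (χ (e.1.1 • z) - χ 0 - (χ' (e.2.1 • z) - χ' 0)) * a z =
      χ (e.1.1 • z) * a z - χ' (e.2.1 • z) * a z := fun e z => by rw [h]; ring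
  simp only [h4] at h3
  have hd : ∀ (χ : 𝓢(V, ℂ)) (ε : Scale), _ := fun χ ε => amp_decay_cutoff_mul χ ε.2.1 ha
  obtain ⟨C, hC, hle⟩ := P.exists_norm_integral_le
    (fun e => add_nonneg e.1.2.1.le e.2.2.1.le) h3 fun e => (hd χ e.1).sub (hd χ' e.2)
  refine ⟨C, hC, fun ε ε' => ?_⟩
  have := hle (ε, ε')
  simp only [sub_mul] at this
  rw [integral_sub (integrable_mul_osc P (hd χ ε).integrable)
    (integrable_mul_osc P (hd χ' ε').integrable)] at this
  simpa only [mul_assoc] using this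

/-- Symbols of any order have oscillatory integrals. -/
lemma exists_hasOscIntegral {k : ℤ} {a : V → ℂ} (ha : Amp (fun z => jap z ^ k) a) :
    ∃ I, HasOscIntegral (fun z => a z * P.osc z) I := by
  obtain ⟨χ₀, h₀⟩ := exists_schwartz_eq_one V
  obtain ⟨C₀, hC₀, hle₀⟩ := P.exists_norm_cutoff_sub_le (χ := χ₀) (χ' := χ₀) rfl ha
  have hcauchy : CauchySeq fun n => ∫ z, χ₀ ((scaleSeq n).1 • z) * (a z * P.osc z) := by
    refine cauchySeq_of_le_tendsto_0 (fun n => C₀ * ((scaleSeq n).1 + (scaleSeq n).1)) ?_ ?_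
    · intro n m N hn hm
      rw [dist_eq_norm]
      refine (hle₀ (scaleSeq n) (scaleSeq m)).trans ?_
      have := scaleSeq_anti hn
      have := scaleSeq_anti hm
      gcongr
    · simpa using (tendsto_scaleSeq.add tendsto_scaleSeq).const_mul C₀
  obtain ⟨I, hI⟩ := cauchySeq_tendsto_of_complete hcauchy
  refine ⟨I, fun χ hχ => ⟨fun ε hε => ?_, ?_⟩⟩
  · simpa only [mul_assoc] using integrable_mul_osc P (amp_decay_cutoff_mul χ hε ha).integrable
  · obtain ⟨C, hC, hle⟩ := P.exists_norm_cutoff_sub_le (χ := χ) (χ' := χ₀) (hχ.trans h₀.symm) ha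
    have hle' : ∀ ε : Scale, ‖(∫ z, χ (ε.1 • z) * (a z * P.osc z)) - I‖ ≤ C * ε.1 := fun ε => by
      have h1 : Tendsto (fun n => C * (ε.1 + (scaleSeq n).1)) atTop (𝓝 (C * ε.1)) := by
        simpa using (tendsto_const_nhds.add tendsto_scaleSeq).const_mul C
      exact le_of_tendsto_of_tendsto ((tendsto_const_nhds.sub hI).norm) h1
        (Eventually.of_forall fun n => hle ε (scaleSeq n))
    rw [tendsto_iff_norm_sub_tendsto_zero]
    refine squeeze_zero' (g := fun ε => C * ε) (Eventually.of_forall fun _ => norm_nonneg _) ?_ ?_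
    · filter_upwards [Ioc_mem_nhdsGT (zero_lt_one' ℝ)] with ε hε
      exact hle' ⟨ε, hε⟩
    · have : Tendsto (fun ε : ℝ => C * ε) (𝓝 0) (𝓝 (C * 0)) := tendsto_id.const_mul C
      rw [mul_zero] at this
      exact this.mono_left nhdsWithin_le_nhds

lemma hasOscIntegral {k : ℤ} {a : V → ℂ} (ha : Amp (fun z => jap z ^ k) a) :
    HasOscIntegral (fun z => a z * P.osc z) (P.oscInt a) := by
  obtain ⟨I, hI⟩ := P.exists_hasOscIntegral ha
  rwa [hI.oscInt_eq]

lemma oscInt_add {k l : ℤ} {a b : V → ℂ} (ha : Amp (fun z => jap z ^ k) a)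
    (hb : Amp (fun z => jap z ^ l) b) :
    P.oscInt (fun z => a z + b z) = P.oscInt a + P.oscInt b := by
  have h := (P.hasOscIntegral ha).add (P.hasOscIntegral hb)
  simp only [← add_mul] at h
  exact h.oscInt_eq

lemma oscInt_const_mul {k : ℤ} {a : V → ℂ} (c : ℂ) (ha : Amp (fun z => jap z ^ k) a) :
    P.oscInt (fun z => c * a z) = c * P.oscInt a := by
  have h := (P.hasOscIntegral ha).const_mul c
  simp only [← mul_assoc] at h
  exact h.oscInt_eq

lemma oscInt_sub {k l : ℤ} {a b : V → ℂ} (ha : Amp (fun z => jap z ^ k) a)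
    (hb : Amp (fun z => jap z ^ l) b) :
    P.oscInt (fun z => a z - b z) = P.oscInt a - P.oscInt b := by
  have h := P.oscInt_add ha hb.neg
  have h' := P.oscInt_const_mul (-1) hb
  simp only [neg_one_mul] at h'
  simp only [sub_eq_add_neg]
  rw [h, h']

/-- Oscillatory integrals depend continuously on the amplitude, uniformly over families. -/
lemma exists_norm_oscInt_le {ι : Type*} {lam : ι → ℝ} {k : ℤ} {a : ι → V → ℂ}
    (hl : ∀ i, 0 ≤ lam i) (ha : AmpFamily (fun i z => lam i * jap z ^ k) a) :
    ∃ C, 0 ≤ C ∧ ∀ i, ‖P.oscInt (a i)‖ ≤ C * lam i := by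
  obtain ⟨χ, hχ⟩ := exists_schwartz_eq_one V
  have hai : ∀ i, Amp (fun z => jap z ^ k) (a i) := fun i => (ha.single i).mono (hl i)
    fun _ z => le_rfl
  have h1 := (((ampFamily_cutoff χ).reindex (Prod.snd : ι × Scale → Scale)).mul
    (ha.reindex Prod.fst)).congr_weight (w' := fun e z => lam e.1 * jap z ^ k)
    fun e z => one_mul _
  obtain ⟨C, hC, h⟩ := P.exists_norm_integral_le (fun e : ι × Scale => hl e.1) h1
    fun e => amp_decay_cutoff_mul χ e.2.2.1 (hai e.1)
  refine ⟨C, hC, fun i => le_of_tendsto ((P.hasOscIntegral (hai i)) χ hχ).2.norm ?_⟩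
  filter_upwards [Ioc_mem_nhdsGT (zero_lt_one' ℝ)] with ε hε
  simpa only [mul_assoc] using h (i, ⟨ε, hε⟩)

/-- Passage to the limit in an oscillatory integral. The amplitudes may converge with a loss in the
order of growth. -/
lemma tendsto_oscInt {k l : ℤ} {a : V → ℂ} {b : Scale → V → ℂ} (ha : Amp (fun z => jap z ^ k) a)
    (hb : AmpFamily (fun ε z => ε.1 * jap z ^ l) (fun ε z => b ε z - a z)) :
    Tendsto (fun n => P.oscInt (b (scaleSeq n))) atTop (𝓝 (P.oscInt a)) := by
  obtain ⟨C, hC, h⟩ := P.exists_norm_oscInt_le (fun ε : Scale => ε.2.1.le) hb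
  rw [tendsto_iff_norm_sub_tendsto_zero]
  refine squeeze_zero (g := fun n => C * (scaleSeq n).1) (fun _ => norm_nonneg _) (fun n => ?_)
    (by simpa using tendsto_scaleSeq.const_mul C)
  have h1 : Amp (fun z => jap z ^ l) (fun z => b (scaleSeq n) z - a z) :=
    (hb.single (scaleSeq n)).mono (scaleSeq n).2.1.le fun _ _ => le_rfl
  have h2 := P.oscInt_add h1 ha
  simp only [sub_add_cancel] at h2
  rw [h2, add_sub_cancel_right]
  exact h (scaleSeq n)

/-- Integration by parts: a linear form of the phase is traded for a derivative of the amplitude. -/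
lemma oscInt_form_mul {k : ℤ} {a : V → ℂ} (ha : Amp (fun z => jap z ^ k) a)
    (j : Fin P.card) :
    P.oscInt (fun z => (P.form j z : ℂ) * a z) =
      Complex.I * P.oscInt (fun z => fderiv ℝ a z (P.dir j)) := by
  have hf : Amp (fun z => jap z ^ (k + 1)) (fun z => (P.form j z : ℂ) * a z) :=
    ((amp_linear (P.form j)).mul ha).congr_weight fun _ z => by
      rw [zpow_add_one₀ (jap_pos z).ne', mul_comm]
  obtain ⟨χ, hχ⟩ := exists_schwartz_eq_one V
  have h1 := (P.hasOscIntegral hf) χ hχ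
  have h2 := (P.hasOscIntegral (ha.fderiv_apply (P.dir j))) χ hχ
  have hB := (ampFamily_fderiv_cutoff χ (P.dir j)).mul (ha.reindex fun _ : Scale => ())
  have hBd : ∀ ε : Scale, Amp (fun z => jap z ^ decayExp V)
      (fun z => fderiv ℝ (fun z => χ (ε.1 • z)) z (P.dir j) * a z) := fun ε => by
    have h := amp_decay_cutoff_mul (χ : 𝓢(V, ℂ)) ε.2.1 ha
    have h3 := h.fderiv_apply (P.dir j)
    have h4 := amp_decay_cutoff_mul χ ε.2.1 (ha.fderiv_apply (P.dir j))
    convert h3.sub h4 using 2 with z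
    have e1 := (((ampFamily_cutoff χ).smooth ε).differentiable (by simp) z).hasFDerivAt
    have e2 := ((ha.smooth ()).differentiable (by simp) z).hasFDerivAt
    have e3 : fderiv ℝ (fun z => χ (ε.1 • z) * a z) z = _ := (e1.mul e2).fderiv
    rw [e3]
    simp
    ring
  obtain ⟨C, hC, h⟩ := P.exists_norm_integral_le (fun ε => ε.2.1.le) hB hBd
  have key : ∀ ε : Scale, Complex.I * (∫ z, χ (ε.1 • z) * ((P.form j z : ℂ) * a z * P.osc z)) +
      (∫ z, χ (ε.1 • z) * (fderiv ℝ a z (P.dir j) * P.osc z)) =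
      -∫ z, fderiv ℝ (fun z => χ (ε.1 • z)) z (P.dir j) * a z * P.osc z := fun ε => by
    have hs := ((ampFamily_cutoff χ).smooth ε).mul (ha.smooth ())
    have e0 := amp_decay_cutoff_mul (χ : 𝓢(V, ℂ)) ε.2.1 ha
    have e1 := integrable_mul_osc P (hBd ε).integrable
    have e2 := (h1.1 ε.1 ε.2.1).const_mul Complex.I
    have e3 := h2.1 ε.1 ε.2.1
    have e5 : ∀ z, fderiv ℝ (fun z => χ (ε.1 • z) * a z * P.osc z) z (P.dir j) =
        (Complex.I * (χ (ε.1 • z) * ((P.form j z : ℂ) * a z * P.osc z)) +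
        χ (ε.1 • z) * (fderiv ℝ a z (P.dir j) * P.osc z)) +
        fderiv ℝ (fun z => χ (ε.1 • z)) z (P.dir j) * a z * P.osc z := fun z => by
      rw [P.fderiv_mul_osc hs]
      have d1 := (((ampFamily_cutoff χ).smooth ε).differentiable (by simp) z).hasFDerivAt
      have d2 := ((ha.smooth ()).differentiable (by simp) z).hasFDerivAt
      have d3 : fderiv ℝ (fun z => χ (ε.1 • z) * a z) z = _ := (d1.mul d2).fderiv
      rw [d3]
      simp
      ring
    have e4 := integral_fderiv_apply_eq_zero (g := fun z => χ (ε.1 • z) * a z * P.osc z)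
      ((hs.mul P.contDiff_osc).differentiable (by simp)) (P.dir j)
      (integrable_mul_osc P e0.integrable) (by
        simp only [e5]
        exact (e2.add e3).add e1)
    simp only [e5] at e4
    have e6 := integral_add (e2.add e3) e1
    have e7 := integral_add e2 e3
    simp only [Pi.add_apply] at e6
    rw [e6, e7, integral_const_mul] at e4
    linear_combination e4
  -- the term in which the derivative falls on the cutoff is `O(ε)`
  have hlim : Tendsto (fun ε : ℝ => Complex.I *
      (∫ z, χ (ε • z) * ((P.form j z : ℂ) * a z * P.osc z)) +
      (∫ z, χ (ε • z) * (fderiv ℝ a z (P.dir j) * P.osc z))) (𝓝[>] 0) (𝓝 0) := by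
    refine squeeze_zero_norm' (a := fun ε => C * ε) ?_ ?_
    · filter_upwards [Ioc_mem_nhdsGT (zero_lt_one' ℝ)] with ε hε
      rw [key ⟨ε, hε⟩, norm_neg]
      exact h ⟨ε, hε⟩
    · have : Tendsto (fun ε : ℝ => C * ε) (𝓝 0) (𝓝 (C * 0)) := tendsto_id.const_mul C
      rw [mul_zero] at this
      exact this.mono_left nhdsWithin_le_nhds
  have hlim' := tendsto_nhds_unique hlim ((h1.2.const_mul Complex.I).add h2.2)
  linear_combination Complex.I * hlim' + P.oscInt (fun z => (P.form j z : ℂ) * a z) * Complex.I_sq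

end Phase

end OscIntegral

/-! ### The Moyal product as an oscillatory integral -/

section Moyal

open MeasureTheory Filter

instance isAddHaarMeasure_volume_prod {V W : Type*} [NormedAddCommGroup V] [MeasureSpace V]
    [BorelSpace V] [NormedAddCommGroup W] [MeasureSpace W] [BorelSpace W]
    [SecondCountableTopology V] [SecondCountableTopology W] [SigmaFinite (volume : Measure V)]
    [SigmaFinite (volume : Measure W)]
    [(volume : Measure V).IsAddHaarMeasure] [(volume : Measure W).IsAddHaarMeasure] :
    (volume : Measure (V × W)).IsAddHaarMeasure :=
  Measure.prod.instIsAddHaarMeasure volume volume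

/-- The `i`-th coordinate of the plane. -/
def crd (i : Fin 2) : Plane →L[ℝ] ℝ := EuclideanSpace.proj i

@[simp] lemma crd_apply (i : Fin 2) (x : Plane) : crd i x = x i := rfl

lemma hasFDerivAt_crd_comp {V : Type*} [NormedAddCommGroup V] [NormedSpace ℝ V]
    (T : V →L[ℝ] Plane) (i : Fin 2) (z : V) :
    HasFDerivAt (fun z => T z i) ((crd i).comp T) z :=
  ((crd i).comp T).hasFDerivAt

/-- The symplectic form `ω((s,t),(s',t')) = ts' - st'`. -/
def symp (p q : Plane) : ℝ := p 1 * q 0 - p 0 * q 1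

lemma plane_ext {x y : Plane} (h0 : x 0 = y 0) (h1 : x 1 = y 1) : x = y := by
  ext i
  fin_cases i
  · exact h0
  · exact h1

/-- The phase of the Moyal product. -/
def moyalPhase : Phase (Plane × Plane) where
  toFun z := symp z.1 z.2
  contDiff := by
    unfold symp
    fun_prop
  card := 4
  dir := ![(0, basisVec 0), (0, basisVec 1), (basisVec 0, 0), (basisVec 1, 0)]
  form := ![(crd 1).comp (.fst ℝ Plane Plane), -(crd 0).comp (.fst ℝ Plane Plane),
    -(crd 1).comp (.snd ℝ Plane Plane), (crd 0).comp (.snd ℝ Plane Plane)]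
  fderiv_apply j z := by
    have h : ∀ (i : Fin 2), HasFDerivAt (fun z : Plane × Plane => z.1 i) _ z := fun i =>
      hasFDerivAt_crd_comp (.fst ℝ Plane Plane) i z
    have h' : ∀ (i : Fin 2), HasFDerivAt (fun z : Plane × Plane => z.2 i) _ z := fun i =>
      hasFDerivAt_crd_comp (.snd ℝ Plane Plane) i z
    have hd : fderiv ℝ (fun z : Plane × Plane => symp z.1 z.2) z = _ :=
      (((h 1).mul (h' 0)).sub ((h 0).mul (h' 1))).fderiv
    rw [hd]
    fin_cases j <;> simp [basisVec]
  eq_zero z h := by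
    have h0 := h 0
    have h1 := h 1
    have h2 := h 2
    have h3 := h 3
    simp at h0 h1 h2 h3
    exact Prod.ext (plane_ext h1 h0) (plane_ext h3 h2)

lemma moyalPhase_osc (z : Plane × Plane) :
    moyalPhase.osc z = Complex.exp (Complex.I * (symp z.1 z.2 : ℝ)) := rfl

/-- The amplitude of the Moyal product at `w`. -/
def moyalAmp (c : ℝ) (f g : Plane → ℂ) (w : Plane) (z : Plane × Plane) : ℂ :=
  f (w + c • z.1) * g (w + z.2)

/-- The Moyal product with deformation parameter `c = ħ/2`,
`(2π)⁻² os-∬ f(w + c p) g(w + q) e^{iω(p,q)} dp dq`. The parameter `c` is any real number here, since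
the expansion of the product is obtained by differentiation in `c`. -/
def moyal (c : ℝ) (f g : Plane → ℂ) (w : Plane) : ℂ :=
  1 / (2 * (Real.pi : ℂ)) ^ 2 * moyalPhase.oscInt (moyalAmp c f g w)

/-- Smooth functions all of whose derivatives are bounded. The Moyal product is studied on this class,
which contains the symbols of order zero. -/
abbrev CB (f : Plane → ℂ) : Prop := Amp (fun _ => 1) f

lemma CB.zpow {f : Plane → ℂ} (h : CB f) : Amp (fun z => jap z ^ (0 : ℤ)) f :=
  h.congr_weight fun _ _ => by simp

lemma CB.of_family {ι : Type*} {c : ι → ℝ} {f : ι → Plane → ℂ}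
    (h : AmpFamily (fun i _ => c i) f) (i : ι) : CB (f i) :=
  (h.single i).mono (abs_nonneg (c i)) fun _ _ => by simpa using le_abs_self (c i)

section Families

variable {ι : Type*} {lam mu : ι → ℝ} {k l : ℤ} {f g : ι → Plane → ℂ}

/-- The points `w` and the parameters `c` are made part of the index of the family, so that estimates
of oscillatory integrals are uniform in `c` and explicit in `w`. -/
lemma ampFamily_comp_fst (hl : ∀ i, 0 ≤ lam i) (hf : AmpFamily (fun i z => lam i * jap z ^ k) f)
    (R : ℝ) :
    AmpFamily (fun (i : ι × Plane × Set.Icc (-R) R) (z : Plane × Plane) =>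
      lam i.1 * jap i.2.1 ^ k * jap z ^ |k|) (fun i z => f i.1 (i.2.1 + i.2.2.1 • z.1)) := by
  have h := (hf.reindex (Prod.fst : ι × Plane × Set.Icc (-R) R → ι)).comp_affine
    (fun i => i.2.2.1 • ContinuousLinearMap.fst ℝ Plane Plane) (fun i => i.2.1) (K := R) fun i => by
      rw [norm_smul]
      have h2 := abs_le.2 i.2.2.2
      exact (mul_le_of_le_one_right (norm_nonneg _) (ContinuousLinearMap.norm_fst_le ℝ Plane Plane)).trans h2
  have h' := h.mono (K := (max 1 R) ^ |k|)
    (w' := fun i z => lam i.1 * jap i.2.1 ^ k * jap z ^ |k|) (by positivity) fun i z => by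
      -- Peetre's inequality separates the base point from the integration variable
      have h1 := jap_add_zpow_le i.2.1 (i.2.2.1 • z.1) k
      have h2 : jap (i.2.2.1 • z.1) ≤ max 1 R * jap z := by
        refine jap_le_of_norm_le (le_max_left _ _) ?_
        rw [norm_smul]
        exact mul_le_mul ((abs_le.2 i.2.2.2).trans (le_max_right _ _)) (norm_fst_le z)
          (norm_nonneg _) (by positivity)
      have h3 := zpow_le_zpow_left₀ (abs_nonneg k) (jap_pos _).le h2
      rw [mul_zpow] at h3
      have h4 := hl i.1
      have h5 := jap_zpow_nonneg i.2.1 k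
      have e : (i.2.2.1 • ContinuousLinearMap.fst ℝ Plane Plane) z + i.2.1 =
        i.2.1 + i.2.2.1 • z.1 := add_comm _ _
      rw [e]
      calc _ ≤ lam i.1 * (jap i.2.1 ^ k * (max 1 R ^ |k| * jap z ^ |k|)) := by
            gcongr
            exact h1.trans (by gcongr)
        _ = _ := by ring
  simpa [add_comm] using h'

lemma ampFamily_comp_snd (hl : ∀ i, 0 ≤ lam i) (hf : AmpFamily (fun i z => lam i * jap z ^ k) f) :
    AmpFamily (fun (i : ι × Plane) (z : Plane × Plane) => lam i.1 * jap i.2 ^ k * jap z ^ |k|)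
      (fun i z => f i.1 (i.2 + z.2)) := by
  have h := (hf.reindex (Prod.fst : ι × Plane → ι)).comp_affine
    (fun i => ContinuousLinearMap.snd ℝ Plane Plane) (fun i => i.2) (K := 1) fun i =>
      ContinuousLinearMap.norm_snd_le ℝ Plane Plane
  have h' := h.mono (K := 1)
    (w' := fun i z => lam i.1 * jap i.2 ^ k * jap z ^ |k|) (by positivity) fun i z => by
      have h1 := jap_add_zpow_le i.2 z.2 k
      have h2 : jap z.2 ≤ jap z := by
        have := norm_snd_le z
        simp only [jap]
        linarith
      have h3 := zpow_le_zpow_left₀ (abs_nonneg k) (jap_pos _).le h2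
      have h4 := hl i.1
      have h5 := jap_zpow_nonneg i.2 k
      have e : (ContinuousLinearMap.snd ℝ Plane Plane) z + i.2 = i.2 + z.2 := add_comm _ _
      rw [e, one_mul, mul_assoc]
      gcongr
      exact h1.trans (by gcongr)
  simpa [add_comm] using h'

lemma ampFamily_moyalAmp (hl : ∀ i, 0 ≤ lam i) (hm : ∀ i, 0 ≤ mu i)
    (hf : AmpFamily (fun i z => lam i * jap z ^ k) f)
    (hg : AmpFamily (fun i z => mu i * jap z ^ l) g) (R : ℝ) :
    AmpFamily (fun (i : ι × Plane × Set.Icc (-R) R) (z : Plane × Plane) =>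
      (lam i.1 * mu i.1 * jap i.2.1 ^ (k + l)) * jap z ^ (|k| + |l|))
      (fun i => moyalAmp i.2.2.1 (f i.1) (g i.1) i.2.1) := by
  have h := (ampFamily_comp_fst hl hf R).mul ((ampFamily_comp_snd hm hg).reindex
    (fun i : ι × Plane × Set.Icc (-R) R => (i.1, i.2.1)))
  refine h.congr_weight fun i z => ?_
  rw [zpow_add₀ (jap_pos _).ne', zpow_add₀ (jap_pos _).ne']
  ring

/-- Orders of growth add up under the Moyal product, locally uniformly in the parameter. -/
lemma exists_norm_moyal_le (hl : ∀ i, 0 ≤ lam i) (hm : ∀ i, 0 ≤ mu i)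
    (hf : AmpFamily (fun i z => lam i * jap z ^ k) f)
    (hg : AmpFamily (fun i z => mu i * jap z ^ l) g) (R : ℝ) :
    ∃ C, 0 ≤ C ∧ ∀ i w, ∀ c ∈ Set.Icc (-R) R,
      ‖moyal c (f i) (g i) w‖ ≤ C * (lam i * mu i * jap w ^ (k + l)) := by
  obtain ⟨C, hC, h⟩ := moyalPhase.exists_norm_oscInt_le
    (fun i : ι × Plane × Set.Icc (-R) R => mul_nonneg
    (mul_nonneg (hl i.1) (hm i.1)) (jap_zpow_nonneg i.2.1 _)) (ampFamily_moyalAmp hl hm hf hg R)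
  refine ⟨‖1 / (2 * (Real.pi : ℂ)) ^ 2‖ * C, by positivity, fun i w c hc => ?_⟩
  rw [moyal, norm_mul, mul_assoc]
  exact mul_le_mul_of_nonneg_left (h (i, w, ⟨c, hc⟩)) (norm_nonneg _)

end Families

section Linearity

variable {k l m : ℤ} {f g h : Plane → ℂ}

lemma amp_moyalAmp (c : ℝ) (hf : Amp (fun z => jap z ^ k) f) (hg : Amp (fun z => jap z ^ l) g)
    (w : Plane) : Amp (fun z => jap z ^ (|k| + |l|)) (moyalAmp c f g w) := by
  have h := (ampFamily_moyalAmp (ι := Unit) (lam := fun _ => 1) (mu := fun _ => 1)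
    (fun _ => zero_le_one) (fun _ => zero_le_one) (hf.congr_weight fun _ _ => (one_mul _).symm)
    (hg.congr_weight fun _ _ => (one_mul _).symm) |c|).single
      ((), w, ⟨c, neg_abs_le c, le_abs_self c⟩)
  refine h.mono (jap_zpow_nonneg w (k + l)) fun _ z => ?_
  simp

/-- The Moyal product as an oscillatory integral. -/
lemma hasOscIntegral_moyal (c : ℝ) (hf : Amp (fun z => jap z ^ k) f)
    (hg : Amp (fun z => jap z ^ l) g) (w : Plane) :
    HasOscIntegral (fun z => moyalAmp c f g w z * moyalPhase.osc z)
      (moyalPhase.oscInt (moyalAmp c f g w)) :=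
  moyalPhase.hasOscIntegral (amp_moyalAmp c hf hg w)

lemma moyal_add_left (c : ℝ) (hf : Amp (fun z => jap z ^ k) f) (hg : Amp (fun z => jap z ^ l) g)
    (hh : Amp (fun z => jap z ^ m) h) (w : Plane) :
    moyal c (fun z => f z + g z) h w = moyal c f h w + moyal c g h w := by
  have e : moyalAmp c (fun z => f z + g z) h w = fun z => moyalAmp c f h w z + moyalAmp c g h w z := by
    funext z
    simp only [moyalAmp]
    ring
  simp only [moyal, e, ← mul_add]
  rw [← moyalPhase.oscInt_add (amp_moyalAmp c hf hh w) (amp_moyalAmp c hg hh w)]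

lemma moyal_add_right (c : ℝ) (hf : Amp (fun z => jap z ^ k) f) (hg : Amp (fun z => jap z ^ l) g)
    (hh : Amp (fun z => jap z ^ m) h) (w : Plane) :
    moyal c f (fun z => g z + h z) w = moyal c f g w + moyal c f h w := by
  have e : moyalAmp c f (fun z => g z + h z) w = fun z => moyalAmp c f g w z + moyalAmp c f h w z := by
    funext z
    simp only [moyalAmp]
    ring
  simp only [moyal, e, ← mul_add]
  rw [← moyalPhase.oscInt_add (amp_moyalAmp c hf hg w) (amp_moyalAmp c hf hh w)]

lemma moyal_const_mul_left (c : ℝ) (b : ℂ) (hf : Amp (fun z => jap z ^ k) f)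
    (hg : Amp (fun z => jap z ^ l) g) (w : Plane) :
    moyal c (fun z => b * f z) g w = b * moyal c f g w := by
  have e : moyalAmp c (fun z => b * f z) g w = fun z => b * moyalAmp c f g w z := by
    funext z
    simp only [moyalAmp]
    ring
  simp only [moyal, e]
  rw [mul_left_comm, ← moyalPhase.oscInt_const_mul b (amp_moyalAmp c hf hg w)]

lemma moyal_const_mul_right (c : ℝ) (b : ℂ) (hf : Amp (fun z => jap z ^ k) f)
    (hg : Amp (fun z => jap z ^ l) g) (w : Plane) :
    moyal c f (fun z => b * g z) w = b * moyal c f g w := by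
  have e : moyalAmp c f (fun z => b * g z) w = fun z => b * moyalAmp c f g w z := by
    funext z
    simp only [moyalAmp]
    ring
  simp only [moyal, e]
  rw [mul_left_comm, ← moyalPhase.oscInt_const_mul b (amp_moyalAmp c hf hg w)]

lemma moyal_sub_left (c : ℝ) (hf : Amp (fun z => jap z ^ k) f) (hg : Amp (fun z => jap z ^ l) g)
    (hh : Amp (fun z => jap z ^ m) h) (w : Plane) :
    moyal c (fun z => f z - g z) h w = moyal c f h w - moyal c g h w := by
  have e : moyalAmp c (fun z => f z - g z) h w = fun z => moyalAmp c f h w z - moyalAmp c g h w z := by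
    funext z
    simp only [moyalAmp]
    ring
  simp only [moyal, e, ← mul_sub]
  rw [← moyalPhase.oscInt_sub (amp_moyalAmp c hf hh w) (amp_moyalAmp c hg hh w)]

lemma moyal_sub_right (c : ℝ) (hf : Amp (fun z => jap z ^ k) f) (hg : Amp (fun z => jap z ^ l) g)
    (hh : Amp (fun z => jap z ^ m) h) (w : Plane) :
    moyal c f (fun z => g z - h z) w = moyal c f g w - moyal c f h w := by
  have e : moyalAmp c f (fun z => g z - h z) w = fun z => moyalAmp c f g w z - moyalAmp c f h w z := by
    funext z
    simp only [moyalAmp]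
    ring
  simp only [moyal, e, ← mul_sub]
  rw [← moyalPhase.oscInt_sub (amp_moyalAmp c hf hg w) (amp_moyalAmp c hf hh w)]

end Linearity

/-! ### Differentiation of the Moyal product -/

section Derivative

variable {V : Type*} [NormedAddCommGroup V] [NormedSpace ℝ V]

lemma norm_taylor_le {f : V → ℂ} (hf : ContDiff ℝ ∞ f) {C : ℝ}
    (hC : ∀ z, ‖iteratedFDeriv ℝ 2 f z‖ ≤ C) (z h : V) :
    ‖f (z + h) - f z - fderiv ℝ f z h‖ ≤ C * ‖h‖ ^ 2 := by
  have hC0 : 0 ≤ C := (norm_nonneg _).trans (hC z)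
  have hf1 : Differentiable ℝ f := hf.differentiable (by simp)
  have hf2 : Differentiable ℝ (fderiv ℝ f) :=
    (hf.fderiv_right (m := ∞) (by simp)).differentiable (by simp)
  have h1 : ∀ x, ‖fderiv ℝ (fderiv ℝ f) x‖ ≤ C := fun x => by
    rw [← norm_iteratedFDeriv_one, norm_iteratedFDeriv_fderiv]
    exact hC x
  have h2 : ∀ x ∈ segment ℝ z (z + h), ‖fderiv ℝ f x - fderiv ℝ f z‖ ≤ C * ‖h‖ := fun x hx => by
    refine (Convex.norm_image_sub_le_of_norm_fderiv_le (𝕜 := ℝ) (s := Set.univ)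
      (fun x _ => hf2 x) (fun x _ => h1 x) convex_univ (Set.mem_univ z) (Set.mem_univ x)).trans ?_
    refine mul_le_mul_of_nonneg_left ?_ hC0
    have := norm_sub_le_of_mem_segment hx
    simpa using this
  have h3 := (convex_segment z (z + h)).norm_image_sub_le_of_norm_fderiv_le' (𝕜 := ℝ) (f := f)
    (φ := fderiv ℝ f z) (fun x _ => hf1 x) h2 (left_mem_segment ℝ z (z + h))
    (right_mem_segment ℝ z (z + h))
  rw [add_sub_cancel_left] at h3
  refine h3.trans (le_of_eq ?_)
  ring

lemma fderiv_fderiv_apply_comm {f : V → ℂ} (hf : ContDiff ℝ ∞ f) (z u v : V) :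
    fderiv ℝ (fun y => fderiv ℝ f y u) z v = fderiv ℝ (fun y => fderiv ℝ f y v) z u := by
  have hf2 : DifferentiableAt ℝ (fderiv ℝ f) z :=
    (hf.fderiv_right (m := ∞) (by simp)).differentiable (by simp) z
  have h : ∀ u, fderiv ℝ (fun y => fderiv ℝ f y u) z = (fderiv ℝ (fderiv ℝ f) z).flip u := fun u => by
    rw [fderiv_clm_apply hf2 (differentiableAt_const u)]
    simp
  rw [h, h]
  exact (hf.contDiffAt.isSymmSndFDerivAt (by simpa using WithTop.coe_le_coe.2 (le_top : (2 : ℕ∞) ≤ ⊤))) v u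

/-- The first order Taylor remainder is of second order in the increment, with all derivatives. -/
lemma ampFamily_taylor [FiniteDimensional ℝ V] {f : V → ℂ} (hf : Amp (fun _ => 1) f) :
    AmpFamily (fun (h : V) (_ : V) => ‖h‖ ^ 2) (fun h z => f (z + h) - f z - fderiv ℝ f z h) := by
  have hs : ∀ (f : V → ℂ), Amp (fun _ => 1) f → ∀ h : V,
      ContDiff ℝ ∞ fun z => f (z + h) - f z - fderiv ℝ f z h := fun f hf h =>
    (((hf.smooth ()).comp (contDiff_id.add contDiff_const)).sub (hf.smooth ())).sub
      ((hf.fderiv_apply h).smooth ())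
  refine ⟨hs f hf, fun n => ?_⟩
  induction n generalizing f with
  | zero =>
    obtain ⟨C, hC, h⟩ := hf.bound 2
    exact DerivBound.zero_of_le hC fun v z =>
      norm_taylor_le (hf.smooth ()) (fun z => by simpa using h () z) z v
  | succ n ih =>
    refine DerivBound.succ (hs f hf) fun v => ?_
    convert ih (hf.fderiv_apply v) using 3 with h z
    have hd := (hf.smooth ()).differentiable (by simp)
    have e1 : HasFDerivAt (fun z => f (z + h)) (fderiv ℝ f (z + h)) z := by
      have := (hd (z + h)).hasFDerivAt.comp z ((hasFDerivAt_id z).add_const h)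
      exact this
    have e2 := (((hf.fderiv_apply h).smooth ()).differentiable (by simp) z).hasFDerivAt
    have e3 : fderiv ℝ (fun z => f (z + h) - f z - fderiv ℝ f z h) z = _ :=
      ((e1.sub (hd z).hasFDerivAt).sub e2).fderiv
    rw [e3]
    simp [fderiv_fderiv_apply_comm (hf.smooth ()) z h v]

lemma ampFamily_fderiv {f : V → ℂ} (hf : Amp (fun _ => 1) f) :
    AmpFamily (fun (h : V) (_ : V) => ‖h‖) (fun h z => fderiv ℝ f z h) := by
  refine ⟨fun h => (hf.fderiv_apply h).smooth (), fun n => ?_⟩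
  obtain ⟨C, hC, hb⟩ := hf.bound (n + 1)
  refine ⟨C, hC, fun h z => ?_⟩
  refine (norm_iteratedFDeriv_fderiv_apply_le (hf.smooth ()).contDiffAt h n).trans ?_
  rw [mul_comm C]
  exact mul_le_mul_of_nonneg_left (by simpa using hb () z) (norm_nonneg h)

lemma ampFamily_translate {f : V → ℂ} (hf : Amp (fun _ => 1) f) :
    AmpFamily (fun (_ : V) (_ : V) => 1) (fun h z => f (z + h)) := by
  simpa using (hf.reindex fun _ : V => ()).comp_affine (fun _ => ContinuousLinearMap.id ℝ V)
    (fun h => h) (fun _ => le_rfl)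

end Derivative

end Moyal

/-! ### Smoothness of the Moyal product -/

section MoyalDerivative

open MeasureTheory Filter

/-- The partial derivative `∂_i`. -/
def pd (i : Fin 2) (f : Plane → ℂ) (z : Plane) : ℂ := fderiv ℝ f z (basisVec i)

lemma CB.pd {f : Plane → ℂ} (hf : CB f) (i : Fin 2) : CB (pd i f) := hf.fderiv_apply _

lemma plane_eq (h : Plane) : h = h 0 • basisVec 0 + h 1 • basisVec 1 := by
  refine plane_ext ?_ ?_ <;> simp [basisVec]

lemma fderiv_apply_eq (f : Plane → ℂ) (z h : Plane) :
    fderiv ℝ f z h = (h 0 : ℂ) * pd 0 f z + (h 1 : ℂ) * pd 1 f z := by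
  conv_lhs => rw [plane_eq h]
  simp [pd]

variable {f g : Plane → ℂ}

lemma moyal_translate (c : ℝ) (f g : Plane → ℂ) (w h : Plane) :
    moyal c f g (w + h) = moyal c (fun z => f (z + h)) (fun z => g (z + h)) w := by
  have : moyalAmp c f g (w + h) = moyalAmp c (fun z => f (z + h)) (fun z => g (z + h)) w := by
    funext z
    simp only [moyalAmp, add_right_comm]
  rw [moyal, moyal, this]

/-- Leibniz rule for the Moyal product with a quadratic error term. -/
lemma exists_norm_moyal_translate_le (c : ℝ) (hf : CB f) (hg : CB g) (w : Plane) :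
    ∃ C, 0 ≤ C ∧ ∀ h : Plane, ‖h‖ ≤ 1 → ‖moyal c f g (w + h) - moyal c f g w -
      (moyal c (fun z => fderiv ℝ f z h) g w + moyal c f (fun z => fderiv ℝ g z h) w)‖
        ≤ C * ‖h‖ ^ 2 := by
  let H : Type := {h : Plane // ‖h‖ ≤ 1}
  have z0 : ∀ {b : H → ℝ} {a : H → Plane → ℂ}, AmpFamily (fun h _ => b h) a →
      AmpFamily (fun h z => b h * jap z ^ (0 : ℤ)) a := fun h => h.congr_weight fun _ _ => by simp
  have f1 := z0 ((ampFamily_taylor hf).reindex (Subtype.val : H → Plane))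
  have g1 := z0 ((ampFamily_taylor hg).reindex (Subtype.val : H → Plane))
  have f2 := z0 ((ampFamily_fderiv hf).reindex (Subtype.val : H → Plane))
  have g2' := (ampFamily_fderiv hg).reindex (Subtype.val : H → Plane)
  have g2 : AmpFamily (fun h z => ‖h.1‖ * jap z ^ (0 : ℤ))
      (fun (h : H) z => g (z + h.1) - g z) := by
    have h1 := ((ampFamily_taylor hg).reindex (Subtype.val : H → Plane)).mono
      (w' := fun h z => ‖h.1‖) zero_le_one fun h _ => by
        have := h.2
        nlinarith [norm_nonneg h.1]
    simpa using h1.add g2'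
  have g3 := z0 ((ampFamily_translate hg).reindex (Subtype.val : H → Plane))
  have f0 := z0 (hf.reindex (fun _ : H => ()))
  obtain ⟨C1, hC1, b1⟩ := exists_norm_moyal_le (fun h => by positivity)
    (fun h => zero_le_one) f1 g3 |c|
  obtain ⟨C2, hC2, b2⟩ := exists_norm_moyal_le (fun h => zero_le_one)
    (fun h => by positivity) f0 g1 |c|
  obtain ⟨C3, hC3, b3⟩ := exists_norm_moyal_le (fun h => by positivity)
    (fun h => by positivity) f2 g2 |c|
  have hc : c ∈ Set.Icc (-|c|) |c| := ⟨neg_abs_le c, le_abs_self c⟩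
  refine ⟨C1 + C2 + C3, by positivity, fun h hh => ?_⟩
  have b1' := b1 ⟨h, hh⟩ w c hc
  have b2' := b2 ⟨h, hh⟩ w c hc
  have b3' := b3 ⟨h, hh⟩ w c hc
  have a0 := hf.zpow
  have a1 := hg.zpow
  have a2 := (CB.of_family (ampFamily_translate hf) h).zpow
  have a3 := (CB.of_family (ampFamily_translate hg) h).zpow
  have a4 := (CB.of_family (ampFamily_fderiv hf) h).zpow
  have a5 := (CB.of_family (ampFamily_fderiv hg) h).zpow
  -- the error of the Leibniz rule as a sum of products that are quadratic in `h`
  have e : moyal c f g (w + h) - moyal c f g w -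
      (moyal c (fun z => fderiv ℝ f z h) g w + moyal c f (fun z => fderiv ℝ g z h) w) =
      moyal c (fun z => f (z + h) - f z - fderiv ℝ f z h) (fun z => g (z + h)) w +
      moyal c f (fun z => g (z + h) - g z - fderiv ℝ g z h) w +
      moyal c (fun z => fderiv ℝ f z h) (fun z => g (z + h) - g z) w := by
    rw [moyal_translate, moyal_sub_left c (a2.sub a0) a4 a3, moyal_sub_left c a2 a0 a3,
      moyal_sub_right c a0 (a3.sub a1) a5, moyal_sub_right c a0 a3 a1,
      moyal_sub_right c a4 a3 a1]
    ring
  rw [e]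
  refine (norm_add₃_le).trans ?_
  simp only [add_zero, zpow_zero, mul_one, one_mul] at b1' b2' b3'
  linarith

lemma moyal_fderiv_apply (c : ℝ) (hf : CB f) (hg : CB g) (w v : Plane) :
    moyal c (fun z => fderiv ℝ f z v) g w + moyal c f (fun z => fderiv ℝ g z v) w =
      (∑ i, (crd i).smulRight (moyal c (pd i f) g w + moyal c f (pd i g) w)) v := by
  have e : ∀ f : Plane → ℂ, (fun z => fderiv ℝ f z v) =
      fun z => (v 0 : ℂ) * pd 0 f z + (v 1 : ℂ) * pd 1 f z := fun f =>
    funext fun z => fderiv_apply_eq f z v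
  have m : ∀ {f : Plane → ℂ} (hf : CB f) (i : Fin 2) (b : ℂ),
      Amp (fun z => jap z ^ (0 : ℤ)) (fun z => b * pd i f z) := fun hf i b =>
    (((hf.pd i).const_mul fun _ => b).mono (norm_nonneg b) fun _ _ => by simp)
  rw [e f, e g, moyal_add_left c (m hf 0 _) (m hf 1 _) hg.zpow,
    moyal_add_right c hf.zpow (m hg 0 _) (m hg 1 _),
    moyal_const_mul_left c _ (hf.pd 0).zpow hg.zpow, moyal_const_mul_left c _ (hf.pd 1).zpow hg.zpow,
    moyal_const_mul_right c _ hf.zpow (hg.pd 0).zpow, moyal_const_mul_right c _ hf.zpow (hg.pd 1).zpow]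
  simp only [Fin.sum_univ_two, add_apply, ContinuousLinearMap.smulRight_apply,
    crd_apply, Complex.real_smul]
  ring

lemma hasFDerivAt_moyal (c : ℝ) (hf : CB f) (hg : CB g) (w : Plane) :
    HasFDerivAt (moyal c f g)
      (∑ i, (crd i).smulRight (moyal c (pd i f) g w + moyal c f (pd i g) w)) w := by
  obtain ⟨C, hC, h⟩ := exists_norm_moyal_translate_le c hf hg w
  rw [hasFDerivAt_iff_isLittleO_nhds_zero]
  refine Asymptotics.IsBigO.trans_isLittleO (g := fun h : Plane => ‖h‖ ^ 2) ?_ ?_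
  · refine Asymptotics.IsBigO.of_bound C ?_
    filter_upwards [Metric.closedBall_mem_nhds (0 : Plane) one_pos] with v hv
    have hv' : ‖v‖ ≤ 1 := by simpa using hv
    rw [Real.norm_of_nonneg (by positivity)]
    have e := moyal_fderiv_apply c hf hg w v
    rw [← e]
    exact h v hv'
  · exact ((Asymptotics.isLittleO_pow_id (𝕜 := ℝ) one_lt_two).comp_tendsto
      (tendsto_norm_zero (E := Plane))).trans_isBigO (Asymptotics.isBigO_norm_left.2
        (Asymptotics.isBigO_refl _ _))

lemma fderiv_moyal_apply (c : ℝ) (hf : CB f) (hg : CB g) (w v : Plane) :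
    fderiv ℝ (moyal c f g) w v =
      moyal c (fun z => fderiv ℝ f z v) g w + moyal c f (fun z => fderiv ℝ g z v) w := by
  rw [moyal_fderiv_apply c hf hg, (hasFDerivAt_moyal c hf hg w).fderiv]

lemma contDiff_moyal (c : ℝ) (hf : CB f) (hg : CB g) : ContDiff ℝ ∞ (moyal c f g) := by
  rw [contDiff_infty]
  intro n
  induction n generalizing f g with
  | zero => exact contDiff_zero.2 (continuous_iff_continuousAt.2 fun w =>
      (hasFDerivAt_moyal c hf hg w).continuousAt)
  | succ n ih =>
    rw [Nat.cast_succ, contDiff_succ_iff_fderiv]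
    refine ⟨fun w => (hasFDerivAt_moyal c hf hg w).differentiableAt, by simp, ?_⟩
    have e : fderiv ℝ (moyal c f g) = fun w => ∑ i,
        (crd i).smulRight (moyal c (pd i f) g w + moyal c f (pd i g) w) :=
      funext fun w => (hasFDerivAt_moyal c hf hg w).fderiv
    rw [e]
    exact ContDiff.sum fun i _ => contDiff_const.smulRight ((ih (hf.pd i) hg).add (ih hf (hg.pd i)))

/-- The Moyal product of families of symbols, with constants and orders that multiply and add up. -/
lemma ampFamily_moyal {ι : Type*} {lam mu : ι → ℝ} {k l : ℤ} {f g : ι → Plane → ℂ}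
    (hl : ∀ i, 0 ≤ lam i) (hm : ∀ i, 0 ≤ mu i)
    (hf : AmpFamily (fun i z => lam i * jap z ^ k) f)
    (hg : AmpFamily (fun i z => mu i * jap z ^ l) g)
    (bf : ∀ i, CB (f i)) (bg : ∀ i, CB (g i)) (c : ℝ) :
    AmpFamily (fun i z => lam i * mu i * jap z ^ (k + l)) (fun i => moyal c (f i) (g i)) := by
  refine ⟨fun i => contDiff_moyal c (bf i) (bg i), fun n => ?_⟩
  induction n generalizing f g with
  | zero =>
    obtain ⟨C, hC, h⟩ := exists_norm_moyal_le hl hm hf hg |c|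
    exact DerivBound.zero_of_le hC fun i w => h i w c ⟨neg_abs_le c, le_abs_self c⟩
  | succ n ih =>
    refine DerivBound.succ (fun i => contDiff_moyal c (bf i) (bg i)) fun v => ?_
    have h1 := ih (hf.fderiv_apply v) hg (fun i => (bf i).fderiv_apply v) bg
    have h2 := ih hf (hg.fderiv_apply v) bf (fun i => (bg i).fderiv_apply v)
    have h3 := h1.add h2 (fun i => contDiff_moyal c ((bf i).fderiv_apply v) (bg i))
      (fun i => contDiff_moyal c (bf i) ((bg i).fderiv_apply v))
    simpa only [fderiv_moyal_apply c (bf _) (bg _)] using h3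

lemma CB.moyal (hf : CB f) (hg : CB g) (c : ℝ) : CB (moyal c f g) := by
  have h := ampFamily_moyal (ι := Unit) (lam := fun _ => 1) (mu := fun _ => 1) (k := 0) (l := 0)
    (fun _ => zero_le_one) (fun _ => zero_le_one) (hf.congr_weight fun _ _ => by simp)
    (hg.congr_weight fun _ _ => by simp) (fun _ => hf) (fun _ => hg) c
  exact h.congr_weight fun _ _ => by simp

/-! ### The derivative with respect to the deformation parameter -/

lemma amp_scale (hf : CB f) (c : ℝ) (w : Plane) : CB (fun p => f (w + c • p)) := by
  have h := hf.comp_affine (fun _ => c • ContinuousLinearMap.id ℝ Plane) (fun _ => w)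
    (fun _ => le_rfl)
  simpa [add_comm] using h

/-- The derivative of a dilation with respect to its factor grows linearly. -/
lemma amp_euler (hf : CB f) (c : ℝ) (w : Plane) :
    Amp jap (fun p => fderiv ℝ f (w + c • p) p) := by
  simp only [fderiv_apply_eq]
  have h : ∀ i, Amp jap (fun p : Plane => (p i : ℂ) * pd i f (w + c • p)) := fun i =>
    ((amp_linear (crd i)).mul (amp_scale (hf.pd i) c w)).congr_weight fun _ _ => mul_one _
  exact (h 0).add (h 1)

/-- Taylor expansion of a dilation to first order, with all derivatives. -/
lemma ampFamily_scale_taylor (hf : CB f) (c : ℝ) (w : Plane) :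
    AmpFamily (fun (h : {h : ℝ // |h| ≤ 1}) (p : Plane) => h.1 ^ 2 * jap p ^ (2 : ℤ))
      (fun h p => f (w + (c + h.1) • p) - f (w + c • p) - (h.1 : ℂ) * fderiv ℝ f (w + c • p) p) := by
  have hs : ∀ (f : Plane → ℂ), CB f → ∀ h : {h : ℝ // |h| ≤ 1}, ContDiff ℝ ∞ fun p : Plane =>
      f (w + (c + h.1) • p) - f (w + c • p) - (h.1 : ℂ) * fderiv ℝ f (w + c • p) p := fun f hf h =>
    (((amp_scale hf (c + h.1) w).smooth ()).sub ((amp_scale hf c w).smooth ())).sub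
      (contDiff_const.mul ((amp_euler hf c w).smooth ()))
  refine ⟨hs f hf, fun n => ?_⟩
  induction n using Nat.strong_induction_on generalizing f with
  | _ n ih =>
  cases n with
  | zero =>
    obtain ⟨C, hC, hb⟩ := hf.bound 2
    refine DerivBound.zero_of_le hC fun h p => ?_
    have h1 := norm_taylor_le (hf.smooth ()) (fun z => by simpa using hb () z) (w + c • p) (h.1 • p)
    rw [add_assoc, ← add_smul, map_smul, Complex.real_smul, norm_smul] at h1
    refine h1.trans (mul_le_mul_of_nonneg_left ?_ hC)
    rw [mul_pow, Real.norm_eq_abs, sq_abs]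
    refine mul_le_mul_of_nonneg_left ?_ (sq_nonneg _)
    exact_mod_cast pow_le_pow_left₀ (norm_nonneg p) (norm_le_jap p) 2
  | succ n =>
    refine DerivBound.succ (hs f hf) fun v => ?_
    have hd := (hf.smooth ()).differentiable (by simp)
    have hv := hf.fderiv_apply v
    have key : ∀ (h : {h : ℝ // |h| ≤ 1}) (p : Plane),
        fderiv ℝ (fun p : Plane => f (w + (c + h.1) • p) - f (w + c • p) -
          (h.1 : ℂ) * fderiv ℝ f (w + c • p) p) p v =
        ((c + h.1 : ℝ) : ℂ) * (fderiv ℝ f (w + (c + h.1) • p) v - fderiv ℝ f (w + c • p) v -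
          (h.1 : ℂ) * fderiv ℝ (fun z => fderiv ℝ f z v) (w + c • p) p) +
        ((h.1 ^ 2 : ℝ) : ℂ) * fderiv ℝ (fun z => fderiv ℝ f z v) (w + c • p) p := fun h p => by
      have haff : ∀ b : ℝ, HasFDerivAt (fun p : Plane => w + b • p)
          (b • ContinuousLinearMap.id ℝ Plane) p := fun b =>
        ((ContinuousLinearMap.id ℝ Plane).hasFDerivAt.const_smul b).const_add w
      have e1 : ∀ b : ℝ, HasFDerivAt (fun p : Plane => f (w + b • p)) _ p := fun b =>
        (hd (w + b • p)).hasFDerivAt.comp p (haff b)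
      have hd2 : DifferentiableAt ℝ (fderiv ℝ f) (w + c • p) :=
        ((hf.smooth ()).fderiv_right (m := ∞) (by simp)).differentiable (by simp) _
      have e2 : HasFDerivAt (fun p : Plane => fderiv ℝ f (w + c • p)) _ p :=
        hd2.hasFDerivAt.comp p (haff c)
      have e3 := ((e2.clm_apply (hasFDerivAt_id p)).const_mul (h.1 : ℂ))
      have e4 : fderiv ℝ (fun p : Plane => f (w + (c + h.1) • p) - f (w + c • p) -
          (h.1 : ℂ) * fderiv ℝ f (w + c • p) p) p = _ :=
        (((e1 (c + h.1)).sub (e1 c)).sub e3).fderiv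
      have e5 : fderiv ℝ (fderiv ℝ f) (w + c • p) v p =
          fderiv ℝ (fun z => fderiv ℝ f z v) (w + c • p) p := by
        rw [fderiv_clm_apply hd2 (differentiableAt_const v)]
        simpa using ((hf.smooth ()).contDiffAt.isSymmSndFDerivAt
          (by simpa using WithTop.coe_le_coe.2 (le_top : (2 : ℕ∞) ≤ ⊤))) v p
      rw [e4]
      simp
      rw [e5]
      ring
    simp only [key]
    have h1 := DerivBound.mul (n := n) (w := fun (h : {h : ℝ // |h| ≤ 1}) _ => ‖((c + h.1 : ℝ) : ℂ)‖)
      (fun m _ => (AmpFamily.const _).bound m) (fun m hm => ih m (Nat.lt_succ_of_le hm) hv)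
      (fun _ => contDiff_const) (hs _ hv)
    · have h2 := ((amp_euler hv c w).reindex fun _ : {h : ℝ // |h| ≤ 1} => ()).const_mul
        fun h => ((h.1 ^ 2 : ℝ) : ℂ)
      refine (h1.mono (K := |c| + 1) (by positivity) fun h p => ?_).add ((h2.mono
        (w' := fun h p => h.1 ^ 2 * jap p ^ (2 : ℤ)) zero_le_one fun h p => ?_).bound n)
        (fun h => contDiff_const.mul (hs _ hv h)) h2.smooth
      · refine mul_le_mul_of_nonneg_right ?_ (mul_nonneg (sq_nonneg _) (jap_zpow_nonneg p 2))
        rw [Complex.norm_real]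
        exact (abs_add_le c h.1).trans (by linarith [h.2])
      · rw [one_mul, Complex.norm_real, Real.norm_of_nonneg (sq_nonneg _)]
        refine mul_le_mul_of_nonneg_left ?_ (sq_nonneg _)
        have := jap_zpow_le_of_le p (show (1 : ℤ) ≤ 2 by norm_num)
        simpa using this

end MoyalDerivative

section MoyalParameter

open MeasureTheory Filter

variable {f g : Plane → ℂ}

lemma fderiv_moyalAmp_snd (c : ℝ) (hf : CB f) (hg : CB g) (w : Plane) (v : Plane)
    (z : Plane × Plane) :
    fderiv ℝ (moyalAmp c f g w) z (0, v) = moyalAmp c f (fun z => fderiv ℝ g z v) w z := by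
  have a1 : HasFDerivAt (fun z : Plane × Plane => w + c • z.1)
      (c • ContinuousLinearMap.fst ℝ Plane Plane) z :=
    ((ContinuousLinearMap.fst ℝ Plane Plane).hasFDerivAt.const_smul c).const_add w
  have a2 : HasFDerivAt (fun z : Plane × Plane => w + z.2)
      (ContinuousLinearMap.snd ℝ Plane Plane) z :=
    (ContinuousLinearMap.snd ℝ Plane Plane).hasFDerivAt.const_add w
  have h1 : HasFDerivAt (fun z : Plane × Plane => f (w + c • z.1)) _ z :=
    ((hf.smooth ()).differentiable (by simp) (w + c • z.1)).hasFDerivAt.comp z a1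
  have h2 : HasFDerivAt (fun z : Plane × Plane => g (w + z.2)) _ z :=
    ((hg.smooth ()).differentiable (by simp) (w + z.2)).hasFDerivAt.comp z a2
  have h3 : fderiv ℝ (moyalAmp c f g w) z = _ := (h1.mul h2).fderiv
  rw [h3]
  simp [moyalAmp]

/-- The coordinates of the first variable act as derivatives of the second factor. -/
lemma oscInt_crd_mul_moyalAmp (c : ℝ) (hf : CB f) (hg : CB g) (w : Plane) :
    moyalPhase.oscInt (fun z => (z.1 1 : ℂ) * moyalAmp c f g w z) =
      Complex.I * moyalPhase.oscInt (moyalAmp c f (pd 0 g) w) ∧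
    moyalPhase.oscInt (fun z => (z.1 0 : ℂ) * moyalAmp c f g w z) =
      -(Complex.I * moyalPhase.oscInt (moyalAmp c f (pd 1 g) w)) := by
  have hA := amp_moyalAmp c hf.zpow hg.zpow w
  have h0 := moyalPhase.oscInt_form_mul hA (0 : Fin 4)
  have h1 := moyalPhase.oscInt_form_mul hA (1 : Fin 4)
  have d0 : moyalPhase.dir (0 : Fin 4) = (0, basisVec 0) := rfl
  have d1 : moyalPhase.dir (1 : Fin 4) = (0, basisVec 1) := rfl
  have e0 : ∀ z, moyalPhase.form (0 : Fin 4) z = z.1 1 := fun _ => rfl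
  have e1 : ∀ z, moyalPhase.form (1 : Fin 4) z = -z.1 0 := fun _ => rfl
  simp only [d0, e0, fderiv_moyalAmp_snd c hf hg] at h0
  simp only [d1, e1, fderiv_moyalAmp_snd c hf hg, Complex.ofReal_neg, neg_mul] at h1
  refine ⟨h0, ?_⟩
  have hB : Amp (fun z => jap z ^ (1 : ℤ)) (fun z : Plane × Plane => (z.1 0 : ℂ) * moyalAmp c f g w z) :=
    ((amp_linear ((crd 0).comp (.fst ℝ Plane Plane))).mul hA).congr_weight fun _ z => by simp
  have h2 := moyalPhase.oscInt_const_mul (-1) hB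
  simp only [neg_one_mul] at h2
  rw [h2] at h1
  exact neg_eq_iff_eq_neg.1 h1

/-- The derivative of the Moyal product in the parameter is the Poisson bracket of the factors, up to
the factor `i`, and is itself formed with the Moyal product. It comes from
`∂_c f(w + cp) = p₀ ∂₀f + p₁ ∂₁f`, where integration by parts turns `p₀` and `p₁` into derivatives
of `g`. -/
lemma hasDerivAt_moyal (hf : CB f) (hg : CB g) (w : Plane) (c : ℝ) :
    HasDerivAt (fun c => moyal c f g w)
      (Complex.I * (moyal c (pd 1 f) (pd 0 g) w - moyal c (pd 0 f) (pd 1 g) w)) c := by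
  let H : Type := {h : ℝ // |h| ≤ 1}
  -- the amplitude of the Taylor remainder
  have hfst : ∀ z : Plane × Plane, jap z.1 ≤ jap z := fun z => by
    have := norm_fst_le z
    simp only [jap]
    linarith
  have r1 := ((ampFamily_scale_taylor hf c w).comp_affine
    (fun _ => ContinuousLinearMap.fst ℝ Plane Plane) (fun _ => 0) (fun _ => le_rfl)).mono
    (w' := fun h z => h.1 ^ 2 * jap z ^ (2 : ℤ)) zero_le_one fun h z => by
      rw [one_mul, add_zero]
      exact mul_le_mul_of_nonneg_left (zpow_le_zpow_left₀ (by norm_num) (jap_pos _).le (hfst z))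
        (sq_nonneg _)
  have r2 : Amp (fun _ => 1) (fun z : Plane × Plane => g (w + z.2)) := by
    simpa [add_comm] using hg.comp_affine (fun _ => ContinuousLinearMap.snd ℝ Plane Plane)
      (fun _ => w) (fun _ => le_rfl)
  have r3 := (r1.mul (r2.reindex fun _ : H => ())).congr_weight fun _ _ => mul_one _
  obtain ⟨C, hC, hb⟩ := moyalPhase.exists_norm_oscInt_le (fun h => sq_nonneg _) r3
  -- the amplitude of the derivative
  let E : Plane × Plane → ℂ := fun z => fderiv ℝ f (w + c • z.1) z.1 * g (w + z.2)
  have hE : Amp (fun z => jap z ^ (1 : ℤ)) E := by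
    have := ((amp_euler hf c w).comp_affine (fun _ => ContinuousLinearMap.fst ℝ Plane Plane)
      (fun _ => 0) (fun _ => le_rfl)).mul r2
    simp only [add_zero] at this
    exact this.mono zero_le_one fun _ z => by simpa using hfst z
  have hEv : 1 / (2 * (Real.pi : ℂ)) ^ 2 * moyalPhase.oscInt E =
      Complex.I * (moyal c (pd 1 f) (pd 0 g) w - moyal c (pd 0 f) (pd 1 g) w) := by
    have e : E = fun z => (z.1 0 : ℂ) * moyalAmp c (pd 0 f) g w z +
        (z.1 1 : ℂ) * moyalAmp c (pd 1 f) g w z := by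
      funext z
      simp only [E, fderiv_apply_eq, moyalAmp]
      ring
    have hB : ∀ i j, Amp (fun z => jap z ^ (1 : ℤ))
        (fun z : Plane × Plane => (z.1 i : ℂ) * moyalAmp c (pd j f) g w z) := fun i j =>
      ((amp_linear ((crd i).comp (.fst ℝ Plane Plane))).mul
        (amp_moyalAmp c (hf.pd j).zpow hg.zpow w)).congr_weight fun _ z => by simp
    rw [e, moyalPhase.oscInt_add (hB 0 0) (hB 1 1), (oscInt_crd_mul_moyalAmp c (hf.pd 0) hg w).2,
      (oscInt_crd_mul_moyalAmp c (hf.pd 1) hg w).1, moyal, moyal]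
    ring
  rw [← hEv, hasDerivAt_iff_isLittleO_nhds_zero]
  refine Asymptotics.IsBigO.trans_isLittleO (g := fun h : ℝ => h ^ 2) ?_
    (Asymptotics.isLittleO_pow_id one_lt_two)
  refine Asymptotics.IsBigO.of_bound (‖1 / (2 * (Real.pi : ℂ)) ^ 2‖ * C) ?_
  filter_upwards [Metric.closedBall_mem_nhds (0 : ℝ) one_pos] with h hh
  have hh' : |h| ≤ 1 := by simpa using hh
  have h1 := hb ⟨h, hh'⟩
  have hhE : Amp (fun z => jap z ^ (1 : ℤ)) (fun z => (h : ℂ) * E z) :=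
    (hE.const_mul fun _ => (h : ℂ)).mono (norm_nonneg (h : ℂ)) fun _ _ => le_rfl
  have a1 := amp_moyalAmp (c + h) hf.zpow hg.zpow w
  have a2 := amp_moyalAmp c hf.zpow hg.zpow w
  have e : moyal (c + h) f g w - moyal c f g w -
      h • (1 / (2 * (Real.pi : ℂ)) ^ 2 * moyalPhase.oscInt E) =
      1 / (2 * (Real.pi : ℂ)) ^ 2 * moyalPhase.oscInt (fun z =>
        (f (w + (c + h) • z.1) - f (w + c • z.1) - (h : ℂ) * fderiv ℝ f (w + c • z.1) z.1) *
          g (w + z.2)) := by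
    have e' : (fun z : Plane × Plane =>
        (f (w + (c + h) • z.1) - f (w + c • z.1) - (h : ℂ) * fderiv ℝ f (w + c • z.1) z.1) *
          g (w + z.2)) =
        fun z => (moyalAmp (c + h) f g w z - moyalAmp c f g w z) - (h : ℂ) * E z := by
      funext z
      simp only [moyalAmp, E]
      ring
    have a12 : Amp (fun z => jap z ^ (|0| + |0| : ℤ))
      (fun z => moyalAmp (c + h) f g w z - moyalAmp c f g w z) := a1.sub a2
    rw [e', moyalPhase.oscInt_sub a12 hhE, moyalPhase.oscInt_sub a1 a2,
      moyalPhase.oscInt_const_mul _ hE, moyal, moyal, Complex.real_smul]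
    ring
  rw [e, norm_mul, mul_assoc, Real.norm_of_nonneg (sq_nonneg h)]
  refine mul_le_mul_of_nonneg_left ?_ (norm_nonneg _)
  simpa using h1

end MoyalParameter

/-! ### The symplectic Fourier transform -/

section Symplectic

open MeasureTheory Filter

/-- Rotation by a right angle. -/
def rot : Plane ≃ₗᵢ[ℝ] Plane where
  toFun p := !₂[-p 1, p 0]
  invFun p := !₂[p 1, -p 0]
  map_add' p q := by
    refine plane_ext ?_ ?_ <;> simp
    ring
  map_smul' c p := by refine plane_ext ?_ ?_ <;> simp
  left_inv p := by refine plane_ext ?_ ?_ <;> simp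
  right_inv p := by refine plane_ext ?_ ?_ <;> simp
  norm_map' p := by
    simp [EuclideanSpace.norm_eq, add_comm]

lemma rot_zero (p : Plane) : rot p 0 = -p 1 := rfl

lemma rot_one (p : Plane) : rot p 1 = p 0 := rfl

lemma inner_plane (p q : Plane) : inner ℝ p q = p 0 * q 0 + p 1 * q 1 := by
  simp [PiLp.inner_apply, mul_comm]

lemma inner_rot (p q : Plane) : inner ℝ (rot p) q = -symp p q := by
  rw [inner_plane, rot_zero, rot_one, symp]
  ring

lemma symp_add_right (p q r : Plane) : symp p (q + r) = symp p q + symp p r := by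
  simp only [symp, PiLp.add_apply]
  ring

lemma symp_smul_left (c : ℝ) (p q : Plane) : symp (c • p) q = c * symp p q := by
  simp only [symp, PiLp.smul_apply, smul_eq_mul]
  ring

lemma symp_smul_right (c : ℝ) (p q : Plane) : symp p (c • q) = c * symp p q := by
  simp only [symp, PiLp.smul_apply, smul_eq_mul]
  ring

/-- `e^{iω(p,q)}`. -/
def sympExp (p q : Plane) : ℂ := Complex.exp (Complex.I * (symp p q : ℝ))

lemma norm_sympExp (p q : Plane) : ‖sympExp p q‖ = 1 := by
  rw [sympExp, mul_comm, Complex.norm_exp_ofReal_mul_I]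

lemma continuous_sympExp : Continuous fun z : Plane × Plane => sympExp z.1 z.2 :=
  moyalPhase.contDiff_osc.continuous

/-- The symplectic Fourier transform `∫ e^{iω(p,q)} h(q) dq`, expressed by the Fourier transform of
Schwartz functions; see `sympFourier_eq`. -/
def sympFourier (h : 𝓢(Plane, ℂ)) (p : Plane) : ℂ := 𝓕 h ((2 * Real.pi)⁻¹ • rot p)

lemma sympFourier_eq (h : 𝓢(Plane, ℂ)) (p : Plane) :
    sympFourier h p = ∫ q, sympExp p q * h q := by
  rw [sympFourier, SchwartzMap.fourier_coe, Real.fourier_eq']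
  refine integral_congr_ae (Eventually.of_forall fun q => ?_)
  have : ((-2 * Real.pi * inner ℝ q ((2 * Real.pi)⁻¹ • rot p) : ℝ) : ℂ) * Complex.I =
      Complex.I * (symp p q : ℝ) := by
    rw [inner_smul_right, real_inner_comm, inner_rot]
    have : (Real.pi : ℝ) ≠ 0 := Real.pi_ne_zero
    rw [show -2 * Real.pi * ((2 * Real.pi)⁻¹ * -symp p q) = symp p q by field_simp, mul_comm]
  simp only [this, smul_eq_mul, sympExp]

lemma continuous_sympFourier (h : 𝓢(Plane, ℂ)) : Continuous (sympFourier h) :=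
  (𝓕 h).continuous.comp ((continuous_const_smul _).comp rot.continuous)

lemma integral_comp_rot (F : Plane → ℂ) :
    ∫ p, F ((2 * Real.pi)⁻¹ • rot p) = (2 * (Real.pi : ℂ)) ^ 2 * ∫ p, F p := by
  rw [rot.measurePreserving.integral_comp rot.toHomeomorph.measurableEmbedding
    (fun p => F ((2 * Real.pi)⁻¹ • p)), Measure.integral_comp_smul, finrank_euclideanSpace_fin, Complex.real_smul]
  congr 1
  rw [abs_of_pos (by positivity)]
  push_cast
  rw [inv_pow, inv_inv]

lemma integrable_sympFourier (h : 𝓢(Plane, ℂ)) : Integrable (sympFourier h) := by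
  have h1 : Integrable (fun p => 𝓕 h ((2 * Real.pi)⁻¹ • p)) :=
    (𝓕 h).integrable.comp_smul (by positivity)
  exact (rot.measurePreserving.integrable_comp_emb rot.toHomeomorph.measurableEmbedding).2 h1

/-- Inversion of the symplectic Fourier transform. -/
lemma integral_sympFourier (h : 𝓢(Plane, ℂ)) (w : Plane) :
    ∫ p, sympExp p (-w) * sympFourier h p = (2 * (Real.pi : ℂ)) ^ 2 * h w := by
  have h1 : h w = ∫ v, Complex.exp (((2 * Real.pi * inner ℝ v w : ℝ) : ℂ) * Complex.I) • 𝓕 h v := by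
    rw [← Real.fourierInv_eq', ← SchwartzMap.fourierInv_coe, FourierTransform.fourierInv_fourier_eq]
  rw [h1, ← integral_comp_rot]
  refine integral_congr_ae (Eventually.of_forall fun p => ?_)
  have : (2 * Real.pi * inner ℝ ((2 * Real.pi)⁻¹ • rot p) w : ℝ) = symp p (-w) := by
    have : (Real.pi : ℝ) ≠ 0 := Real.pi_ne_zero
    rw [real_inner_smul_left, inner_rot, ← neg_one_smul ℝ w, symp_smul_right]
    field_simp
  simp only [this, smul_eq_mul, sympExp, sympFourier, mul_comm Complex.I]

end Symplectic

/-! ### Associativity and unit of the Moyal product -/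

section MoyalAlgebra

open MeasureTheory Filter

lemma tendsto_scaleSeq_nhdsGT : Tendsto (fun n => (scaleSeq n).1) atTop (𝓝[>] 0) :=
  tendsto_nhdsWithin_iff.2 ⟨tendsto_scaleSeq, Eventually.of_forall fun n => (scaleSeq n).2.1⟩

/-- Bounded smooth functions are limits of Schwartz functions, with all derivatives and with a loss of
one order of growth. -/
lemma CB.exists_approx {f : Plane → ℂ} (hf : CB f) : ∃ s : Scale → 𝓢(Plane, ℂ),
    AmpFamily (fun ε z => ε.1 * jap z ^ (1 : ℤ)) (fun ε z => s ε z - f z) := by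
  obtain ⟨χ, hχ, hc⟩ := exists_schwartz_hasCompactSupport Plane
  have hc' : ∀ ε : Scale, HasCompactSupport (fun z => χ (ε.1 • z) * f z) := fun ε =>
    HasCompactSupport.mul_right (hc.comp_homeomorph (Homeomorph.smulOfNeZero ε.1 ε.2.1.ne'))
  refine ⟨fun ε => (hc' ε).toSchwartzMap
    (((ampFamily_cutoff χ).smooth ε).mul (hf.smooth ())), ?_⟩
  have h := ((ampFamily_cutoff_sub χ).mul (hf.reindex fun _ : Scale => ())).congr_weight
    (w' := fun ε z => ε.1 * jap z ^ (1 : ℤ)) fun ε z => by simp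
  convert h using 3 with ε z
  rw [hχ]
  change χ (ε.1 • z) * f z - f z = _
  ring

lemma CB.of_schwartz (h : 𝓢(Plane, ℂ)) : CB h := amp_schwartz_one h

lemma CB.const (b : ℂ) : CB (fun _ => b) :=
  (AmpFamily.const fun _ : Unit => b).mono (norm_nonneg b) fun _ _ => by simp

variable {f g h : Plane → ℂ}

/-- Values of the Moyal product along an approximation of the first factor. -/
lemma tendsto_moyal_left (c : ℝ) {k : ℤ} (hf : CB f) (hg : CB g) {s : Scale → Plane → ℂ}
    (hs : ∀ ε, CB (s ε)) (ha : AmpFamily (fun ε z => ε.1 * jap z ^ k) (fun ε z => s ε z - f z))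
    (w : Plane) :
    Tendsto (fun n => moyal c (s (scaleSeq n)) g w) atTop (𝓝 (moyal c f g w)) := by
  obtain ⟨C, hC, h⟩ := exists_norm_moyal_le (mu := fun _ => 1) (l := 0) (fun ε : Scale => ε.2.1.le)
    (fun _ => zero_le_one) ha ((hg.reindex fun _ : Scale => ()).congr_weight fun _ _ => by simp) |c|
  rw [tendsto_iff_norm_sub_tendsto_zero]
  refine squeeze_zero (g := fun n => C * ((scaleSeq n).1 * jap w ^ k)) (fun _ => norm_nonneg _)
    (fun n => ?_) (by simpa using (tendsto_scaleSeq.mul_const (jap w ^ k)).const_mul C)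
  rw [← moyal_sub_left c (hs _).zpow hf.zpow hg.zpow]
  simpa using h (scaleSeq n) w c ⟨neg_abs_le c, le_abs_self c⟩

lemma tendsto_moyal_right (c : ℝ) {k : ℤ} (hf : CB f) (hg : CB g) {s : Scale → Plane → ℂ}
    (hs : ∀ ε, CB (s ε)) (ha : AmpFamily (fun ε z => ε.1 * jap z ^ k) (fun ε z => s ε z - g z))
    (w : Plane) :
    Tendsto (fun n => moyal c f (s (scaleSeq n)) w) atTop (𝓝 (moyal c f g w)) := by
  obtain ⟨C, hC, h⟩ := exists_norm_moyal_le (lam := fun _ => 1) (k := 0) (fun _ => zero_le_one)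
    (fun ε : Scale => ε.2.1.le) ((hf.reindex fun _ : Scale => ()).congr_weight fun _ _ => by simp)
    ha |c|
  rw [tendsto_iff_norm_sub_tendsto_zero]
  refine squeeze_zero (g := fun n => C * ((scaleSeq n).1 * jap w ^ k)) (fun _ => norm_nonneg _)
    (fun n => ?_) (by simpa using (tendsto_scaleSeq.mul_const (jap w ^ k)).const_mul C)
  rw [← moyal_sub_right c hf.zpow (hs _).zpow hg.zpow]
  simpa using h (scaleSeq n) w c ⟨neg_abs_le c, le_abs_self c⟩

lemma sympExp_add_right (p q r : Plane) : sympExp p (q + r) = sympExp p q * sympExp p r := by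
  rw [sympExp, sympExp, sympExp, ← Complex.exp_add, symp_add_right]
  push_cast
  ring_nf

lemma integral_translate_mul_sympExp (h : 𝓢(Plane, ℂ)) (w p : Plane) :
    ∫ q, h (w + q) * sympExp p q = sympExp p (-w) * sympFourier h p := by
  rw [sympFourier_eq, ← integral_const_mul,
    ← integral_add_left_eq_self (fun q => sympExp p (-w) * (sympExp p q * h q)) w]
  refine integral_congr_ae (Eventually.of_forall fun q => ?_)
  beta_reduce
  rw [← mul_assoc, ← sympExp_add_right, neg_add_cancel_left, mul_comm]

/-- The Moyal product with a Schwartz function on the right is a superposition of translates. -/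
lemma moyal_schwartz_right (c : ℝ) (hg : CB g) (h : 𝓢(Plane, ℂ)) (w : Plane) :
    moyal c g h w = 1 / (2 * (Real.pi : ℂ)) ^ 2 *
      ∫ p, g (w + c • p) * (sympExp p (-w) * sympFourier h p) := by
  rw [moyal]
  congr 1
  obtain ⟨χ, hχ⟩ := exists_schwartz_eq_one Plane
  have hA := amp_moyalAmp c hg.zpow (CB.of_schwartz h).zpow w
  have h1 := ((ampFamily_cutoff_sub χ).comp_affine
    (fun _ => ContinuousLinearMap.fst ℝ Plane Plane) (fun _ => 0) (fun _ => le_rfl)).mul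
    (hA.reindex fun _ : Scale => ())
  -- a cutoff in the first variable suffices, as the second factor decays
  have h2 : AmpFamily (fun ε z => ε.1 * jap z ^ (1 : ℤ)) (fun (ε : Scale) z =>
      χ (ε.1 • z.1) * moyalAmp c g h w z - moyalAmp c g h w z) := by
    have h3 := h1.mono (w' := fun ε z => ε.1 * jap z ^ (1 : ℤ)) zero_le_one fun ε z => by
      have := norm_fst_le z
      have := ε.2.1
      simp only [abs_zero, add_zero, ContinuousLinearMap.coe_fst', jap, zpow_zero, zpow_one,
        mul_one, one_mul]
      gcongr
    simpa [hχ, sub_mul] using h3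
  have hlim := moyalPhase.tendsto_oscInt hA h2
  have hgb : Integrable (fun p => g (w + c • p) * (sympExp p (-w) * sympFourier h p)) := by
    obtain ⟨C, hC, hb⟩ := hg.exists_norm_le
    have e1 : Integrable (fun p => sympExp p (-w) * sympFourier h p) :=
      (integrable_sympFourier h).bdd_mul (c := 1)
        (continuous_sympExp.comp (continuous_id.prodMk continuous_const)).aestronglyMeasurable
        (Eventually.of_forall fun p => (norm_sympExp _ _).le)
    exact e1.bdd_mul (c := C)
      ((amp_scale hg c w).smooth ()).continuous.aestronglyMeasurable
      (Eventually.of_forall fun p => by simpa using hb () (w + c • p))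
  refine tendsto_nhds_unique hlim (((hasOscIntegral_of_integrable hgb χ hχ).2.comp
    tendsto_scaleSeq_nhdsGT).congr fun n => ?_)
  have i1 : Integrable (fun p => χ ((scaleSeq n).1 • p) * g (w + c • p)) := by
    obtain ⟨C, hC, hb⟩ := hg.exists_norm_le
    exact (χ.integrable.comp_smul (scaleSeq n).2.1.ne').mul_bdd (c := C)
      ((amp_scale hg c w).smooth ()).continuous.aestronglyMeasurable
      (Eventually.of_forall fun p => by simpa using hb () (w + c • p))
  have i2 : Integrable (fun q => h (w + q)) := h.integrable.comp_add_left w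
  have i3 := i1.mul_prod i2
  have i4 : Integrable (fun z : Plane × Plane => χ ((scaleSeq n).1 • z.1) * moyalAmp c g h w z) := by
    refine i3.congr (Eventually.of_forall fun z => ?_)
    simp only [moyalAmp, mul_assoc]
  rw [moyalPhase.oscInt_eq_integral i4, Function.comp_apply]
  have i5 := integrable_mul_osc moyalPhase i4
  rw [Measure.volume_eq_prod] at i5 ⊢
  rw [integral_prod _ i5]
  refine integral_congr_ae (Eventually.of_forall fun p => ?_)
  beta_reduce
  rw [← integral_translate_mul_sympExp, ← mul_assoc, ← integral_const_mul]
  refine integral_congr_ae (Eventually.of_forall fun q => ?_)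
  simp only [moyalAmp, moyalPhase_osc, sympExp]
  ring

/-- For Schwartz functions this is Fourier inversion. -/
lemma moyal_one_left (c : ℝ) (hg : CB g) (w : Plane) : moyal c (fun _ => 1) g w = g w := by
  obtain ⟨s, hs⟩ := hg.exists_approx
  have h1 := tendsto_moyal_right c (CB.const 1) hg (fun ε => CB.of_schwartz (s ε)) hs w
  have h2 : Tendsto (fun n => s (scaleSeq n) w) atTop (𝓝 (g w)) := by
    obtain ⟨C, hC, hb⟩ := hs.exists_norm_le
    rw [tendsto_iff_norm_sub_tendsto_zero]
    exact squeeze_zero (g := fun n => C * ((scaleSeq n).1 * jap w ^ (1 : ℤ)))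
      (fun _ => norm_nonneg _) (fun n => hb (scaleSeq n) w)
      (by simpa using (tendsto_scaleSeq.mul_const (jap w)).const_mul C)
  refine tendsto_nhds_unique h1 (h2.congr fun n => ?_)
  have hp : (2 * (Real.pi : ℂ)) ^ 2 ≠ 0 := by
    have : (Real.pi : ℂ) ≠ 0 := by exact_mod_cast Real.pi_ne_zero
    exact pow_ne_zero 2 (mul_ne_zero two_ne_zero this)
  rw [moyal_schwartz_right c (CB.const 1)]
  simp only [one_mul, integral_sympFourier]
  field_simp

/-- For the parameter zero the Moyal product is the pointwise product. -/
lemma moyal_zero (hg : CB g) (w : Plane) : moyal 0 f g w = f w * g w := by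
  have e : f w * moyal 0 (fun _ => 1) g w = moyal 0 f g w := by
    rw [← moyal_const_mul_left 0 (f w) (CB.const 1).zpow hg.zpow, moyal, moyal]
    congr 2
    funext z
    simp [moyalAmp]
  rw [← e, moyal_one_left 0 hg]

lemma moyal_zero_right (c : ℝ) (hf : CB f) (w : Plane) : moyal c f (fun _ => 0) w = 0 := by
  have := moyal_const_mul_right c 0 hf.zpow (CB.const 0).zpow w
  simpa using this

/-- The derivative in the parameter vanishes, so that the product with `1` is the pointwise one. -/
lemma moyal_one_right (c : ℝ) (hf : CB f) (w : Plane) : moyal c f (fun _ => 1) w = f w := by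
  have h1 : ∀ i, pd i (fun _ => (1 : ℂ)) = fun _ => 0 := fun i => by
    funext z
    simp [pd]
  have h2 : ∀ c, HasDerivAt (fun c => moyal c f (fun _ => 1) w) 0 c := fun c => by
    have := hasDerivAt_moyal hf (CB.const 1) w c
    simpa only [h1, moyal_zero_right c (hf.pd _), sub_zero, mul_zero] using this
  rw [is_const_of_deriv_eq_zero (fun c => (h2 c).differentiableAt) (fun c => (h2 c).deriv) c 0,
    moyal_zero (CB.const 1), mul_one]

/-- A volume preserving linear change of variables in an oscillatory integral. -/
lemma HasOscIntegral.comp_measurePreserving {V : Type*} [NormedAddCommGroup V] [NormedSpace ℝ V]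
    [MeasureSpace V] [BorelSpace V] {a : V → ℂ} {I : ℂ} (h : HasOscIntegral a I) (L : V ≃L[ℝ] V)
    (hL : MeasurePreserving L volume volume) : HasOscIntegral (fun z => a (L z)) I := fun χ hχ => by
  have hχ' : SchwartzMap.compCLMOfContinuousLinearEquiv ℂ L.symm χ 0 = 1 := by simpa using hχ
  have he := L.toHomeomorph.measurableEmbedding
  obtain ⟨h1, h2⟩ := h _ hχ'
  have e : ∀ (ε : ℝ) (z : V), χ (ε • z) * a (L z) =
      (fun z => SchwartzMap.compCLMOfContinuousLinearEquiv ℂ L.symm χ (ε • z) * a z) (L z) :=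
    fun ε z => by simp
  refine ⟨fun ε hε => ?_, h2.congr fun ε => ?_⟩
  · simp only [e]
    exact (hL.integrable_comp_emb he).2 (h1 ε hε)
  · simp only [e]
    exact (hL.integral_comp he _).symm

/-- Exchanging the factors of the Moyal product reverses the sign of the parameter. -/
lemma moyal_swap {c : ℝ} (hc : c ≠ 0) (hf : CB f) (hg : CB g) (w : Plane) :
    moyal c f g w = moyal (-c) g f w := by
  let A : Plane ≃L[ℝ] Plane := ContinuousLinearEquiv.smulLeft (Units.mk0 c⁻¹ (inv_ne_zero hc))
  let B : Plane ≃L[ℝ] Plane := ContinuousLinearEquiv.smulLeft (Units.mk0 (-c) (neg_ne_zero.2 hc))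
  let L : (Plane × Plane) ≃L[ℝ] (Plane × Plane) :=
    (ContinuousLinearEquiv.prodComm ℝ Plane Plane).trans (A.prodCongr B)
  have hLz : ∀ z, L z = (c⁻¹ • z.2, (-c) • z.1) := fun z => rfl
  have hL : MeasurePreserving L volume volume := by
    let D : (Plane × Plane) →ₗ[ℝ] (Plane × Plane) :=
      LinearMap.prodMap (c⁻¹ • LinearMap.id) ((-c) • LinearMap.id)
    have hdet : LinearMap.det D = 1 := by
      rw [LinearMap.det_prodMap, LinearMap.det_smul, LinearMap.det_smul]
      simp [hc]
    have hD : MeasurePreserving D volume volume :=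
      ⟨D.continuous_of_finiteDimensional.measurable, by
        rw [Measure.map_linearMap_addHaar_eq_smul_addHaar volume (by simp [hdet]), hdet]
        simp⟩
    have hswap : MeasurePreserving (Prod.swap : Plane × Plane → Plane × Plane) volume volume :=
      Measure.measurePreserving_swap
    exact hD.comp hswap
  have h1 := (hasOscIntegral_moyal c hf.zpow hg.zpow w).comp_measurePreserving L hL
  have h2 := hasOscIntegral_moyal (-c) hg.zpow hf.zpow w
  rw [moyal, moyal, h2.unique (J := moyalPhase.oscInt (moyalAmp c f g w)) ?_]
  convert h1 using 2 with z
  have e : symp (c⁻¹ • z.2) ((-c) • z.1) = symp z.1 z.2 := by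
    simp only [symp, PiLp.smul_apply, smul_eq_mul]
    field_simp
    ring
  rw [hLz, moyalPhase_osc, moyalPhase_osc, e, moyalAmp, moyalAmp, smul_smul, mul_inv_cancel₀ hc,
    one_smul]
  ring

/-- Left and right multiplication by Schwartz functions are superpositions of modulated translations,
and these commute. -/
lemma moyal_assoc_schwartz {c : ℝ} (hc : c ≠ 0) (f : 𝓢(Plane, ℂ)) (hg : CB g) (h : 𝓢(Plane, ℂ))
    (w : Plane) : moyal c (moyal c f g) h w = moyal c f (moyal c g h) w := by
  have cf := CB.of_schwartz f
  have ch := CB.of_schwartz h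
  rw [moyal_schwartz_right c (cf.moyal hg c), moyal_swap hc cf (hg.moyal ch c),
    moyal_schwartz_right (-c) (hg.moyal ch c)]
  simp only [moyal_swap hc cf hg, moyal_schwartz_right (-c) hg f, moyal_schwartz_right c hg h]
  congr 1
  have e1 : ∀ p : Plane, 1 / (2 * (Real.pi : ℂ)) ^ 2 *
      (∫ p', g (w + c • p + -c • p') * (sympExp p' (-(w + c • p)) * sympFourier f p')) *
      (sympExp p (-w) * sympFourier h p) = ∫ p', 1 / (2 * (Real.pi : ℂ)) ^ 2 *
      (g (w + c • p + -c • p') * (sympExp p' (-(w + c • p)) * sympFourier f p')) *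
      (sympExp p (-w) * sympFourier h p) := fun p => by
    rw [← integral_const_mul, ← integral_mul_const]
  have e2 : ∀ p' : Plane, 1 / (2 * (Real.pi : ℂ)) ^ 2 *
      (∫ p, g (w + -c • p' + c • p) * (sympExp p (-(w + -c • p')) * sympFourier h p)) *
      (sympExp p' (-w) * sympFourier f p') = ∫ p, 1 / (2 * (Real.pi : ℂ)) ^ 2 *
      (g (w + c • p + -c • p') * (sympExp p' (-(w + c • p)) * sympFourier f p')) *
      (sympExp p (-w) * sympFourier h p) := fun p' => by
    rw [← integral_const_mul, ← integral_mul_const]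
    refine integral_congr_ae (Eventually.of_forall fun p => ?_)
    have e3 : sympExp p (-(w + -c • p')) * sympExp p' (-w) =
        sympExp p' (-(w + c • p)) * sympExp p (-w) := by
      simp only [sympExp, ← Complex.exp_add, symp, PiLp.add_apply, PiLp.neg_apply, PiLp.smul_apply,
        smul_eq_mul]
      push_cast
      ring_nf
    beta_reduce
    rw [add_right_comm w]
    linear_combination (1 / (2 * (Real.pi : ℂ)) ^ 2 * g (w + c • p + -c • p') * sympFourier f p' *
      sympFourier h p) * e3
  simp only [e1, e2]
  refine integral_integral_swap ?_
  have i1 := (integrable_sympFourier h).mul_prod (integrable_sympFourier f)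
  obtain ⟨C, hC, hb⟩ := hg.exists_norm_le
  have i2 := i1.bdd_mul (c := ‖1 / (2 * (Real.pi : ℂ)) ^ 2‖ * C) (f := fun z : Plane × Plane =>
    1 / (2 * (Real.pi : ℂ)) ^ 2 * g (w + c • z.1 + -c • z.2) *
      (sympExp z.2 (-(w + c • z.1)) * sympExp z.1 (-w))) ?_ (Eventually.of_forall fun z => ?_)
  · refine i2.congr (Eventually.of_forall fun z => ?_)
    simp only [Function.uncurry]
    ring
  · refine Continuous.aestronglyMeasurable ?_
    have k1 := (hg.smooth ()).continuous
    have k2 : Continuous fun z : Plane × Plane => sympExp z.2 (-(w + c • z.1)) :=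
      continuous_sympExp.comp (f := fun z : Plane × Plane => (z.2, -(w + c • z.1))) (by fun_prop)
    have k3 : Continuous fun z : Plane × Plane => sympExp z.1 (-w) :=
      continuous_sympExp.comp (f := fun z : Plane × Plane => (z.1, -w)) (by fun_prop)
    exact (continuous_const.mul (k1.comp (by fun_prop))).mul (k2.mul k3)
  · rw [norm_mul, norm_mul, norm_mul, norm_sympExp, norm_sympExp, mul_one, mul_one]
    exact mul_le_mul_of_nonneg_left (by simpa using hb () _) (norm_nonneg _)

lemma moyal_assoc {c : ℝ} (hc : c ≠ 0) (hf : CB f) (hg : CB g) (hh : CB h) (w : Plane) :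
    moyal c (moyal c f g) h w = moyal c f (moyal c g h) w := by
  have one : ∀ {g : Plane → ℂ}, CB g → AmpFamily (fun (_ : Scale) z => 1 * jap z ^ (0 : ℤ))
    fun _ => g := fun hg => (hg.reindex fun _ => ()).congr_weight fun _ _ => by simp
  -- first for a Schwartz function on the left
  have step : ∀ f : 𝓢(Plane, ℂ), moyal c (moyal c f g) h w = moyal c f (moyal c g h) w := fun f => by
    obtain ⟨s, hs⟩ := hh.exists_approx
    have cf := CB.of_schwartz f
    have cs := fun ε => CB.of_schwartz (s ε)
    have h1 := tendsto_moyal_right c (cf.moyal hg c) hh cs hs w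
    have h3 := (ampFamily_moyal (fun _ => zero_le_one) (fun ε : Scale => ε.2.1.le) (one hg) hs
      (fun _ => hg) (fun ε => (cs ε).sub hh) c)
    have h4 : AmpFamily (fun ε z => ε.1 * jap z ^ (0 + 1 : ℤ))
        (fun (ε : Scale) z => moyal c g (s ε) z - moyal c g h z) := by
      have e : (fun (ε : Scale) z => moyal c g (s ε) z - moyal c g h z) =
          fun ε => moyal c g (fun z => s ε z - h z) := by
        funext ε z
        rw [moyal_sub_right c hg.zpow (cs _).zpow hh.zpow]
      rw [e]
      simpa only [one_mul] using h3
    have h2 := tendsto_moyal_right c cf (hg.moyal hh c) (fun ε => hg.moyal (cs ε) c) h4 w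
    exact tendsto_nhds_unique h1 (h2.congr fun n => (moyal_assoc_schwartz hc f hg _ w).symm)
  obtain ⟨s, hs⟩ := hf.exists_approx
  have cs := fun ε => CB.of_schwartz (s ε)
  have h1 := tendsto_moyal_left c hf (hg.moyal hh c) cs hs w
  have h3 := (ampFamily_moyal (fun ε : Scale => ε.2.1.le) (fun _ => zero_le_one) hs (one hg)
    (fun ε => (cs ε).sub hf) (fun _ => hg) c)
  have h4 : AmpFamily (fun ε z => ε.1 * jap z ^ (1 + 0 : ℤ))
      (fun (ε : Scale) z => moyal c (s ε) g z - moyal c f g z) := by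
    have e : (fun (ε : Scale) z => moyal c (s ε) g z - moyal c f g z) =
        fun ε => moyal c (fun z => s ε z - f z) g := by
      funext ε z
      rw [moyal_sub_left c (cs _).zpow hf.zpow hg.zpow]
    rw [e]
    simpa only [mul_one] using h3
  have h2 := tendsto_moyal_left c (hf.moyal hg c) hh (fun ε => (cs ε).moyal hg c) h4 w
  exact tendsto_nhds_unique h2 (h1.congr fun n => (step _).symm)

end MoyalAlgebra

/-! ### Star-functions -/

section StarFunction

open MeasureTheory Filter

/-- The pullback of a phase under a linear isomorphism. -/
def Phase.comp {V W : Type*} [NormedAddCommGroup V] [NormedSpace ℝ V] [NormedAddCommGroup W]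
    [NormedSpace ℝ W] (P : Phase V) (L : W ≃L[ℝ] V) : Phase W where
  toFun z := P.toFun (L z)
  contDiff := P.contDiff.comp L.contDiff
  card := P.card
  dir j := L.symm (P.dir j)
  form j := (P.form j).comp (L : W →L[ℝ] V)
  fderiv_apply j z := by
    have h := ((P.contDiff.differentiable (by simp) (L z)).hasFDerivAt.comp z L.hasFDerivAt).fderiv
    simp only [Function.comp_def] at h
    rw [h]
    simp [P.fderiv_apply]
  eq_zero z h := by simpa using P.eq_zero (L z) h

variable {ħ : ℝ} {f g : Plane → ℂ}

/-- The symplectic frequency `p = ħ⁻¹ rot ξ`, for which `⟨ξ, x⟩ / ħ = ω(p, x)`. -/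
def freq (hħ : ħ ≠ 0) : Plane ≃L[ℝ] Plane :=
  rot.toContinuousLinearEquiv.trans
    (ContinuousLinearEquiv.smulLeft (Units.mk0 ħ⁻¹ (inv_ne_zero hħ)))

lemma freq_apply (hħ : ħ ≠ 0) (ξ : Plane) : freq hħ ξ = ħ⁻¹ • rot ξ := rfl

lemma symp_freq (hħ : ħ ≠ 0) (ξ x : Plane) : symp (freq hħ ξ) x = ħ⁻¹ * inner ℝ ξ x := by
  rw [freq_apply, symp_smul_left, inner_plane, symp, rot_zero, rot_one]
  ring

lemma symp_freq_freq (hħ : ħ ≠ 0) (ξ η : Plane) :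
    symp (freq hħ ξ) (freq hħ η) = ħ⁻¹ ^ 2 * symp ξ η := by
  rw [freq_apply, freq_apply, symp_smul_left, symp_smul_right, symp, symp, rot_zero, rot_one,
    rot_zero, rot_one]
  ring

lemma integral_comp_freq (hħ : ħ ≠ 0) (F : Plane → ℂ) :
    ∫ ξ, F (freq hħ ξ) = (ħ : ℂ) ^ 2 * ∫ p, F p := by
  simp only [freq_apply]
  rw [rot.measurePreserving.integral_comp rot.toHomeomorph.measurableEmbedding
    (fun p => F (ħ⁻¹ • p)), Measure.integral_comp_smul, finrank_euclideanSpace_fin,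
    Complex.real_smul]
  congr 1
  rw [inv_pow, inv_inv, abs_of_nonneg (sq_nonneg ħ)]
  push_cast
  rfl

lemma planeWave_inv (hħ : ħ ≠ 0) (ξ x : Plane) :
    (planeWave ħ ξ x)⁻¹ = sympExp (freq hħ ξ) x := by
  have : (ħ : ℂ) ≠ 0 := by exact_mod_cast hħ
  rw [planeWave, sympExp, ← Complex.exp_neg, symp_freq]
  congr 1
  push_cast
  field_simp
  rw [Complex.I_sq]
  ring

lemma fourier_testIntertwiner (ħ : ℝ) (M : Matrix (Fin 2) (Fin 2) ℂ) (φ : testSpace) (w : Plane) :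
    (𝓕 (testIntertwiner ħ M φ).1 : 𝓢(Plane, ℂ)) w =
      intertwinerSymbol ħ M w * (𝓕 φ.1 : 𝓢(Plane, ℂ)) w := by
  change (𝓕 (𝓕⁻ (multiplied ħ M φ)) : 𝓢(Plane, ℂ)) w = _
  rw [FourierTransform.fourier_fourierInv_eq]
  rfl

lemma quad_smul (M : Matrix (Fin 2) (Fin 2) ℂ) (c : ℝ) (ξ : Plane) :
    quad M (c • ξ) = (c : ℂ) ^ 2 * quad M ξ := by
  simp only [quad, Fin.sum_univ_two, PiLp.smul_apply, smul_eq_mul]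
  push_cast
  ring

/-- The pairing of a star-exponential with a test function is the Fourier transform of the
transposed intertwiner applied to the test function. -/
lemma integral_starExp_mul (hħ : ħ ≠ 0) (K : Matrix (Fin 2) (Fin 2) ℂ) (φ : testSpace)
    (ξ : Plane) : ∫ w, starExp ħ K ξ w * φ.1 w =
      sympFourier (testIntertwiner ħ K φ).1 (-(freq hħ ξ)) := by
  have hħ' : (ħ : ℂ) ≠ 0 := by exact_mod_cast hħ
  have hpi : (Real.pi : ℂ) ≠ 0 := by exact_mod_cast Real.pi_ne_zero
  have e : (2 * Real.pi)⁻¹ • rot (-(freq hħ ξ)) = ((2 * Real.pi)⁻¹ * ħ⁻¹) • ξ := by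
    rw [freq_apply]
    refine plane_ext ?_ ?_
    · simp only [PiLp.smul_apply, smul_eq_mul, rot_zero, rot_one, PiLp.neg_apply]
      ring
    · simp only [PiLp.smul_apply, smul_eq_mul, rot_zero, rot_one, PiLp.neg_apply]
      ring
  have e' : ∫ w, starExp ħ K ξ w * φ.1 w = Complex.exp (1 / (4 * Complex.I * ħ) * quad K ξ) *
      ∫ w, planeWave ħ ξ w * φ.1 w := by
    rw [← integral_const_mul]
    simp only [starExp, mul_assoc]
  rw [e', sympFourier, fourier_testIntertwiner, ← sympFourier, sympFourier_eq, e]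
  congr 1
  · rw [intertwinerSymbol, quad_smul]
    congr 1
    push_cast
    field_simp
    ring_nf
    simp only [Complex.I_pow_four]
    ring
  · refine integral_congr_ae (Eventually.of_forall fun w => ?_)
    have : planeWave ħ ξ w = sympExp (-(freq hħ ξ)) w := by
      rw [← inv_inv (planeWave ħ ξ w), planeWave_inv hħ, sympExp, sympExp, ← Complex.exp_neg,
        ← neg_one_smul ℝ (freq hħ ξ), symp_smul_left]
      congr 1
      push_cast
      ring
    simp only [this]

lemma amp_sympFourier (ψ : 𝓢(Plane, ℂ)) : CB (sympFourier ψ) := by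
  have h := (amp_schwartz_one (𝓕 ψ)).comp_affine
    (fun _ => (2 * Real.pi)⁻¹ • (rot.toContinuousLinearEquiv : Plane →L[ℝ] Plane)) (fun _ => 0)
    (fun _ => le_rfl)
  simp only [add_zero] at h
  exact h

lemma CB.comp_clm {V : Type*} [NormedAddCommGroup V] [NormedSpace ℝ V] (hf : CB f)
    (T : V →L[ℝ] Plane) : Amp (fun _ => 1) (fun z : V => f (T z)) := by
  simpa using hf.comp_affine (fun _ => T) (fun _ => 0) (fun _ => le_rfl)

lemma CB.integrable_mul (hf : CB f) (ψ : 𝓢(Plane, ℂ)) : Integrable (fun x => f x * ψ x) := by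
  obtain ⟨C, hC, hb⟩ := hf.exists_norm_le
  exact ψ.integrable.bdd_mul (c := C) (hf.smooth ()).continuous.aestronglyMeasurable
    (Eventually.of_forall fun p => by simpa using hb () p)

lemma tendsto_integral_mul_schwartz {k : ℤ} (hf : CB f) {s : Scale → Plane → ℂ}
    (hs : ∀ ε, CB (s ε)) (ha : AmpFamily (fun ε z => ε.1 * jap z ^ k) (fun ε z => s ε z - f z))
    (ψ : 𝓢(Plane, ℂ)) :
    Tendsto (fun n => ∫ x, s (scaleSeq n) x * ψ x) atTop (𝓝 (∫ x, f x * ψ x)) := by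
  obtain ⟨C, hC, h⟩ := ha.exists_norm_le
  have hint : Integrable (fun x => jap x ^ k * ‖ψ x‖) := by
    have h1 := (amp_schwartz ψ (k - decayExp Plane).toNat).exists_norm_le
    obtain ⟨D, hD, h1⟩ := h1
    refine (integrable_jap.const_mul D).mono' ?_ (Eventually.of_forall fun x => ?_)
    · have : Continuous fun x : Plane => jap x ^ k := by
        unfold jap
        exact Continuous.zpow₀ (by fun_prop) k fun x => Or.inl (jap_pos x).ne'
      exact (this.mul ψ.continuous.norm).aestronglyMeasurable
    · rw [norm_mul, norm_norm, Real.norm_of_nonneg (jap_zpow_nonneg x k)]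
      calc jap x ^ k * ‖ψ x‖
          ≤ jap x ^ k * (D * jap x ^ (-((k - decayExp Plane).toNat : ℤ))) :=
            mul_le_mul_of_nonneg_left (h1 () x) (jap_zpow_nonneg x k)
        _ = D * jap x ^ (k + -((k - decayExp Plane).toNat : ℤ)) := by
            rw [zpow_add₀ (jap_pos x).ne']
            ring
        _ ≤ D * jap x ^ decayExp Plane := by
            refine mul_le_mul_of_nonneg_left (jap_zpow_le_of_le x ?_) hD
            have := Int.self_le_toNat (k - decayExp Plane)
            linarith
  rw [tendsto_iff_norm_sub_tendsto_zero]
  refine squeeze_zero (g := fun n => (scaleSeq n).1 * (C * ∫ x, jap x ^ k * ‖ψ x‖))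
    (fun _ => norm_nonneg _) (fun n => ?_) (by simpa using tendsto_scaleSeq.mul_const _)
  rw [← integral_sub ((hs _).integrable_mul ψ) (hf.integrable_mul ψ), ← integral_const_mul,
    ← integral_const_mul]
  refine norm_integral_le_of_norm_le ((hint.const_mul _).const_mul _)
    (Eventually.of_forall fun x => ?_)
  rw [← sub_mul, norm_mul]
  calc ‖s (scaleSeq n) x - f x‖ * ‖ψ x‖ ≤ C * ((scaleSeq n).1 * jap x ^ k) * ‖ψ x‖ :=
        mul_le_mul_of_nonneg_right (h _ x) (norm_nonneg _)
    _ = _ := by ring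

/-- The phase `⟨ξ, x⟩ / ħ` in the variables `(x, ξ)`. -/
def starPhase (hħ : ħ ≠ 0) : Phase (Plane × Plane) :=
  moyalPhase.comp ((ContinuousLinearEquiv.prodComm ℝ Plane Plane).trans
    ((freq hħ).prodCongr (ContinuousLinearEquiv.refl ℝ Plane)))

lemma starPhase_osc (hħ : ħ ≠ 0) (z : Plane × Plane) :
    (starPhase hħ).osc z = sympExp (freq hħ z.2) z.1 := rfl

/-- The amplitude of the integral that defines star-functions, with `ψ` in place of the transform
of the test function. -/
def starAmp (hħ : ħ ≠ 0) (f : Plane → ℂ) (ψ : 𝓢(Plane, ℂ)) (z : Plane × Plane) : ℂ :=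
  f z.1 * sympFourier ψ (-(freq hħ z.2))

lemma amp_starAmp (hħ : ħ ≠ 0) (hf : CB f) (ψ : 𝓢(Plane, ℂ)) :
    Amp (fun z => jap z ^ (0 : ℤ)) (starAmp hħ f ψ) :=
  ((hf.comp_clm (.fst ℝ Plane Plane)).mul ((amp_sympFourier ψ).comp_clm
    (-((freq hħ : Plane →L[ℝ] Plane).comp (.snd ℝ Plane Plane))))).congr_weight fun _ _ => by simp

lemma integrable_comp_freq (hħ : ħ ≠ 0) {F : Plane → ℂ} (hF : Integrable F) :
    Integrable (fun ξ => F (freq hħ ξ)) := by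
  have h1 : Integrable (fun p => F (ħ⁻¹ • p)) := hF.comp_smul (inv_ne_zero hħ)
  exact (rot.measurePreserving.integrable_comp_emb rot.toHomeomorph.measurableEmbedding).2 h1

lemma sympExp_neg_left (p q : Plane) : sympExp (-p) q = sympExp p (-q) := by
  simp only [sympExp, symp, PiLp.neg_apply]
  ring_nf

/-- For Schwartz functions this is Fubini's theorem and Fourier inversion. -/
lemma oscInt_starAmp_schwartz (hħ : ħ ≠ 0) (f ψ : 𝓢(Plane, ℂ)) :
    (starPhase hħ).oscInt (starAmp hħ f ψ) = (2 * (Real.pi : ℂ) * ħ) ^ 2 * ∫ x, f x * ψ x := by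
  have i1 : Integrable (starAmp hħ f ψ) :=
    f.integrable.mul_prod (integrable_comp_freq hħ (integrable_sympFourier ψ).comp_neg)
  have i2 := integrable_mul_osc (starPhase hħ) i1
  rw [(starPhase hħ).oscInt_eq_integral i1]
  rw [Measure.volume_eq_prod] at i2 ⊢
  rw [integral_prod _ i2, ← integral_const_mul]
  refine integral_congr_ae (Eventually.of_forall fun x => ?_)
  have h1 : ∫ p, sympFourier ψ (-p) * sympExp p x = (2 * (Real.pi : ℂ)) ^ 2 * ψ x := by
    rw [← integral_sympFourier, ← integral_neg_eq_self]
    simp only [neg_neg, sympExp_neg_left, mul_comm]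
  have h := integral_comp_freq hħ fun p => sympFourier ψ (-p) * sympExp p x
  simp only [starAmp, starPhase_osc, mul_assoc]
  rw [integral_const_mul, h, h1]
  ring

/-- The general case follows by Schwartz approximation, since both sides depend continuously on `f`. -/
lemma oscInt_starAmp (hħ : ħ ≠ 0) (hf : CB f) (ψ : 𝓢(Plane, ℂ)) :
    (starPhase hħ).oscInt (starAmp hħ f ψ) = (2 * (Real.pi : ℂ) * ħ) ^ 2 * ∫ x, f x * ψ x := by
  obtain ⟨s, hs⟩ := hf.exists_approx
  have h1 : AmpFamily (fun (ε : Scale) z => ε.1 * jap z ^ (1 : ℤ)) (fun ε z =>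
      starAmp hħ (s ε) ψ z - starAmp hħ f ψ z) := by
    have h2 := (hs.comp_affine (fun _ => ContinuousLinearMap.fst ℝ Plane Plane) (fun _ => 0)
      (fun _ => le_rfl)).mul (((amp_sympFourier ψ).comp_clm
      (-((freq hħ : Plane →L[ℝ] Plane).comp (.snd ℝ Plane Plane)))).reindex fun _ : Scale => ())
    have h3 := h2.mono (w' := fun ε z => ε.1 * jap z ^ (1 : ℤ)) zero_le_one fun ε z => by
      have := norm_fst_le z
      have := ε.2.1
      simp only [add_zero, ContinuousLinearMap.coe_fst', jap, zpow_one, mul_one, one_mul]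
      gcongr
    simpa [starAmp, sub_mul] using h3
  have h2 := (starPhase hħ).tendsto_oscInt (amp_starAmp hħ hf ψ) h1
  simp only [oscInt_starAmp_schwartz] at h2
  exact tendsto_nhds_unique h2
    ((tendsto_integral_mul_schwartz hf (fun ε => CB.of_schwartz _) hs ψ).const_mul _)

/-- The generalised function `φ ↦ ∫ f · (T_K φ)`, where `T_K` is the operator
`exp((iħ/4) ∑ K_{ij} ∂_i ∂_j)` on test functions. It is the star-function of `f`; see
`isStarFunction_iff`. -/
def starFun (ħ : ℝ) (K : Matrix (Fin 2) (Fin 2) ℂ) (hf : CB f) : GenFun where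
  toFun φ := ∫ x, f x * (testIntertwiner ħ K φ).1 x
  map_add' φ φ' := by
    rw [← integral_add (hf.integrable_mul _) (hf.integrable_mul _)]
    simp [mul_add]
  map_smul' c φ := by
    rw [RingHom.id_apply, smul_eq_mul, ← integral_const_mul]
    simp [mul_left_comm]

lemma starFun_apply (ħ : ℝ) (K : Matrix (Fin 2) (Fin 2) ℂ) (hf : CB f) (φ : testSpace) :
    starFun ħ K hf φ = ∫ x, f x * (testIntertwiner ħ K φ).1 x := rfl

lemma isStarFunction_starFun (hħ : ħ ≠ 0) (K : Matrix (Fin 2) (Fin 2) ℂ) (hf : CB f) :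
    IsStarFunction ħ K f (starFun ħ K hf) := fun φ => by
  have h := ((starPhase hħ).hasOscIntegral
    (amp_starAmp hħ hf (testIntertwiner ħ K φ).1)).const_mul (1 / (2 * (Real.pi : ℂ) * ħ) ^ 2)
  have hħ' : (ħ : ℂ) ≠ 0 := by exact_mod_cast hħ
  have hpi : (Real.pi : ℂ) ≠ 0 := by exact_mod_cast Real.pi_ne_zero
  rw [oscInt_starAmp hħ hf, ← mul_assoc, one_div_mul_cancel (by simp [hħ', hpi]), one_mul] at h
  rw [starFun_apply]
  convert h using 3 with z
  rw [planeWave_inv hħ, integral_starExp_mul hħ, starPhase_osc, starAmp]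
  ring

lemma isStarFunction_iff (hħ : ħ ≠ 0) (K : Matrix (Fin 2) (Fin 2) ℂ) (hf : CB f) {F : GenFun} :
    IsStarFunction ħ K f F ↔ F = starFun ħ K hf := by
  refine ⟨fun h => LinearMap.ext fun φ => (h φ).unique (isStarFunction_starFun hħ K hf φ), ?_⟩
  rintro rfl
  exact isStarFunction_starFun hħ K hf

end StarFunction

/-! ### Injectivity of the correspondence between symbols and star-functions -/

section Injectivity

open MeasureTheory Filter

variable {ħ : ℝ} {f g : Plane → ℂ}

lemma testSpace_ext {φ φ' : testSpace}
    (h : ∀ w, (𝓕 φ.1 : 𝓢(Plane, ℂ)) w = (𝓕 φ'.1 : 𝓢(Plane, ℂ)) w) : φ = φ' := by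
  have h' : (𝓕 φ.1 : 𝓢(Plane, ℂ)) = 𝓕 φ'.1 := SchwartzMap.ext h
  have h'' := congrArg (fun s : 𝓢(Plane, ℂ) => (𝓕⁻ s : 𝓢(Plane, ℂ))) h'
  simp only [FourierTransform.fourierInv_fourier_eq] at h''
  exact Subtype.ext h''

lemma testIntertwiner_zero (ħ : ℝ) (φ : testSpace) : testIntertwiner ħ 0 φ = φ :=
  testSpace_ext fun w => by simp [fourier_testIntertwiner, intertwinerSymbol, quad]

lemma testIntertwiner_neg (ħ : ℝ) (M : Matrix (Fin 2) (Fin 2) ℂ) (φ : testSpace) :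
    testIntertwiner ħ M (testIntertwiner ħ (0 - M) φ) = φ :=
  testSpace_ext fun w => by
    have e : quad M w + quad (0 - M) w = 0 := by
      simp only [quad, Fin.sum_univ_two, Matrix.sub_apply, Matrix.zero_apply]
      ring
    rw [fourier_testIntertwiner, fourier_testIntertwiner, ← mul_assoc, intertwinerSymbol,
      intertwinerSymbol, ← Complex.exp_add, ← mul_add, e]
    simp

/-- The intertwiner removes the dependence on `K`. -/
lemma intertwiner_starFun (ħ : ℝ) (K : Matrix (Fin 2) (Fin 2) ℂ) (hf : CB f) :
    intertwiner ħ K 0 (starFun ħ K hf) = starFun ħ 0 hf := by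
  refine LinearMap.ext fun φ => ?_
  rw [intertwiner, LinearMap.comp_apply, starFun_apply, starFun_apply, testIntertwiner_neg,
    testIntertwiner_zero]

lemma represents_iff (ħ : ℝ) (hf : CB f) {F : GenFun} :
    Represents F f ↔ F = starFun ħ 0 hf := by
  refine ⟨fun h => LinearMap.ext fun φ => ?_, ?_⟩
  · rw [starFun_apply, testIntertwiner_zero, (h φ).2]
  · rintro rfl φ
    rw [starFun_apply, testIntertwiner_zero]
    exact ⟨hf.integrable_mul _, rfl⟩

/-- Every Schwartz function is a limit of band-limited ones, when tested against bounded smooth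
functions. -/
lemma exists_tendsto_testSpace (ψ : 𝓢(Plane, ℂ)) : ∃ φ : ℕ → testSpace, ∀ f : Plane → ℂ, CB f →
    Tendsto (fun n => ∫ x, f x * (φ n).1 x) atTop (𝓝 (∫ x, f x * ψ x)) := by
  obtain ⟨χ, hχ, hc⟩ := exists_schwartz_hasCompactSupport Plane
  have hc' : ∀ ε : Scale, HasCompactSupport (fun w => χ (ε.1 • w) * 𝓕 ψ w) := fun ε =>
    HasCompactSupport.mul_right (hc.comp_homeomorph (Homeomorph.smulOfNeZero ε.1 ε.2.1.ne'))
  let s : Scale → 𝓢(Plane, ℂ) := fun ε => (hc' ε).toSchwartzMap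
    (((ampFamily_cutoff χ).smooth ε).mul ((amp_schwartz_one (𝓕 ψ)).smooth ()))
  have hs : ∀ ε, 𝓕 (𝓕⁻ (s ε)) = s ε := fun ε => FourierTransform.fourier_fourierInv_eq _
  refine ⟨fun n => ⟨𝓕⁻ (s (scaleSeq n)), ?_⟩, fun f hf => ?_⟩
  · change HasCompactSupport (𝓕 (𝓕⁻ (s (scaleSeq n))) : 𝓢(Plane, ℂ))
    rw [hs]
    exact hc' _
  -- the pairing of `f` with a test function is an oscillatory integral, on the Fourier side of the
  -- test function; any value of the parameter `ħ` serves, and `1` is taken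
  let P := starPhase one_ne_zero
  let T : Plane × Plane →L[ℝ] Plane := ((2 * Real.pi)⁻¹ •
    (rot.toContinuousLinearEquiv : Plane →L[ℝ] Plane)).comp
    (-((freq one_ne_zero : Plane →L[ℝ] Plane).comp (.snd ℝ Plane Plane)))
  have ha : AmpFamily (fun ε z => ε.1 * jap z ^ (1 : ℤ)) (fun (ε : Scale) z =>
      starAmp one_ne_zero f (𝓕⁻ (s ε)) z - starAmp one_ne_zero f ψ z) := by
    have h1 := (((ampFamily_cutoff_sub χ).comp_affine (fun _ => T) (fun _ => 0)
      (fun _ => le_rfl)).mul ((amp_starAmp one_ne_zero hf ψ).reindex fun _ : Scale => ()))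
    have h2 := h1.mono (w' := fun ε z => ε.1 * jap z ^ (1 : ℤ)) (K := max ‖T‖ 1) (by positivity)
      fun ε z => by
        have h3 : jap (T z + 0) ≤ max ‖T‖ 1 * jap z := by
          refine jap_le_of_norm_le (le_max_right _ _) ?_
          rw [add_zero]
          exact (T.le_opNorm z).trans (by gcongr; exact le_max_left _ _)
        have := ε.2.1
        simp only [zpow_zero, zpow_one, mul_one]
        nlinarith
    convert h2 using 3 with ε z
    have e : ∀ h, starAmp one_ne_zero f h z = f z.1 * 𝓕 h (T z) := fun h => rfl
    have e' : s ε (T z) = χ (ε.1 • T z) * 𝓕 ψ (T z) := rfl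
    rw [e, e, hs, e', hχ, add_zero]
    ring
  have h1 := P.tendsto_oscInt (amp_starAmp one_ne_zero hf ψ) ha
  have hne : (2 * (Real.pi : ℂ) * (1 : ℝ)) ^ 2 ≠ 0 := by simp [Real.pi_ne_zero]
  simp only [P, oscInt_starAmp one_ne_zero hf] at h1
  have h2 := h1.const_mul ((2 * (Real.pi : ℂ) * (1 : ℝ)) ^ 2)⁻¹
  simp only [inv_mul_cancel_left₀ hne] at h2
  exact h2

lemma CB.eq_zero_of_integral_eq_zero (hf : CB f) (h : ∀ φ : testSpace, ∫ x, f x * φ.1 x = 0) :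
    f = 0 := by
  have h1 : ∀ ψ : 𝓢(Plane, ℂ), ∫ x, f x * ψ x = 0 := fun ψ => by
    obtain ⟨φ, hφ⟩ := exists_tendsto_testSpace ψ
    have h2 := hφ f hf
    simp only [h] at h2
    exact tendsto_nhds_unique h2 tendsto_const_nhds
  have hc := (hf.smooth ()).continuous
  refine (hc.ae_eq_iff_eq volume continuous_const).1
    (ae_eq_zero_of_integral_contDiff_smul_eq_zero hc.locallyIntegrable fun k hk hkc => ?_)
  have hk1 : HasCompactSupport (fun x => (k x : ℂ)) := hkc.comp_left (g := Complex.ofReal) (by simp)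
  rw [← h1 (hk1.toSchwartzMap (Complex.ofRealCLM.contDiff.comp hk))]
  refine integral_congr_ae (Eventually.of_forall fun x => ?_)
  change k x • f x = f x * (k x : ℂ)
  rw [Complex.real_smul, mul_comm]

lemma starFun_injective (K : Matrix (Fin 2) (Fin 2) ℂ) (hf : CB f) (hg : CB g)
    (h : starFun ħ K hf = starFun ħ K hg) : f = g := by
  have h0 := congrArg (intertwiner ħ K 0) h
  rw [intertwiner_starFun, intertwiner_starFun] at h0
  have h1 := CB.eq_zero_of_integral_eq_zero (f := fun x => f x - g x) (hf.sub hg) fun φ => by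
    have h2 := LinearMap.congr_fun h0 φ
    rw [starFun_apply, starFun_apply, testIntertwiner_zero] at h2
    simp only [sub_mul]
    rw [integral_sub (hf.integrable_mul _) (hg.integrable_mul _), h2, sub_self]
  exact funext fun x => sub_eq_zero.1 (congrFun h1 x)

end Injectivity

/-! ### Products of star-exponentials -/

section StarExp

variable {ħ : ℝ}

/-- Higher derivatives of a joint eigenfunction of all directional derivatives. -/
lemma iteratedFDeriv_eigen {V : Type*} [NormedAddCommGroup V] [NormedSpace ℝ V] {F : V → ℂ}
    (hF : ContDiff ℝ ∞ F) (c : V → ℂ) (h : ∀ w v, fderiv ℝ F w v = c v * F w) (n : ℕ) (w : V)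
    (m : Fin n → V) : iteratedFDeriv ℝ n F w m = (∏ k, c (m k)) * F w := by
  induction n generalizing w with
  | zero => simp
  | succ n ih =>
    have hd : DifferentiableAt ℝ (iteratedFDeriv ℝ n F) w :=
      (hF.differentiable_iteratedFDeriv (by exact_mod_cast ENat.natCast_lt_top n)) w
    rw [iteratedFDeriv_succ_apply_left, ← fderiv_continuousMultilinear_apply_const_apply hd,
      Fin.prod_univ_succ]
    have e : (fun y => iteratedFDeriv ℝ n F y (Fin.tail m)) =
        fun y => (∏ k, c (Fin.tail m k)) * F y := funext fun y => ih y _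
    rw [e, fderiv_const_mul (hF.differentiable (by simp) w), smul_apply, h]
    simp only [Fin.tail, smul_eq_mul]
    ring

lemma hasFDerivAt_starExp (ħ : ℝ) (K : Matrix (Fin 2) (Fin 2) ℂ) (ξ w : Plane) :
    HasFDerivAt (starExp ħ K ξ) (starExp ħ K ξ w • ((1 / (Complex.I * ħ)) •
      Complex.ofRealCLM.comp (innerSL ℝ ξ))) w := by
  have h1 : HasFDerivAt (fun x => ((inner ℝ ξ x : ℝ) : ℂ)) (Complex.ofRealCLM.comp (innerSL ℝ ξ)) w :=
    Complex.ofRealCLM.hasFDerivAt.comp w (innerSL ℝ ξ).hasFDerivAt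
  have h2 := ((h1.const_mul (1 / (Complex.I * ħ))).cexp).const_mul
    (Complex.exp (1 / (4 * Complex.I * ħ) * quad K ξ))
  rw [smul_smul] at h2
  exact h2

lemma contDiff_starExp (ħ : ℝ) (K : Matrix (Fin 2) (Fin 2) ℂ) (ξ : Plane) :
    ContDiff ℝ ∞ (starExp ħ K ξ) := by
  have h1 : ContDiff ℝ ∞ (fun x => ((inner ℝ ξ x : ℝ) : ℂ)) :=
    Complex.ofRealCLM.contDiff.comp (innerSL ℝ ξ).contDiff
  exact contDiff_const.mul (contDiff_const.mul h1).cexp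

lemma iteratedFDeriv_starExp (ħ : ℝ) (K : Matrix (Fin 2) (Fin 2) ℂ) (ξ w : Plane) (n : ℕ)
    (i : Fin n → Fin 2) : iteratedFDeriv ℝ n (starExp ħ K ξ) w (fun k => basisVec (i k)) =
      (∏ k, (1 / (Complex.I * ħ) * (ξ (i k) : ℂ))) * starExp ħ K ξ w := by
  rw [iteratedFDeriv_eigen (contDiff_starExp ħ K ξ)
    (fun v => 1 / (Complex.I * ħ) * ((inner ℝ ξ v : ℝ) : ℂ))]
  · simp [basisVec, EuclideanSpace.inner_single_right]
  · intro w v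
    rw [(hasFDerivAt_starExp ħ K ξ w).fderiv]
    simp
    ring

/-- On star-exponentials the series of the product formula is an exponential series: the sum over
multi-indices of order `n` is an `n`-th power. -/
lemma starFormula_starExp (hħ : ħ ≠ 0) (K : Matrix (Fin 2) (Fin 2) ℂ) (ξ η w : Plane) :
    starFormula ħ K (starExp ħ K ξ) (starExp ħ K η) w =
      Complex.exp (1 / (2 * Complex.I * ħ) * ∑ i, ∑ j, (K + matJ) i j * (ξ i : ℂ) * (η j : ℂ)) *
        (starExp ħ K ξ w * starExp ħ K η w) := by
  have hħ' : (ħ : ℂ) ≠ 0 := by exact_mod_cast hħ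
  set S := ∑ i, ∑ j, (K + matJ) i j * (ξ i : ℂ) * (η j : ℂ) with hS
  set a := 1 / (Complex.I * (ħ : ℂ)) with ha
  have e : ∀ n : ℕ, ∑ i : Fin n → Fin 2, ∑ j : Fin n → Fin 2, (∏ k, (K + matJ) (i k) (j k)) *
      (iteratedFDeriv ℝ n (starExp ħ K ξ) w (fun k => basisVec (i k)) *
        iteratedFDeriv ℝ n (starExp ħ K η) w (fun k => basisVec (j k))) =
      (a ^ 2 * S) ^ n * (starExp ħ K ξ w * starExp ħ K η w) := fun n => by
    have e1 : a ^ 2 * S = ∑ i, ∑ j, (K + matJ) i j * (a * (ξ i : ℂ)) * (a * (η j : ℂ)) := by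
      rw [hS, Finset.mul_sum]
      refine Finset.sum_congr rfl fun i _ => ?_
      rw [Finset.mul_sum]
      exact Finset.sum_congr rfl fun j _ => by ring
    rw [e1, Fintype.sum_pow, Finset.sum_mul]
    refine Finset.sum_congr rfl fun i _ => ?_
    rw [Finset.prod_univ_sum, Fintype.piFinset_univ, Finset.sum_mul]
    refine Finset.sum_congr rfl fun j _ => ?_
    rw [iteratedFDeriv_starExp, iteratedFDeriv_starExp, ← ha]
    have e2 : ∏ k, (K + matJ) (i k) (j k) * (a * (ξ (i k) : ℂ)) * (a * (η (j k) : ℂ)) =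
        (∏ k, (K + matJ) (i k) (j k)) * (∏ k, a * (ξ (i k) : ℂ)) * ∏ k, a * (η (j k) : ℂ) := by
      rw [Finset.prod_mul_distrib, Finset.prod_mul_distrib]
    rw [e2]
    ring
  simp only [starFormula, e]
  have e2 : ∀ n : ℕ, (Complex.I * ħ / 2) ^ n / (n.factorial : ℂ) *
      ((a ^ 2 * S) ^ n * (starExp ħ K ξ w * starExp ħ K η w)) =
      (Complex.I * ħ / 2 * (a ^ 2 * S)) ^ n / (n.factorial : ℂ) *
        (starExp ħ K ξ w * starExp ħ K η w) := fun n => by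
    rw [mul_pow]
    ring
  simp only [e2]
  rw [tsum_mul_right, Complex.exp_eq_exp_ℂ, NormedSpace.exp_eq_tsum_div]
  have e3 : Complex.I * ħ / 2 * (a ^ 2 * S) = 1 / (2 * Complex.I * ħ) * S := by
    rw [ha]
    field_simp
  rw [e3]

/-- The product of two star-exponentials is a star-exponential times a phase. Symmetry of `K` makes
the cross terms of `⟨(ξ + η)K, ξ + η⟩` equal to `2⟨ξK, η⟩`, and leaves the phase independent
of `K`. -/
lemma starFormula_starExp_eq (hħ : ħ ≠ 0) {K : Matrix (Fin 2) (Fin 2) ℂ} (hK : K.IsSymm)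
    (ξ η w : Plane) : starFormula ħ K (starExp ħ K ξ) (starExp ħ K η) w =
      sympExp (-((ħ / 2) • freq hħ ξ)) (freq hħ η) * starExp ħ K (ξ + η) w := by
  have hħ' : (ħ : ℂ) ≠ 0 := by exact_mod_cast hħ
  have h10 : K 1 0 = K 0 1 := hK.apply 0 1
  rw [starFormula_starExp hħ, starExp, starExp, starExp, planeWave, planeWave, planeWave, sympExp]
  simp only [← Complex.exp_add]
  rw [← neg_smul, symp_smul_left, symp_freq_freq]
  congr 1
  simp only [quad, Fin.sum_univ_two, Matrix.add_apply, matJ, inner_plane, symp, h10]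
  simp
  field_simp
  ring

end StarExp

/-! ### The product of star-functions -/

section StarProduct

open MeasureTheory Filter

variable {ħ : ℝ} {f g : Plane → ℂ}

/-- The kernel that couples two symplectic frequencies in the product of star-functions. -/
def prodKernel (c : ℝ) (ψ : 𝓢(Plane, ℂ)) (p q : Plane) : ℂ :=
  sympFourier ψ (-(p + q)) * sympExp (-(c • p)) q

lemma continuous_prodKernel (c : ℝ) (ψ : 𝓢(Plane, ℂ)) :
    Continuous fun z : Plane × Plane => prodKernel c ψ z.1 z.2 :=
  ((continuous_sympFourier ψ).comp (by fun_prop)).mul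
    (continuous_sympExp.comp (f := fun z : Plane × Plane => (-(c • z.1), z.2)) (by fun_prop))

lemma exists_norm_prodKernel_le (c : ℝ) (ψ : 𝓢(Plane, ℂ)) :
    ∃ C, 0 ≤ C ∧ ∀ p q, ‖prodKernel c ψ p q‖ ≤ C := by
  obtain ⟨C, hC, h⟩ := (amp_sympFourier ψ).exists_norm_le
  refine ⟨C, hC, fun p q => ?_⟩
  rw [prodKernel, norm_mul, norm_sympExp, mul_one]
  simpa using h () (-(p + q))

lemma integrable_prodKernel (c : ℝ) (ψ : 𝓢(Plane, ℂ)) {F G : Plane → ℂ} (hF : Integrable F)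
    (hG : Integrable G) {T : Plane → Plane} (hT : Continuous T) :
    Integrable (fun z : Plane × Plane => F z.1 * (G z.2 * prodKernel c ψ (T z.1) (T z.2))) := by
  obtain ⟨C, hC, h⟩ := exists_norm_prodKernel_le c ψ
  have h1 := (hF.mul_prod hG).mul_bdd (c := C)
    (g := fun z : Plane × Plane => prodKernel c ψ (T z.1) (T z.2))
    ((continuous_prodKernel c ψ).comp (f := fun z : Plane × Plane => (T z.1, T z.2))
      (by fun_prop)).aestronglyMeasurable
    (Eventually.of_forall fun z => h _ _)
  exact h1.congr (Eventually.of_forall fun z => mul_assoc _ _ _)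

/-- One variable of `integral_moyal_mul_schwartz`, by Fourier inversion for `f`. -/
lemma integral_translate_mul_schwartz (c : ℝ) (f ψ : 𝓢(Plane, ℂ)) (q : Plane) :
    (2 * (Real.pi : ℂ)) ^ 2 * ∫ w, f (w + c • q) * (ψ w * sympExp q (-w)) =
      ∫ p, sympFourier f p * prodKernel c ψ p q := by
  have e1 : ∀ p, sympFourier f p * prodKernel c ψ p q =
      ∫ w, sympExp p (-(w + c • q)) * sympFourier f p * (ψ w * sympExp q (-w)) := fun p => by
    rw [prodKernel, sympFourier_eq ψ, ← integral_mul_const, ← integral_const_mul]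
    refine integral_congr_ae (Eventually.of_forall fun w => ?_)
    have e : sympExp (-(p + q)) w * sympExp (-(c • p)) q =
        sympExp p (-(w + c • q)) * sympExp q (-w) := by
      simp only [sympExp, ← Complex.exp_add, symp, PiLp.add_apply, PiLp.neg_apply, PiLp.smul_apply,
        smul_eq_mul]
      push_cast
      ring_nf
    beta_reduce
    linear_combination (sympFourier f p * ψ w) * e
  simp only [e1]
  rw [← integral_const_mul, integral_integral_swap]
  · refine integral_congr_ae (Eventually.of_forall fun w => ?_)
    beta_reduce
    rw [integral_mul_const, integral_sympFourier, mul_assoc]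
  · have h1 := ((integrable_sympFourier f).mul_prod (ψ.integrable (μ := volume))).bdd_mul (c := 1)
      (f := fun z : Plane × Plane => sympExp z.1 (-(z.2 + c • q)) * sympExp q (-z.2)) ?_
      (Eventually.of_forall fun z => ?_)
    · refine h1.congr (Eventually.of_forall fun z => ?_)
      simp only [Function.uncurry]
      ring
    · have k1 : Continuous fun z : Plane × Plane => sympExp z.1 (-(z.2 + c • q)) :=
        continuous_sympExp.comp (f := fun z : Plane × Plane => (z.1, -(z.2 + c • q))) (by fun_prop)
      have k2 : Continuous fun z : Plane × Plane => sympExp q (-z.2) :=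
        continuous_sympExp.comp (f := fun z : Plane × Plane => (q, -z.2)) (by fun_prop)
      exact (k1.mul k2).aestronglyMeasurable
    · simp [norm_sympExp]

/-- The Moyal product of two Schwartz functions on the Fourier side. -/
lemma integral_moyal_mul_schwartz (c : ℝ) (f g ψ : 𝓢(Plane, ℂ)) :
    (2 * (Real.pi : ℂ)) ^ 4 * ∫ w, moyal c f g w * ψ w =
      ∫ p, ∫ q, sympFourier f p * (sympFourier g q * prodKernel c ψ p q) := by
  have hpi : (Real.pi : ℂ) ≠ 0 := by exact_mod_cast Real.pi_ne_zero
  have e1 : ∀ w, (2 * (Real.pi : ℂ)) ^ 4 * (moyal c f g w * ψ w) =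
      ∫ q, (2 * (Real.pi : ℂ)) ^ 2 * sympFourier g q * (f (w + c • q) * (ψ w * sympExp q (-w))) :=
      fun w => by
    have : ∀ q, (2 * (Real.pi : ℂ)) ^ 2 * sympFourier g q *
        (f (w + c • q) * (ψ w * sympExp q (-w))) = (2 * (Real.pi : ℂ)) ^ 2 * ψ w *
        (f (w + c • q) * (sympExp q (-w) * sympFourier g q)) := fun q => by ring
    simp only [this]
    rw [integral_const_mul, moyal_schwartz_right c (CB.of_schwartz f)]
    field_simp
  have i1 : Integrable (Function.uncurry fun w q => (2 * (Real.pi : ℂ)) ^ 2 * sympFourier g q *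
      (f (w + c • q) * (ψ w * sympExp q (-w)))) (volume.prod volume) := by
    obtain ⟨C, hC, hb⟩ := (CB.of_schwartz f).exists_norm_le
    have h1 := ((ψ.integrable (μ := volume)).mul_prod (integrable_sympFourier g)).bdd_mul
      (c := ‖(2 * (Real.pi : ℂ)) ^ 2‖ * C)
      (f := fun z : Plane × Plane => (2 * (Real.pi : ℂ)) ^ 2 * f (z.1 + c • z.2) *
        sympExp z.2 (-z.1)) ?_ (Eventually.of_forall fun z => ?_)
    · refine h1.congr (Eventually.of_forall fun z => ?_)
      simp only [Function.uncurry]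
      ring
    · have k1 : Continuous fun z : Plane × Plane => sympExp z.2 (-z.1) :=
        continuous_sympExp.comp (f := fun z : Plane × Plane => (z.2, -z.1)) (by fun_prop)
      exact ((continuous_const.mul (f.continuous.comp (by fun_prop))).mul k1).aestronglyMeasurable
    · rw [norm_mul, norm_mul, norm_sympExp, mul_one]
      exact mul_le_mul_of_nonneg_left (by simpa using hb () _) (norm_nonneg _)
  have i2 : Integrable (Function.uncurry fun p q => sympFourier f p *
      (sympFourier g q * prodKernel c ψ p q)) (volume.prod volume) := by
    have h1 := integrable_prodKernel c ψ (integrable_sympFourier f) (integrable_sympFourier g)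
      (T := fun p => p) (continuous_id' (X := Plane))
    rw [Measure.volume_eq_prod] at h1
    refine h1.congr (Eventually.of_forall fun z => ?_)
    rw [Function.uncurry_apply_pair]
  rw [← integral_const_mul, integral_congr_ae (Eventually.of_forall e1), integral_integral_swap i1,
    integral_integral_swap i2]
  refine integral_congr_ae (Eventually.of_forall fun q => ?_)
  beta_reduce
  rw [integral_const_mul, mul_right_comm, integral_translate_mul_schwartz, ← integral_mul_const]
  refine integral_congr_ae (Eventually.of_forall fun p => ?_)
  beta_reduce
  ring

instance isAddHaarMeasure_volume_prod_prod :
    (volume : Measure ((Plane × Plane) × (Plane × Plane))).IsAddHaarMeasure :=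
  Measure.prod.instIsAddHaarMeasure volume volume

/-- The phase `ω(p, x) + ω(q, y) - c ω(p, q)` of the product of star-functions, in terms of symplectic
frequencies `p` and `q` and in the variables `((x, p), (y, q))`. The derivatives in `x` and `y` control
the frequencies, and then those in `p` and `q` control `x` and `y`. -/
def couplingPhase (c : ℝ) : Phase ((Plane × Plane) × (Plane × Plane)) where
  toFun z := symp z.1.2 z.1.1 + symp z.2.2 z.2.1 - c * symp z.1.2 z.2.2
  contDiff := by
    unfold symp
    fun_prop
  card := 8
  dir := ![((basisVec 0, 0), 0), ((basisVec 1, 0), 0), (0, (basisVec 0, 0)), (0, (basisVec 1, 0)),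
    ((0, basisVec 0), 0), ((0, basisVec 1), 0), (0, (0, basisVec 0)), (0, (0, basisVec 1))]
  form :=
    let x := (ContinuousLinearMap.fst ℝ Plane Plane).comp
      (.fst ℝ (Plane × Plane) (Plane × Plane))
    let p := (ContinuousLinearMap.snd ℝ Plane Plane).comp
      (.fst ℝ (Plane × Plane) (Plane × Plane))
    let y := (ContinuousLinearMap.fst ℝ Plane Plane).comp
      (.snd ℝ (Plane × Plane) (Plane × Plane))
    let q := (ContinuousLinearMap.snd ℝ Plane Plane).comp
      (.snd ℝ (Plane × Plane) (Plane × Plane))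
    ![(crd 1).comp p, -(crd 0).comp p, (crd 1).comp q, -(crd 0).comp q,
      -(crd 1).comp x + c • (crd 1).comp q, (crd 0).comp x - c • (crd 0).comp q,
      -(crd 1).comp y - c • (crd 1).comp p, (crd 0).comp y + c • (crd 0).comp p]
  fderiv_apply j z := by
    have hx := fun i => hasFDerivAt_crd_comp ((ContinuousLinearMap.fst ℝ Plane Plane).comp
      (.fst ℝ (Plane × Plane) (Plane × Plane))) i z
    have hp := fun i => hasFDerivAt_crd_comp ((ContinuousLinearMap.snd ℝ Plane Plane).comp
      (.fst ℝ (Plane × Plane) (Plane × Plane))) i z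
    have hy := fun i => hasFDerivAt_crd_comp ((ContinuousLinearMap.fst ℝ Plane Plane).comp
      (.snd ℝ (Plane × Plane) (Plane × Plane))) i z
    have hq := fun i => hasFDerivAt_crd_comp ((ContinuousLinearMap.snd ℝ Plane Plane).comp
      (.snd ℝ (Plane × Plane) (Plane × Plane))) i z
    have hd : fderiv ℝ (fun z : (Plane × Plane) × (Plane × Plane) =>
        symp z.1.2 z.1.1 + symp z.2.2 z.2.1 - c * symp z.1.2 z.2.2) z = _ :=
      (((((hp 1).mul (hx 0)).sub ((hp 0).mul (hx 1))).add
        (((hq 1).mul (hy 0)).sub ((hq 0).mul (hy 1)))).sub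
        ((((hp 1).mul (hq 0)).sub ((hp 0).mul (hq 1))).const_mul c)).fderiv
    rw [hd]
    fin_cases j <;> simp [basisVec]
  eq_zero z h := by
    have h0 := h 0
    have h1 := h 1
    have h2 := h 2
    have h3 := h 3
    have h4 := h 4
    have h5 := h 5
    have h6 := h 6
    have h7 := h 7
    simp at h0 h1 h2 h3 h4 h5 h6 h7
    simp only [h0, h1, h2, h3, mul_zero, add_zero, sub_zero, neg_eq_zero]
      at h4 h5 h6 h7
    exact Prod.ext (Prod.ext (plane_ext h5 h4) (plane_ext h1 h0))
      (Prod.ext (plane_ext h7 h6) (plane_ext h3 h2))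

/-- The phase of the product of star-functions. -/
def prodPhase (hħ : ħ ≠ 0) : Phase ((Plane × Plane) × (Plane × Plane)) :=
  (couplingPhase (ħ / 2)).comp
    (((ContinuousLinearEquiv.refl ℝ Plane).prodCongr (freq hħ)).prodCongr
      ((ContinuousLinearEquiv.refl ℝ Plane).prodCongr (freq hħ)))

lemma prodPhase_osc (hħ : ħ ≠ 0) (z : (Plane × Plane) × (Plane × Plane)) :
    (prodPhase hħ).osc z = sympExp (freq hħ z.1.2) z.1.1 * sympExp (freq hħ z.2.2) z.2.1 *
      sympExp (-((ħ / 2) • freq hħ z.1.2)) (freq hħ z.2.2) := by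
  have e : (prodPhase hħ).toFun z = symp (freq hħ z.1.2) z.1.1 + symp (freq hħ z.2.2) z.2.1 -
    ħ / 2 * symp (freq hħ z.1.2) (freq hħ z.2.2) := rfl
  rw [Phase.osc, e, sympExp, sympExp, sympExp, ← Complex.exp_add, ← Complex.exp_add, ← neg_smul,
    symp_smul_left]
  congr 1
  push_cast
  ring

/-- The amplitude of the product of star-functions, with `ψ` in place of the transform of the test
function. -/
def prodAmp (hħ : ħ ≠ 0) (f g : Plane → ℂ) (ψ : 𝓢(Plane, ℂ))
    (z : (Plane × Plane) × (Plane × Plane)) : ℂ :=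
  f z.1.1 * g z.2.1 * sympFourier ψ (-(freq hħ z.1.2 + freq hħ z.2.2))

section

variable {ι : Type*} {a b : ι → Plane → ℂ}

lemma ampFamily_prodAmp (hħ : ħ ≠ 0) {w w' : ι → Plane → ℝ} (ha : AmpFamily w a)
    (hb : AmpFamily w' b) (ψ : 𝓢(Plane, ℂ)) :
    AmpFamily (fun i z => w i z.1.1 * w' i z.2.1) (fun i => prodAmp hħ (a i) (b i) ψ) := by
  have h1 := ha.comp_affine (fun _ => (ContinuousLinearMap.fst ℝ Plane Plane).comp
    (.fst ℝ (Plane × Plane) (Plane × Plane))) (fun _ => 0) (fun _ => le_rfl)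
  have h2 := hb.comp_affine (fun _ => (ContinuousLinearMap.fst ℝ Plane Plane).comp
    (.snd ℝ (Plane × Plane) (Plane × Plane))) (fun _ => 0) (fun _ => le_rfl)
  have h3 := ((amp_sympFourier ψ).comp_clm (-((freq hħ : Plane →L[ℝ] Plane).comp
    ((ContinuousLinearMap.snd ℝ Plane Plane).comp (.fst ℝ (Plane × Plane) (Plane × Plane))) +
    (freq hħ : Plane →L[ℝ] Plane).comp ((ContinuousLinearMap.snd ℝ Plane Plane).comp
    (.snd ℝ (Plane × Plane) (Plane × Plane)))))).reindex fun _ : ι => ()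
  have h4 := (h1.mul h2).mul h3
  simp only [add_zero, mul_one] at h4
  exact h4

end

lemma amp_prodAmp (hħ : ħ ≠ 0) (hf : CB f) (hg : CB g) (ψ : 𝓢(Plane, ℂ)) :
    Amp (fun z => jap z ^ (0 : ℤ)) (prodAmp hħ f g ψ) :=
  (ampFamily_prodAmp hħ hf hg ψ).congr_weight fun _ _ => by simp

lemma integral_mul_sympExp_freq (hħ : ħ ≠ 0) (f : 𝓢(Plane, ℂ)) {u : Plane → ℂ}
    (hu : Integrable u) :
    ∫ z : Plane × Plane, f z.1 * u z.2 * sympExp (freq hħ z.2) z.1 =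
      ∫ ξ, sympFourier f (freq hħ ξ) * u ξ := by
  have h1 := integrable_mul_osc (starPhase hħ) (f.integrable.mul_prod hu)
  simp only [starPhase_osc] at h1
  rw [Measure.volume_eq_prod] at h1 ⊢
  rw [integral_prod_symm _ h1]
  refine integral_congr_ae (Eventually.of_forall fun ξ => ?_)
  simp only
  rw [sympFourier_eq, ← integral_mul_const]
  refine integral_congr_ae (Eventually.of_forall fun x => ?_)
  beta_reduce
  ring

/-- With cutoffs in the two frequencies all integrals converge absolutely, and `x` and `y` can be
integrated out. -/
lemma integral_cutoff_prodAmp (hħ : ħ ≠ 0) (f g ψ : 𝓢(Plane, ℂ)) {u : Plane → ℂ}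
    (hu : Integrable u) :
    (prodPhase hħ).oscInt (fun z => u z.1.2 * u z.2.2 * prodAmp hħ f g ψ z) =
      ∫ z : Plane × Plane, sympFourier f (freq hħ z.1) * u z.1 * (sympFourier g (freq hħ z.2) *
        u z.2 * prodKernel (ħ / 2) ψ (freq hħ z.1) (freq hħ z.2)) := by
  set c := ħ / 2 with hc
  obtain ⟨C, hC, hb⟩ := (amp_sympFourier ψ).exists_norm_le
  have i1 : Integrable (fun z : (Plane × Plane) × (Plane × Plane) =>
      u z.1.2 * u z.2.2 * prodAmp hħ f g ψ z) := by
    have h1 := (((f.integrable (μ := volume)).mul_prod hu).mul_prod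
      ((g.integrable (μ := volume)).mul_prod hu)).mul_bdd (c := C)
      (g := fun z : (Plane × Plane) × (Plane × Plane) =>
        sympFourier ψ (-(freq hħ z.1.2 + freq hħ z.2.2)))
      ((continuous_sympFourier ψ).comp (by fun_prop)).aestronglyMeasurable
      (Eventually.of_forall fun z => by simpa using hb () _)
    refine h1.congr (Eventually.of_forall fun z => ?_)
    simp only [prodAmp]
    ring
  have i2 := integrable_mul_osc (prodPhase hħ) i1
  -- the frequency integrals converge absolutely
  have i3 : Integrable (fun z : Plane × Plane => u z.1 * (sympFourier g (freq hħ z.2) * u z.2 *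
      prodKernel c ψ (freq hħ z.1) (freq hħ z.2))) := by
    obtain ⟨D, hD, hd⟩ := exists_norm_prodKernel_le c ψ
    obtain ⟨E, hE, he⟩ := (amp_sympFourier g).exists_norm_le
    have h1 := (hu.mul_prod hu).mul_bdd (c := E * D)
      (g := fun z : Plane × Plane => sympFourier g (freq hħ z.2) *
        prodKernel c ψ (freq hħ z.1) (freq hħ z.2)) ?_ (Eventually.of_forall fun z => ?_)
    · refine h1.congr (Eventually.of_forall fun z => ?_)
      beta_reduce
      ring
    · exact (((continuous_sympFourier g).comp (by fun_prop)).mul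
        ((continuous_prodKernel c ψ).comp (f := fun z : Plane × Plane =>
          (freq hħ z.1, freq hħ z.2)) (by fun_prop))).aestronglyMeasurable
    · rw [norm_mul]
      exact mul_le_mul (by simpa using he () _) (hd _ _) (norm_nonneg _) hE
  have i4 : Integrable (fun z : Plane × Plane => sympFourier f (freq hħ z.1) * u z.1 *
      (sympFourier g (freq hħ z.2) * u z.2 * prodKernel c ψ (freq hħ z.1) (freq hħ z.2))) := by
    obtain ⟨E, hE, he⟩ := (amp_sympFourier f).exists_norm_le
    simp only [mul_assoc (sympFourier f _)]
    exact i3.bdd_mul (c := E)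
      ((continuous_sympFourier f).comp (by fun_prop)).aestronglyMeasurable
      (Eventually.of_forall fun z => by simpa using he () _)
  rw [(prodPhase hħ).oscInt_eq_integral i1]
  rw [Measure.volume_eq_prod] at i2 i3 i4
  rw [Measure.volume_eq_prod (Plane × Plane) (Plane × Plane), integral_prod _ i2]
  rw [Measure.volume_eq_prod Plane Plane, integral_prod _ i4, ← Measure.volume_eq_prod Plane Plane]
  have e1 : ∀ a : Plane × Plane, ∫ b : Plane × Plane,
      u a.2 * u b.2 * prodAmp hħ f g ψ (a, b) * (prodPhase hħ).osc (a, b) =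
      f a.1 * (u a.2 * ∫ η, sympFourier g (freq hħ η) * u η *
        prodKernel c ψ (freq hħ a.2) (freq hħ η)) * sympExp (freq hħ a.2) a.1 := fun a => by
    have hint : Integrable (fun η => u η * prodKernel c ψ (freq hħ a.2) (freq hħ η)) := by
      obtain ⟨D, hD, hd⟩ := exists_norm_prodKernel_le c ψ
      exact hu.mul_bdd (c := D) ((continuous_prodKernel c ψ).comp (f := fun η : Plane =>
          (freq hħ a.2, freq hħ η)) (by fun_prop)).aestronglyMeasurable
        (Eventually.of_forall fun η => hd _ _)
    have h1 := integral_mul_sympExp_freq hħ g hint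
    simp only [← mul_assoc] at h1
    simp only [mul_assoc (sympFourier g _)] at h1 ⊢
    rw [mul_right_comm, ← mul_assoc]
    simp only [← mul_assoc (sympFourier g _)] at h1 ⊢
    rw [← h1, ← integral_const_mul]
    refine integral_congr_ae (Eventually.of_forall fun b => ?_)
    simp only [prodAmp, prodPhase_osc, prodKernel]
    ring
  simp only [e1]
  have i5 := i3.integral_prod_left
  simp only [integral_const_mul] at i5
  rw [integral_mul_sympExp_freq hħ f i5]
  refine integral_congr_ae (Eventually.of_forall fun ξ => ?_)
  simp only
  rw [← mul_assoc, ← integral_const_mul]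

/-- The cutoffs of `integral_cutoff_prodAmp` are removed on one side by continuity of the oscillatory
integral, and on the other by dominated convergence. They are needed since the amplitude itself is
not integrable, even for Schwartz functions: it depends on the sum of the frequencies only. -/
lemma oscInt_prodAmp_schwartz (hħ : ħ ≠ 0) (f g ψ : 𝓢(Plane, ℂ)) :
    (prodPhase hħ).oscInt (prodAmp hħ f g ψ) =
      (2 * (Real.pi : ℂ) * ħ) ^ 4 * ∫ w, moyal (ħ / 2) f g w * ψ w := by
  obtain ⟨χ, hχ⟩ := exists_schwartz_eq_one Plane
  have i1 := integrable_prodKernel (ħ / 2) ψ (integrable_comp_freq hħ (integrable_sympFourier f))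
    (integrable_comp_freq hħ (integrable_sympFourier g)) (freq hħ).continuous
  have e1 : (2 * (Real.pi : ℂ) * ħ) ^ 4 * ∫ w, moyal (ħ / 2) f g w * ψ w =
      ∫ z : Plane × Plane, sympFourier f (freq hħ z.1) * (sympFourier g (freq hħ z.2) *
        prodKernel (ħ / 2) ψ (freq hħ z.1) (freq hħ z.2)) := by
    rw [mul_pow, mul_right_comm, integral_moyal_mul_schwartz]
    rw [Measure.volume_eq_prod] at i1 ⊢
    rw [integral_prod _ i1]
    simp only
    rw [integral_comp_freq hħ fun p => ∫ η, sympFourier f p * (sympFourier g (freq hħ η) *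
      prodKernel (ħ / 2) ψ p (freq hħ η))]
    simp only [fun p => integral_comp_freq hħ fun q => sympFourier f p * (sympFourier g q *
      prodKernel (ħ / 2) ψ p q)]
    rw [integral_const_mul]
    ring
  rw [e1]
  have ha : AmpFamily (fun ε z => ε.1 * jap z ^ (1 : ℤ)) (fun (ε : Scale) z =>
      χ (ε.1 • z.1.2) * χ (ε.1 • z.2.2) * prodAmp hħ f g ψ z - prodAmp hħ f g ψ z) := by
    let T₁ := (ContinuousLinearMap.snd ℝ Plane Plane).comp
      (.fst ℝ (Plane × Plane) (Plane × Plane))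
    let T₂ := (ContinuousLinearMap.snd ℝ Plane Plane).comp
      (.snd ℝ (Plane × Plane) (Plane × Plane))
    have k1 := (ampFamily_cutoff_sub χ).comp_affine (fun _ => T₁) (fun _ => 0) (fun _ => le_rfl)
    have k2 := (ampFamily_cutoff_sub χ).comp_affine (fun _ => T₂) (fun _ => 0) (fun _ => le_rfl)
    have k3 := (ampFamily_cutoff χ).comp_affine (fun _ => T₂) (fun _ => 0) (fun _ => le_rfl)
    have n1 : ∀ z, ‖T₁ z‖ ≤ ‖z‖ := fun z => (norm_snd_le z.1).trans (norm_fst_le z)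
    have n2 : ∀ z, ‖T₂ z‖ ≤ ‖z‖ := fun z => (norm_snd_le z.2).trans (norm_snd_le z)
    have k4 := (k1.mul k3).mono (w' := fun ε z => ε.1 * jap z) zero_le_one fun ε z => by
      have := n1 z
      have := ε.2.1
      simp only [add_zero, jap, mul_one, one_mul]
      gcongr
    have k5 := k2.mono (w' := fun ε z => ε.1 * jap z) zero_le_one fun ε z => by
      have := n2 z
      have := ε.2.1
      simp only [add_zero, jap, one_mul]
      gcongr
    have k6 := (k4.add k5).mul ((amp_prodAmp hħ (CB.of_schwartz f) (CB.of_schwartz g) ψ).reindex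
      fun _ : Scale => ())
    convert k6.congr_weight (w' := fun ε z => ε.1 * jap z ^ (1 : ℤ)) fun ε z => by simp
      using 3 with ε z
    change χ (ε.1 • z.1.2) * χ (ε.1 • z.2.2) * prodAmp hħ f g ψ z - prodAmp hħ f g ψ z =
      ((χ (ε.1 • (z.1.2 + 0)) - χ 0) * χ (ε.1 • (z.2.2 + 0)) + (χ (ε.1 • (z.2.2 + 0)) - χ 0)) *
        prodAmp hħ f g ψ z
    rw [hχ, add_zero, add_zero]
    ring
  have h1 := (prodPhase hħ).tendsto_oscInt
    (amp_prodAmp hħ (CB.of_schwartz f) (CB.of_schwartz g) ψ) ha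
  have h2 : ∀ n, Integrable (fun ξ => χ ((scaleSeq n).1 • ξ)) := fun n =>
    χ.integrable.comp_smul (scaleSeq n).2.1.ne'
  simp only [fun n => integral_cutoff_prodAmp hħ f g ψ (h2 n)] at h1
  refine tendsto_nhds_unique h1 ?_
  obtain ⟨C, hC, hb⟩ := (CB.of_schwartz χ).exists_norm_le
  have hb' : ∀ x, ‖χ x‖ ≤ C := fun x => by simpa using hb () x
  have e2 : ∀ n (z : Plane × Plane), sympFourier f (freq hħ z.1) * χ ((scaleSeq n).1 • z.1) *
      (sympFourier g (freq hħ z.2) * χ ((scaleSeq n).1 • z.2) *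
        prodKernel (ħ / 2) ψ (freq hħ z.1) (freq hħ z.2)) =
      χ ((scaleSeq n).1 • z.1) * χ ((scaleSeq n).1 • z.2) * (sympFourier f (freq hħ z.1) *
        (sympFourier g (freq hħ z.2) * prodKernel (ħ / 2) ψ (freq hħ z.1) (freq hħ z.2))) :=
    fun n z => by ring
  simp only [e2]
  refine tendsto_integral_of_dominated_convergence _ (fun n => ?_) (i1.norm.const_mul (C * C))
    (fun n => Eventually.of_forall fun z => ?_) (Eventually.of_forall fun z => ?_)
  · refine AEStronglyMeasurable.mul (Continuous.aestronglyMeasurable ?_) i1.aestronglyMeasurable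
    exact (χ.continuous.comp (by fun_prop)).mul (χ.continuous.comp (by fun_prop))
  · rw [norm_mul, norm_mul]
    exact mul_le_mul_of_nonneg_right (mul_le_mul (hb' _) (hb' _) (norm_nonneg _) hC)
      (norm_nonneg _)
  · have h3 : ∀ x : Plane, Tendsto (fun n => χ ((scaleSeq n).1 • x)) atTop (𝓝 1) := fun x => by
      have h4 : Tendsto (fun n => (scaleSeq n).1 • x) atTop (𝓝 0) := by
        simpa using tendsto_scaleSeq.smul_const x
      have h5 := (χ.continuous.tendsto 0).comp h4
      rw [hχ] at h5
      exact h5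
    simpa using ((h3 z.1).mul (h3 z.2)).mul_const _

/-- Both sides depend continuously on `f` and `g`, so that Schwartz approximation applies to each in
turn. -/
lemma oscInt_prodAmp (hħ : ħ ≠ 0) (hf : CB f) (hg : CB g) (ψ : 𝓢(Plane, ℂ)) :
    (prodPhase hħ).oscInt (prodAmp hħ f g ψ) =
      (2 * (Real.pi : ℂ) * ħ) ^ 4 * ∫ w, moyal (ħ / 2) f g w * ψ w := by
  have one : ∀ {g : Plane → ℂ}, CB g → AmpFamily (fun (_ : Scale) z => 1 * jap z ^ (0 : ℤ))
    fun _ => g := fun hg => (hg.reindex fun _ => ()).congr_weight fun _ _ => by simp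
  have n1 : ∀ z : (Plane × Plane) × (Plane × Plane), ‖z.1.1‖ ≤ ‖z‖ := fun z =>
    (norm_fst_le z.1).trans (norm_fst_le z)
  have n2 : ∀ z : (Plane × Plane) × (Plane × Plane), ‖z.2.1‖ ≤ ‖z‖ := fun z =>
    (norm_fst_le z.2).trans (norm_snd_le z)
  -- first for a Schwartz function on the left
  have step : ∀ f : 𝓢(Plane, ℂ), (prodPhase hħ).oscInt (prodAmp hħ f g ψ) =
      (2 * (Real.pi : ℂ) * ħ) ^ 4 * ∫ w, moyal (ħ / 2) f g w * ψ w := fun f => by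
    obtain ⟨s, hs⟩ := hg.exists_approx
    have cf := CB.of_schwartz f
    have cs := fun ε => CB.of_schwartz (s ε)
    have k1 := (ampFamily_prodAmp hħ (one cf) hs ψ).mono
      (w' := fun ε z => ε.1 * jap z ^ (1 : ℤ)) zero_le_one fun ε z => by
        have := n2 z
        have := ε.2.1
        simp only [jap, zpow_zero, zpow_one, mul_one, one_mul]
        gcongr
    have k2 : AmpFamily (fun ε z => ε.1 * jap z ^ (1 : ℤ)) (fun (ε : Scale) z =>
        prodAmp hħ f (s ε) ψ z - prodAmp hħ f g ψ z) := by
      convert k1 using 3 with ε z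
      simp only [prodAmp]
      ring
    have h1 := (prodPhase hħ).tendsto_oscInt (amp_prodAmp hħ cf hg ψ) k2
    have k3 := ampFamily_moyal (fun _ => zero_le_one) (fun ε : Scale => ε.2.1.le) (one cf) hs
      (fun _ => cf) (fun ε => (cs ε).sub hg) (ħ / 2)
    have k4 : AmpFamily (fun ε z => ε.1 * jap z ^ (0 + 1 : ℤ))
        (fun (ε : Scale) z => moyal (ħ / 2) f (s ε) z - moyal (ħ / 2) f g z) := by
      have e : (fun (ε : Scale) z => moyal (ħ / 2) f (s ε) z - moyal (ħ / 2) f g z) =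
          fun ε => moyal (ħ / 2) f (fun z => s ε z - g z) := by
        funext ε z
        rw [moyal_sub_right _ cf.zpow (cs _).zpow hg.zpow]
      rw [e]
      simpa only [one_mul] using k3
    have h2 := tendsto_integral_mul_schwartz (cf.moyal hg (ħ / 2))
      (fun ε => cf.moyal (cs ε) (ħ / 2)) k4 ψ
    simp only [oscInt_prodAmp_schwartz] at h1
    exact tendsto_nhds_unique h1 (h2.const_mul _)
  obtain ⟨s, hs⟩ := hf.exists_approx
  have cs := fun ε => CB.of_schwartz (s ε)
  have k1 := (ampFamily_prodAmp hħ hs (one hg) ψ).mono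
    (w' := fun ε z => ε.1 * jap z ^ (1 : ℤ)) zero_le_one fun ε z => by
      have := n1 z
      have := ε.2.1
      simp only [jap, zpow_zero, zpow_one, mul_one, one_mul]
      gcongr
  have k2 : AmpFamily (fun ε z => ε.1 * jap z ^ (1 : ℤ)) (fun (ε : Scale) z =>
      prodAmp hħ (s ε) g ψ z - prodAmp hħ f g ψ z) := by
    convert k1 using 3 with ε z
    simp only [prodAmp]
    ring
  have h1 := (prodPhase hħ).tendsto_oscInt (amp_prodAmp hħ hf hg ψ) k2
  have k3 := ampFamily_moyal (fun ε : Scale => ε.2.1.le) (fun _ => zero_le_one) hs (one hg)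
    (fun ε => (cs ε).sub hf) (fun _ => hg) (ħ / 2)
  have k4 : AmpFamily (fun ε z => ε.1 * jap z ^ (1 + 0 : ℤ))
      (fun (ε : Scale) z => moyal (ħ / 2) (s ε) g z - moyal (ħ / 2) f g z) := by
    have e : (fun (ε : Scale) z => moyal (ħ / 2) (s ε) g z - moyal (ħ / 2) f g z) =
        fun ε => moyal (ħ / 2) (fun z => s ε z - f z) g := by
      funext ε z
      rw [moyal_sub_left _ (cs _).zpow hf.zpow hg.zpow]
    rw [e]
    simpa only [mul_one] using k3
  have h2 := tendsto_integral_mul_schwartz (hf.moyal hg (ħ / 2))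
    (fun ε => (cs ε).moyal hg (ħ / 2)) k4 ψ
  simp only [step] at h1
  exact tendsto_nhds_unique h1 (h2.const_mul _)

/-- The oscillatory integral that defines the product of two star-functions is the star-function of
the Moyal product. -/
lemma hasOscIntegral_starProduct (hħ : ħ ≠ 0) {K : Matrix (Fin 2) (Fin 2) ℂ} (hK : K.IsSymm)
    (hf : CB f) (hg : CB g) (φ : testSpace) :
    HasOscIntegral (V := (Plane × Plane) × (Plane × Plane)) (fun z =>
      (1 / (2 * (Real.pi : ℂ) * ħ) ^ 4) *
        (f z.1.1 * (planeWave ħ z.1.2 z.1.1)⁻¹ * (g z.2.1 * (planeWave ħ z.2.2 z.2.1)⁻¹) *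
          ∫ w, starFormula ħ K (starExp ħ K z.1.2) (starExp ħ K z.2.2) w * φ.1 w))
      (starFun ħ K (hf.moyal hg (ħ / 2)) φ) := by
  have h := ((prodPhase hħ).hasOscIntegral
    (amp_prodAmp hħ hf hg (testIntertwiner ħ K φ).1)).const_mul
      (1 / (2 * (Real.pi : ℂ) * ħ) ^ 4)
  have hħ' : (ħ : ℂ) ≠ 0 := by exact_mod_cast hħ
  have hpi : (Real.pi : ℂ) ≠ 0 := by exact_mod_cast Real.pi_ne_zero
  rw [oscInt_prodAmp hħ hf hg, ← mul_assoc, one_div_mul_cancel (by simp [hħ', hpi]), one_mul] at h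
  rw [starFun_apply]
  convert h using 3 with z
  simp only [planeWave_inv hħ, starFormula_starExp_eq hħ hK, mul_assoc]
  rw [integral_const_mul, integral_starExp_mul hħ, prodPhase_osc, prodAmp, map_add]
  ring

end StarProduct

/-! ### Symbols on the exterior of the unit disc -/

section Exterior

open Filter

lemma rho_eq (x : Plane) : rho x = Real.sqrt (1 + ‖x‖ ^ 2) := by
  rw [rho, EuclideanSpace.norm_sq_eq]
  simp [add_assoc]

lemma rho_sq (x : Plane) : rho x ^ 2 = 1 + ‖x‖ ^ 2 := by
  rw [rho_eq, Real.sq_sqrt (by positivity)]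

lemma one_le_rho (x : Plane) : 1 ≤ rho x := by
  rw [rho_eq]
  exact Real.one_le_sqrt.2 (by nlinarith [sq_nonneg ‖x‖])

lemma rho_inv_nonneg (x : Plane) : 0 ≤ (rho x)⁻¹ := inv_nonneg.2 (rho_pos x).le

lemma rho_inv_le_one (x : Plane) : (rho x)⁻¹ ≤ 1 := inv_le_one_of_one_le₀ (one_le_rho x)

lemma rho_le_jap (x : Plane) : rho x ≤ jap x := by
  rw [rho_eq, jap]
  exact Real.sqrt_le_iff.2 ⟨by positivity, by nlinarith [norm_nonneg x]⟩

lemma jap_le_two_mul_rho (x : Plane) : jap x ≤ 2 * rho x := by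
  have h := rho_sq x
  have h1 := one_le_rho x
  have h2 : ‖x‖ ≤ rho x := abs_le_of_sq_le_sq' (by nlinarith) (rho_pos x).le |>.2
  rw [jap]
  linarith

lemma norm_inv_le {x : Plane} (hx : 1 ≤ ‖x‖) : ‖x‖⁻¹ ≤ 2 * (rho x)⁻¹ := by
  have h : rho x ≤ 2 * ‖x‖ := (rho_le_jap x).trans (by rw [jap]; linarith)
  have h1 := rho_pos x
  rw [inv_le_comm₀ (by linarith) (by positivity), mul_inv, inv_inv]
  linarith

lemma ne_zero_of_one_le {x : Plane} (hx : 1 ≤ ‖x‖) : x ≠ 0 := by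
  rintro rfl
  norm_num at hx

/-- The derivative of order `m` is `O(ρ^{-r-m})` on the exterior of the unit disc. -/
def ExtBound (r m : ℕ) (F : Plane → ℂ) : Prop :=
  ∃ C, 0 ≤ C ∧ ∀ x : Plane, 1 ≤ ‖x‖ → ‖iteratedFDeriv ℝ m F x‖ ≤ C * (rho x)⁻¹ ^ (r + m)

/-- Symbols of order `-r` on the exterior of the unit disc. -/
structure ExtSymbol (r : ℕ) (F : Plane → ℂ) : Prop where
  smooth : ContDiffOn ℝ ∞ F {0}ᶜ
  bound : ∀ m, ExtBound r m F

variable {r s m : ℕ} {F G : Plane → ℂ}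

lemma contDiffAt_punctured (h : ContDiffOn ℝ ∞ F {0}ᶜ) {x : Plane} (hx : x ≠ 0) :
    ContDiffAt ℝ ∞ F x :=
  h.contDiffAt (isOpen_compl_singleton.mem_nhds hx)

lemma contDiffOn_fderiv_apply (h : ContDiffOn ℝ ∞ F {0}ᶜ) (v : Plane) :
    ContDiffOn ℝ ∞ (fun x => fderiv ℝ F x v) {0}ᶜ := fun _ hx =>
  (((contDiffAt_punctured h hx).fderiv_right (m := ∞) (by simp)).clm_apply
    contDiffAt_const).contDiffWithinAt

lemma ExtBound.mono (h : ExtBound r m F) (hs : s ≤ r) : ExtBound s m F := by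
  obtain ⟨C, hC, h⟩ := h
  refine ⟨C, hC, fun x hx => (h x hx).trans (mul_le_mul_of_nonneg_left ?_ hC)⟩
  exact pow_le_pow_of_le_one (rho_inv_nonneg x) (rho_inv_le_one x) (by omega)

lemma ExtBound.mul (hF : ContDiffOn ℝ ∞ F {0}ᶜ) (hG : ContDiffOn ℝ ∞ G {0}ᶜ)
    (bF : ∀ i ≤ m, ExtBound r i F) (bG : ∀ i ≤ m, ExtBound s i G) :
    ExtBound (r + s) m (fun x => F x * G x) := by
  choose! C hC bF using bF
  choose! D hD bG using bG
  refine ⟨∑ i ∈ Finset.range (m + 1), (m.choose i : ℝ) * C i * D (m - i),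
    Finset.sum_nonneg fun i hi => ?_, fun x hx => ?_⟩
  · have := hC i (by simpa [Nat.lt_succ_iff] using hi)
    have := hD (m - i) (by omega)
    positivity
  · refine (norm_iteratedFDeriv_mul_le_of_isOpen isOpen_compl_singleton hF hG
      (ne_zero_of_one_le hx) m).trans ?_
    rw [Finset.sum_mul]
    refine Finset.sum_le_sum fun i hi => ?_
    have hi' : i ≤ m := by simpa [Nat.lt_succ_iff] using hi
    calc (m.choose i : ℝ) * ‖iteratedFDeriv ℝ i F x‖ * ‖iteratedFDeriv ℝ (m - i) G x‖
        ≤ (m.choose i : ℝ) * (C i * (rho x)⁻¹ ^ (r + i)) *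
          (D (m - i) * (rho x)⁻¹ ^ (s + (m - i))) := by
          have := hC i hi'
          have := rho_inv_nonneg x
          gcongr
          · exact bF i hi' x hx
          · exact bG (m - i) (by omega) x hx
      _ = _ := by
          rw [show r + s + m = (r + i) + (s + (m - i)) by omega, pow_add _ (r + i)]
          ring

/-- A bound of order `m + 1` follows from bounds of order `m` for all directional derivatives. -/
lemma ExtBound.succ (hF : ContDiffOn ℝ ∞ F {0}ᶜ)
    (h : ∀ v, ExtBound (r + 1) m (fun x => fderiv ℝ F x v)) : ExtBound r (m + 1) F := by
  obtain ⟨K, d, e, hK, hle⟩ := exists_norm_iteratedFDeriv_succ_le (V := Plane)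
  choose C hC h using h
  refine ⟨K * ∑ j, C (e j), mul_nonneg hK (Finset.sum_nonneg fun j _ => hC _), fun x hx =>
    (hle F x m (contDiffAt_punctured hF (ne_zero_of_one_le hx))).trans ?_⟩
  rw [mul_assoc, Finset.sum_mul]
  refine mul_le_mul_of_nonneg_left (Finset.sum_le_sum fun j _ => ?_) hK
  refine (h (e j) x hx).trans_eq ?_
  ring_nf

lemma ExtBound.zero_of_le {C : ℝ} (hC : 0 ≤ C)
    (h : ∀ x : Plane, 1 ≤ ‖x‖ → ‖F x‖ ≤ C * (rho x)⁻¹ ^ r) : ExtBound r 0 F :=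
  ⟨C, hC, fun x hx => by simpa using h x hx⟩

lemma ExtBound.congr (h : ExtBound r m F) (hFG : ∀ x ≠ 0, F x = G x) : ExtBound r m G := by
  obtain ⟨C, hC, h⟩ := h
  refine ⟨C, hC, fun x hx => ?_⟩
  have e : G =ᶠ[𝓝 x] F := by
    filter_upwards [isOpen_compl_singleton.mem_nhds (ne_zero_of_one_le hx)] with y hy
    exact (hFG y hy).symm
  rw [(e.iteratedFDeriv ℝ m).eq_of_nhds]
  exact h x hx

lemma ExtBound.add (hF : ContDiffOn ℝ ∞ F {0}ᶜ) (hG : ContDiffOn ℝ ∞ G {0}ᶜ)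
    (bF : ExtBound r m F) (bG : ExtBound r m G) : ExtBound r m (fun x => F x + G x) := by
  obtain ⟨C, hC, bF⟩ := bF
  obtain ⟨D, hD, bG⟩ := bG
  refine ⟨C + D, by positivity, fun x hx => ?_⟩
  have hx' := ne_zero_of_one_le hx
  have e : iteratedFDeriv ℝ m (fun x => F x + G x) x =
      iteratedFDeriv ℝ m F x + iteratedFDeriv ℝ m G x :=
    iteratedFDeriv_add_apply
      ((contDiffAt_punctured hF hx').of_le (by exact_mod_cast le_top))
      ((contDiffAt_punctured hG hx').of_le (by exact_mod_cast le_top))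
  rw [e, add_mul]
  exact (norm_add_le _ _).trans (add_le_add (bF x hx) (bG x hx))

namespace ExtSymbol

lemma mono (h : ExtSymbol r F) (hs : s ≤ r) : ExtSymbol s F :=
  ⟨h.smooth, fun m => (h.bound m).mono hs⟩

lemma congr (h : ExtSymbol r F) (hFG : ∀ x ≠ 0, F x = G x) : ExtSymbol r G :=
  ⟨h.smooth.congr fun x hx => (hFG x hx).symm, fun m => (h.bound m).congr hFG⟩

lemma mul (hF : ExtSymbol r F) (hG : ExtSymbol s G) : ExtSymbol (r + s) (fun x => F x * G x) :=
  ⟨hF.smooth.mul hG.smooth, fun _ =>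
    ExtBound.mul hF.smooth hG.smooth (fun i _ => hF.bound i) (fun i _ => hG.bound i)⟩

lemma add (hF : ExtSymbol r F) (hG : ExtSymbol r G) : ExtSymbol r (fun x => F x + G x) :=
  ⟨hF.smooth.add hG.smooth, fun m => ExtBound.add hF.smooth hG.smooth (hF.bound m) (hG.bound m)⟩

lemma const (c : ℂ) : ExtSymbol 0 (fun _ => c) := by
  refine ⟨contDiffOn_const, fun m => ⟨‖c‖, norm_nonneg c, fun x _ => ?_⟩⟩
  cases m with
  | zero => simp
  | succ m =>
    have := rho_inv_nonneg x
    rw [iteratedFDeriv_succ_const]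
    simp only [Pi.zero_apply, norm_zero]
    positivity

lemma zero (r : ℕ) : ExtSymbol r (fun _ => 0) := by
  refine ⟨contDiffOn_const, fun m => ⟨0, le_rfl, fun x _ => ?_⟩⟩
  have : iteratedFDeriv ℝ m (fun _ : Plane => (0 : ℂ)) = 0 := iteratedFDeriv_fun_zero
  simp [this]

lemma const_mul (c : ℂ) (hF : ExtSymbol r F) : ExtSymbol r (fun x => c * F x) := by
  simpa using (const c).mul hF

lemma sum {ι : Type*} (t : Finset ι) {F : ι → Plane → ℂ} (h : ∀ i ∈ t, ExtSymbol r (F i)) :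
    ExtSymbol r (fun x => ∑ i ∈ t, F i x) := by
  classical
  induction t using Finset.induction_on with
  | empty => simpa using zero r
  | insert i t hi ih =>
    simp only [Finset.sum_insert hi]
    exact (h i (Finset.mem_insert_self i t)).add (ih fun j hj => h j (Finset.mem_insert_of_mem hj))

lemma fderiv_apply (hF : ExtSymbol r F) (v : Plane) :
    ExtSymbol (r + 1) (fun x => fderiv ℝ F x v) := by
  refine ⟨contDiffOn_fderiv_apply hF.smooth v, fun m => ?_⟩
  obtain ⟨C, hC, h⟩ := hF.bound (m + 1)
  refine ⟨‖v‖ * C, by positivity, fun x hx => ?_⟩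
  refine (norm_iteratedFDeriv_fderiv_apply_le
    (contDiffAt_punctured hF.smooth (ne_zero_of_one_le hx)) v m).trans ?_
  rw [mul_assoc, show r + 1 + m = r + (m + 1) by omega]
  exact mul_le_mul_of_nonneg_left (h x hx) (norm_nonneg v)

end ExtSymbol

/-! ### Graded asymptotic expansions -/

/-- A graded class of functions from which asymptotic expansions are built: the members of `T n` are
symbols of order `-n`. -/
structure IsTermClass (T : ℕ → (Plane → ℂ) → Prop) : Prop where
  extSymbol : ∀ {n h}, T n h → ExtSymbol n h
  zero : ∀ n, T n (fun _ => 0)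
  add : ∀ {n h k}, T n h → T n k → T n (fun x => h x + k x)
  const_mul : ∀ {n h} (c : ℂ), T n h → T n (fun x => c * h x)
  mul : ∀ {n m h k}, T n h → T m k → T (n + m) (fun x => h x * k x)

/-- The asymptotic expansion of `F` into terms of the orders `-j`, `-(j+1)`, …, where the `N`-th
remainder is a symbol of order `-(j+N)` outside the unit disc. -/
def HasTermExp (T : ℕ → (Plane → ℂ) → Prop) (j : ℕ) (F : Plane → ℂ) : Prop :=
  ∃ h : ℕ → Plane → ℂ, (∀ k, T (j + k) (h k)) ∧
    ∀ N, ExtSymbol (j + N) (fun x => F x - ∑ k ∈ Finset.range N, h k x)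

variable {T : ℕ → (Plane → ℂ) → Prop} {j i : ℕ}

lemma HasTermExp.extSymbol (h : HasTermExp T j F) : ExtSymbol j F := by
  obtain ⟨h, -, h0⟩ := h
  simpa using h0 0

lemma HasTermExp.congr (h : HasTermExp T j F) (hFG : ∀ x ≠ 0, F x = G x) : HasTermExp T j G := by
  obtain ⟨h, hT, hN⟩ := h
  exact ⟨h, hT, fun N => (hN N).congr fun x hx => by rw [hFG x hx]⟩

namespace IsTermClass

variable (hT : IsTermClass T)
include hT

lemma sum {ι : Type*} {n : ℕ} (t : Finset ι) {F : ι → Plane → ℂ} (h : ∀ i ∈ t, T n (F i)) :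
    T n (fun x => ∑ i ∈ t, F i x) := by
  classical
  induction t using Finset.induction_on with
  | empty => simpa using hT.zero n
  | insert i t hi ih =>
    simp only [Finset.sum_insert hi]
    exact hT.add (h i (Finset.mem_insert_self i t))
      (ih fun j hj => h j (Finset.mem_insert_of_mem hj))

lemma hasTermExp_of_mem {h : Plane → ℂ} (hh : T j h) : HasTermExp T j h := by
  refine ⟨fun k => if k = 0 then h else fun _ => 0, fun k => ?_, fun N => ?_⟩
  · by_cases hk : k = 0
    · simpa [hk] using hh
    · simpa [hk] using hT.zero _
  · cases N with
    | zero => simpa using hT.extSymbol hh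
    | succ N => simpa [Finset.sum_range_succ'] using ExtSymbol.zero (j + (N + 1))

lemma hasTermExp_pred (h : HasTermExp T (j + 1) F) : HasTermExp T j F := by
  obtain ⟨h, hh, hN⟩ := h
  refine ⟨fun k => Nat.casesOn k (fun _ => 0) h, fun k => ?_, fun N => ?_⟩
  · cases k with
    | zero => exact hT.zero _
    | succ k => simpa [add_assoc, add_comm 1] using hh k
  · cases N with
    | zero => simpa using (hN 0).mono (s := j) (by omega)
    | succ N =>
      have := hN N
      rw [show j + 1 + N = j + (N + 1) by omega] at this
      simpa [Finset.sum_range_succ'] using this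

lemma hasTermExp_of_le (h : HasTermExp T i F) (hij : j ≤ i) : HasTermExp T j F := by
  induction i, hij using Nat.le_induction with
  | base => exact h
  | succ i _ ih => exact ih (hT.hasTermExp_pred h)

lemma hasTermExp_const_mul (c : ℂ) (h : HasTermExp T j F) :
    HasTermExp T j (fun x => c * F x) := by
  obtain ⟨h, hh, hN⟩ := h
  refine ⟨fun k x => c * h k x, fun k => hT.const_mul c (hh k), fun N => ?_⟩
  simpa [mul_sub, Finset.mul_sum] using (hN N).const_mul c

lemma hasTermExp_add (h : HasTermExp T j F) (h' : HasTermExp T j G) :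
    HasTermExp T j (fun x => F x + G x) := by
  obtain ⟨h, hh, hN⟩ := h
  obtain ⟨k, hk, kN⟩ := h'
  refine ⟨fun n x => h n x + k n x, fun n => hT.add (hh n) (hk n), fun N => ?_⟩
  convert (hN N).add (kN N) using 2 with x
  rw [Finset.sum_add_distrib]
  ring

/-- Asymptotic summation: a function that is approximated by sums of functions with expansions of
increasing order has an expansion. -/
lemma hasTermExp_of_sum {G : ℕ → Plane → ℂ} (hG : ∀ n, HasTermExp T (j + n) (G n))
    (hF : ∀ N, ExtSymbol (j + N) (fun x => F x - ∑ n ∈ Finset.range N, G n x)) :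
    HasTermExp T j F := by
  choose b hb hN using hG
  refine ⟨fun m x => ∑ n ∈ Finset.range (m + 1), b n (m - n) x, fun m => ?_, fun N => ?_⟩
  · refine hT.sum _ fun n hn => ?_
    have h1 := hb n (m - n)
    have h2 : n ≤ m := by simpa [Nat.lt_succ_iff] using hn
    rwa [show j + n + (m - n) = j + m by omega] at h1
  · have h1 : ExtSymbol (j + N) (fun x => ∑ n ∈ Finset.range N,
        (G n x - ∑ k ∈ Finset.range (N - n), b n k x)) := by
      refine ExtSymbol.sum _ fun n hn => ?_
      have h2 := hN n (N - n)
      have h3 := Finset.mem_range.1 hn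
      rwa [show j + n + (N - n) = j + N by omega] at h2
    convert (hF N).add h1 using 2 with x
    rw [Finset.sum_range_diag_flip N fun n k => b n k x, Finset.sum_sub_distrib]
    ring

lemma hasTermExp_mem_mul {h : Plane → ℂ} (hh : T i h) (hF : HasTermExp T j F) :
    HasTermExp T (i + j) (fun x => h x * F x) := by
  obtain ⟨k, hk, kN⟩ := hF
  refine ⟨fun n x => h x * k n x, fun n => ?_, fun N => ?_⟩
  · rw [add_assoc]
    exact hT.mul hh (hk n)
  · rw [add_assoc]
    simpa [mul_sub, Finset.mul_sum] using (hT.extSymbol hh).mul (kN N)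

/-- Each term of the expansion of `F`, times `G`, has an expansion; the products are summed
asymptotically. -/
lemma hasTermExp_mul (hF : HasTermExp T i F) (hG : HasTermExp T j G) :
    HasTermExp T (i + j) (fun x => F x * G x) := by
  obtain ⟨h, hh, hN⟩ := id hF
  refine hT.hasTermExp_of_sum (G := fun n x => h n x * G x) (fun n => ?_) fun N => ?_
  · rw [show i + j + n = i + n + j by omega]
    exact hT.hasTermExp_mem_mul (hh n) hG
  · rw [show i + j + N = i + N + j by omega]
    convert (hN N).mul hG.extSymbol using 2 with x
    rw [sub_mul, Finset.sum_mul]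

lemma hasTermExp_pow (h1 : T 0 (fun _ => 1)) (hF : HasTermExp T 1 F) (n : ℕ) :
    HasTermExp T n (fun x => F x ^ n) := by
  induction n with
  | zero => simpa using hT.hasTermExp_of_mem h1
  | succ n ih =>
    simp only [pow_succ]
    exact hT.hasTermExp_mul ih hF

end IsTermClass

/-- Expansions into terms that have expansions themselves. -/
lemma HasTermExp.trans {T' : ℕ → (Plane → ℂ) → Prop} (hT' : IsTermClass T')
    (h : HasTermExp T j F) (hTT' : ∀ {n k}, T n k → HasTermExp T' n k) : HasTermExp T' j F := by
  obtain ⟨k, hk, hN⟩ := h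
  exact hT'.hasTermExp_of_sum (fun n => hTT' (hk n)) hN

end Exterior

/-! ### Homogeneous terms and angular terms -/

section Terms

open Filter

variable {n m : ℕ} {h k : Plane → ℂ}

/-- Functions on the punctured plane that are smooth and homogeneous of degree `-n`. -/
structure IsHomog (n : ℕ) (h : Plane → ℂ) : Prop where
  smooth : ContDiffOn ℝ ∞ h {0}ᶜ
  homog : ∀ (r : ℝ) (x : Plane), 0 < r → x ≠ 0 → h (r • x) = (r⁻¹ ^ n : ℝ) * h x

/-- Functions `ρ⁻ⁿ a(θ)`. -/
def IsRhoTerm (n : ℕ) (h : Plane → ℂ) : Prop :=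
  ∃ a, IsAngular a ∧ h = fun x => ((rho x)⁻¹ ^ n : ℝ) * a x

lemma isAngular_iff : IsAngular h ↔ IsHomog 0 h := by
  refine ⟨fun H => ⟨H.1, fun r x hr hx => ?_⟩, fun H => ⟨H.1, fun r x hr hx => ?_⟩⟩
  · simpa using H.2 r x hr hx
  · simpa using H.2 r x hr hx

namespace IsHomog

lemma add (hh : IsHomog n h) (hk : IsHomog n k) : IsHomog n (fun x => h x + k x) :=
  ⟨hh.smooth.add hk.smooth, fun r x hr hx => by
    rw [hh.homog r x hr hx, hk.homog r x hr hx, mul_add]⟩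

lemma mul (hh : IsHomog n h) (hk : IsHomog m k) : IsHomog (n + m) (fun x => h x * k x) :=
  ⟨hh.smooth.mul hk.smooth, fun r x hr hx => by
    rw [hh.homog r x hr hx, hk.homog r x hr hx, pow_add]
    push_cast
    ring⟩

lemma const (c : ℂ) : IsHomog 0 (fun _ => c) := ⟨contDiffOn_const, fun r x _ _ => by simp⟩

lemma const_mul (c : ℂ) (hh : IsHomog n h) : IsHomog n (fun x => c * h x) := by
  simpa using (const c).mul hh

lemma fderiv_apply (hh : IsHomog n h) (v : Plane) :
    IsHomog (n + 1) (fun x => fderiv ℝ h x v) := by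
  refine ⟨contDiffOn_fderiv_apply hh.smooth v, fun r x hr hx => ?_⟩
  have hrx : r • x ≠ 0 := smul_ne_zero hr.ne' hx
  have h1 : HasFDerivAt (fun y : Plane => r • y) (r • ContinuousLinearMap.id ℝ Plane) x :=
    (ContinuousLinearMap.id ℝ Plane).hasFDerivAt.const_smul r
  have h2 := (((contDiffAt_punctured hh.smooth hrx).differentiableAt
    (by simp)).hasFDerivAt.comp x h1).fderiv
  have h3 := (((contDiffAt_punctured hh.smooth hx).differentiableAt
    (by simp)).hasFDerivAt.const_mul ((r⁻¹ ^ n : ℝ) : ℂ)).fderiv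
  have e : h ∘ (fun y : Plane => r • y) =ᶠ[𝓝 x] fun y => ((r⁻¹ ^ n : ℝ) : ℂ) * h y := by
    filter_upwards [isOpen_compl_singleton.mem_nhds hx] with y hy
    exact hh.homog r y hr hy
  rw [e.fderiv_eq, h3] at h2
  have h4 := DFunLike.congr_fun h2 v
  simp only [smul_apply, smul_eq_mul, ContinuousLinearMap.comp_apply, ContinuousLinearMap.id_apply,
    map_smul, Complex.real_smul] at h4
  have hr' : (r : ℂ) ≠ 0 := by exact_mod_cast hr.ne'
  rw [pow_succ]
  push_cast at h4 ⊢
  rw [mul_right_comm, h4]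
  field_simp

lemma exists_norm_le (hh : IsHomog n h) : ∃ C, 0 ≤ C ∧ ∀ x ≠ 0, ‖h x‖ ≤ C * ‖x‖⁻¹ ^ n := by
  have hc : ContinuousOn h (Metric.sphere 0 1) := hh.smooth.continuousOn.mono fun x hx => by
    rintro rfl
    simp at hx
  obtain ⟨C, hC⟩ := (isCompact_sphere (0 : Plane) 1).exists_bound_of_continuousOn hc
  refine ⟨max C 0, le_max_right _ _, fun x hx => ?_⟩
  have hx' : 0 < ‖x‖ := norm_pos_iff.2 hx
  have hy : ‖‖x‖⁻¹ • x‖ = 1 := by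
    rw [norm_smul, norm_inv, norm_norm, inv_mul_cancel₀ hx'.ne']
  have hy0 : ‖x‖⁻¹ • x ≠ 0 := smul_ne_zero (inv_ne_zero hx'.ne') hx
  have e := hh.homog ‖x‖ _ hx' hy0
  rw [smul_smul, mul_inv_cancel₀ hx'.ne', one_smul] at e
  rw [e, norm_mul, Complex.norm_real, Real.norm_of_nonneg (by positivity), mul_comm]
  refine mul_le_mul_of_nonneg_right ((hC _ ?_).trans (le_max_left _ _)) (by positivity)
  simp [hy]

/-- The bound is compactness of the circle, and derivatives are homogeneous again. -/
lemma extSymbol (hh : IsHomog n h) : ExtSymbol n h := by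
  refine ⟨hh.smooth, fun m => ?_⟩
  induction m generalizing n h with
  | zero =>
    obtain ⟨C, hC, hb⟩ := hh.exists_norm_le
    refine ExtBound.zero_of_le (C := C * 2 ^ n) (by positivity) fun x hx => ?_
    refine (hb x (ne_zero_of_one_le hx)).trans ?_
    rw [mul_assoc, ← mul_pow]
    have := norm_inv_le hx
    gcongr
  | succ m ih => exact ExtBound.succ hh.smooth fun v => ih (hh.fderiv_apply v)

end IsHomog

lemma isTermClass_isHomog : IsTermClass IsHomog where
  extSymbol := IsHomog.extSymbol
  zero n := ⟨contDiffOn_const, fun r x _ _ => by simp⟩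
  add := IsHomog.add
  const_mul := IsHomog.const_mul
  mul := IsHomog.mul

/-- `|x|⁻¹`, as a complex valued function. -/
def normInv (x : Plane) : ℂ := ((‖x‖⁻¹ : ℝ) : ℂ)

/-- `ρ⁻¹`, as a complex valued function. -/
def rhoInv (x : Plane) : ℂ := (((rho x)⁻¹ : ℝ) : ℂ)

lemma isHomog_normInv : IsHomog 1 normInv := by
  refine ⟨fun x hx => ?_, fun r x hr hx => ?_⟩
  · exact (Complex.ofRealCLM.contDiff.contDiffAt.comp x
      ((contDiffAt_norm ℝ hx).inv (norm_ne_zero_iff.2 hx))).contDiffWithinAt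
  · simp only [normInv, norm_smul, Real.norm_of_nonneg hr.le, mul_inv, pow_one]
    push_cast
    ring

/-! ### The binomial series -/

/-- The derivative of order `k` of `(1 + s)^{-1/2}`. -/
def binom (k : ℕ) (s : ℝ) : ℝ :=
  (∏ i ∈ Finset.range k, (-(1 / 2 : ℝ) - i)) * (1 + s) ^ (-(1 / 2 : ℝ) - k)

lemma hasDerivAt_binom (k : ℕ) {s : ℝ} (hs : -1 < s) :
    HasDerivAt (binom k) (binom (k + 1) s) s := by
  have h1 : HasDerivAt (fun s : ℝ => 1 + s) 1 s := (hasDerivAt_id s).const_add 1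
  have h2 := (h1.rpow_const (p := -(1 / 2 : ℝ) - k) (Or.inl (by linarith))).const_mul
    (∏ i ∈ Finset.range k, (-(1 / 2 : ℝ) - i))
  refine HasDerivAt.congr_deriv (f := binom k) h2 ?_
  have e : binom (k + 1) s = (∏ i ∈ Finset.range (k + 1), (-(1 / 2 : ℝ) - i)) *
    (1 + s) ^ (-(1 / 2 : ℝ) - (k + 1 : ℕ)) := rfl
  rw [e, Finset.prod_range_succ, Nat.cast_succ,
    show (-(1 / 2 : ℝ) - (k + 1)) = -(1 / 2 : ℝ) - k - 1 by ring]
  ring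

/-- The Taylor remainder of order `N` of the derivative of order `j` of `(1 + s)^{-1/2}` at `0`. -/
def binomRem (j N : ℕ) (s : ℝ) : ℝ :=
  binom j s - ∑ k ∈ Finset.range N, binom (j + k) 0 / k.factorial * s ^ k

lemma binomRem_zero (j : ℕ) : binomRem j 0 = binom j := by
  funext s
  simp [binomRem]

lemma binomRem_succ_zero (j N : ℕ) : binomRem j (N + 1) 0 = 0 := by
  simp [binomRem, Finset.sum_range_succ']

lemma hasDerivAt_binomRem_succ (j N : ℕ) {s : ℝ} (hs : -1 < s) :
    HasDerivAt (binomRem j (N + 1)) (binomRem (j + 1) N s) s := by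
  have h1 : HasDerivAt (fun s : ℝ => ∑ k ∈ Finset.range (N + 1),
      binom (j + k) 0 / k.factorial * s ^ k)
      (∑ k ∈ Finset.range (N + 1), binom (j + k) 0 / k.factorial * (k * s ^ (k - 1))) s :=
    HasDerivAt.fun_sum fun k _ => (hasDerivAt_pow k s).const_mul _
  refine HasDerivAt.congr_deriv (f := binomRem j (N + 1)) ((hasDerivAt_binom j hs).sub h1) ?_
  have e : binomRem (j + 1) N s = binom (j + 1) s - ∑ k ∈ Finset.range N,
    binom (j + 1 + k) 0 / k.factorial * s ^ k := rfl
  rw [e, Finset.sum_range_succ']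
  simp only [Nat.cast_zero, zero_mul, mul_zero, add_zero, Nat.add_sub_cancel]
  congr 1
  refine Finset.sum_congr rfl fun k _ => ?_
  rw [Nat.factorial_succ, show j + 1 + k = j + (k + 1) by omega]
  push_cast
  field_simp

lemma hasDerivAt_binomRem (j N : ℕ) {s : ℝ} (hs : -1 < s) :
    HasDerivAt (binomRem j N) (binomRem (j + 1) (N - 1) s) s := by
  cases N with
  | zero =>
    rw [binomRem_zero, binomRem_zero]
    exact hasDerivAt_binom j hs
  | succ N => exact hasDerivAt_binomRem_succ j N hs

/-- The interval keeps away from the singularity at `-1`. It contains the values `|x|⁻²` and `-ρ⁻²`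
outside the unit disc, for which the series is used. -/
lemma exists_abs_binomRem_le (j N : ℕ) :
    ∃ C, 0 ≤ C ∧ ∀ s ∈ Set.Icc (-(1 / 2) : ℝ) 1, |binomRem j N s| ≤ C * |s| ^ N := by
  induction N generalizing j with
  | zero =>
    have hc : ContinuousOn (binomRem j 0) (Set.Icc (-(1 / 2) : ℝ) 1) := fun s hs =>
      (hasDerivAt_binomRem j 0 (by linarith [hs.1])).continuousAt.continuousWithinAt
    obtain ⟨C, hC⟩ := isCompact_Icc.exists_bound_of_continuousOn hc
    exact ⟨max C 0, le_max_right _ _, fun s hs => by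
      simpa using Or.inl (hC s hs)⟩
  | succ N ih =>
    obtain ⟨C, hC, hb⟩ := ih (j + 1)
    refine ⟨C, hC, fun s hs => ?_⟩
    have h0 : (0 : ℝ) ∈ Set.Icc (-|s|) |s| ∩ Set.Icc (-(1 / 2) : ℝ) 1 :=
      ⟨⟨by simp, abs_nonneg s⟩, by norm_num, zero_le_one⟩
    have hs' : s ∈ Set.Icc (-|s|) |s| ∩ Set.Icc (-(1 / 2) : ℝ) 1 :=
      ⟨⟨neg_abs_le s, le_abs_self s⟩, hs⟩
    have hconv : Convex ℝ (Set.Icc (-|s|) |s| ∩ Set.Icc (-(1 / 2) : ℝ) 1) :=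
      (convex_Icc _ _).inter (convex_Icc _ _)
    have h := hconv.norm_image_sub_le_of_norm_hasDerivWithin_le (f := binomRem j (N + 1))
      (C := C * |s| ^ N)
      (fun t ht => (hasDerivAt_binomRem_succ j N (by linarith [ht.2.1])).hasDerivWithinAt)
      (fun t ht => (hb t ht.2).trans
        (mul_le_mul_of_nonneg_left (pow_le_pow_left₀ (abs_nonneg t) (abs_le.2 ht.1) N) hC)) h0 hs'
    rw [binomRem_succ_zero, sub_zero, sub_zero, Real.norm_eq_abs, Real.norm_eq_abs] at h
    rw [pow_succ, ← mul_assoc]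
    exact h

/-- The Taylor remainders of the binomial series along a symbol of order `-2`. -/
lemma extSymbol_binomRem {s : Plane → ℝ} (hs : ExtSymbol 2 (fun x => (s x : ℂ)))
    (hs0 : ContDiffOn ℝ ∞ s {0}ᶜ) (hs1 : ∀ x ≠ 0, -1 < s x)
    (hs2 : ∀ x, 1 ≤ ‖x‖ → s x ∈ Set.Icc (-(1 / 2) : ℝ) 1) (j N : ℕ) :
    ExtSymbol (2 * N) (fun x => ((binomRem j N (s x) : ℝ) : ℂ)) := by
  have hsm : ∀ j N, ContDiffOn ℝ ∞ (fun x => ((binomRem j N (s x) : ℝ) : ℂ)) {0}ᶜ := fun j N => by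
    refine Complex.ofRealCLM.contDiff.comp_contDiffOn ?_
    change ContDiffOn ℝ ∞ (fun x => (∏ i ∈ Finset.range j, (-(1 / 2 : ℝ) - i)) *
      (1 + s x) ^ (-(1 / 2 : ℝ) - j) - ∑ k ∈ Finset.range N,
        binom (j + k) 0 / k.factorial * s x ^ k) {0}ᶜ
    refine ContDiffOn.sub (contDiffOn_const.mul ?_) (ContDiffOn.sum fun k _ =>
      contDiffOn_const.mul (hs0.pow k))
    exact (contDiffOn_const.add hs0).rpow_const_of_ne fun x hx => by linarith [hs1 x hx]
  refine ⟨hsm j N, fun m => ?_⟩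
  induction m using Nat.strong_induction_on generalizing j N with
  | _ m ih =>
  cases m with
  | zero =>
    obtain ⟨C, hC, hb⟩ := exists_abs_binomRem_le j N
    obtain ⟨D, hD, hd⟩ := hs.bound 0
    refine ExtBound.zero_of_le (C := C * D ^ N) (by positivity) fun x hx => ?_
    rw [Complex.norm_real, Real.norm_eq_abs]
    refine (hb _ (hs2 x hx)).trans ?_
    rw [mul_assoc, pow_mul, ← mul_pow]
    have := hd x hx
    simp only [norm_iteratedFDeriv_zero, Complex.norm_real, Real.norm_eq_abs, add_zero] at this
    gcongr
  | succ m =>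
    refine ExtBound.succ (hsm j N) fun v => ?_
    have e : ∀ x ≠ 0, ((binomRem (j + 1) (N - 1) (s x) : ℝ) : ℂ) *
        fderiv ℝ (fun x => (s x : ℂ)) x v =
        fderiv ℝ (fun x => ((binomRem j N (s x) : ℝ) : ℂ)) x v := fun x hx => by
      have h1 : HasFDerivAt s _ x := ((hs0.contDiffAt
        (isOpen_compl_singleton.mem_nhds hx)).differentiableAt (by simp)).hasFDerivAt
      have h2 := Complex.ofRealCLM.hasFDerivAt.comp x h1
      have h3 := Complex.ofRealCLM.hasFDerivAt.comp x
        ((hasDerivAt_binomRem j N (hs1 x hx)).comp_hasFDerivAt x h1)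
      have h2' := h2.fderiv
      have h3' := h3.fderiv
      simp only [Function.comp_def, Complex.ofRealCLM_apply] at h2' h3'
      rw [h2', h3']
      simp
    have h1 : ExtBound (2 * (N - 1) + 3) m (fun x => ((binomRem (j + 1) (N - 1) (s x) : ℝ) : ℂ) *
        fderiv ℝ (fun x => (s x : ℂ)) x v) :=
      ExtBound.mul (hsm _ _) (hs.fderiv_apply v).smooth (fun i hi => ih i (by omega) _ _)
        (fun i _ => (hs.fderiv_apply v).bound i)
    have h2 : ExtBound (2 * N + 1) m (fun x => ((binomRem (j + 1) (N - 1) (s x) : ℝ) : ℂ) *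
        fderiv ℝ (fun x => (s x : ℂ)) x v) := h1.mono (by omega)
    exact h2.congr e

end Terms

/-! ### Classical symbols and homogeneous expansions -/

section Classical

open Filter

variable {f g : Plane → ℂ}

lemma inv_eq_mul_binom {a b s : ℝ} (ha : 0 < a) (hb : 0 < b) (h : b ^ 2 = a ^ 2 * (1 + s)) :
    b⁻¹ = a⁻¹ * binom 0 s := by
  have e : 1 + s = (b / a) ^ 2 := by
    rw [div_pow, h]
    field_simp
  have e' : binom 0 s = (1 + s) ^ (-(1 / 2 : ℝ)) := by
    simp [binom]
  rw [e', e, Real.rpow_neg (by positivity), ← Real.sqrt_eq_rpow, Real.sqrt_sq (by positivity)]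
  field_simp

lemma norm_inv_eq {x : Plane} (hx : x ≠ 0) :
    ‖x‖⁻¹ = (rho x)⁻¹ * binom 0 (-1 * (rho x)⁻¹ ^ 2) := by
  refine inv_eq_mul_binom (rho_pos x) (norm_pos_iff.2 hx) ?_
  have := (rho_pos x).ne'
  have h := rho_sq x
  field_simp
  linarith

lemma rho_inv_eq {x : Plane} (hx : x ≠ 0) :
    (rho x)⁻¹ = ‖x‖⁻¹ * binom 0 (1 * ‖x‖⁻¹ ^ 2) := by
  refine inv_eq_mul_binom (norm_pos_iff.2 hx) (rho_pos x) ?_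
  have := norm_ne_zero_iff.2 hx
  rw [rho_sq]
  field_simp
  ring

/-- The binomial series of `y (1 + σ y²)^{-1/2}`, for `y` of order `-1`. The cases `y = |x|⁻¹`, `σ = 1`
and `y = ρ⁻¹`, `σ = -1` express `ρ⁻¹` and `|x|⁻¹` by each other. -/
lemma hasTermExp_binom {T : ℕ → (Plane → ℂ) → Prop} (hT : IsTermClass T) {y : Plane → ℝ}
    (hy : T 1 (fun x => (y x : ℂ))) (hy0 : ContDiffOn ℝ ∞ y {0}ᶜ) (σ : ℝ)
    (h1 : ∀ x ≠ 0, -1 < σ * y x ^ 2)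
    (h2 : ∀ x, 1 ≤ ‖x‖ → σ * y x ^ 2 ∈ Set.Icc (-(1 / 2) : ℝ) 1) :
    HasTermExp T 1 (fun x => ((y x * binom 0 (σ * y x ^ 2) : ℝ) : ℂ)) := by
  have hpow : ∀ n : ℕ, T (2 * n + 1) (fun x => (y x : ℂ) ^ (2 * n + 1)) := fun n => by
    induction n with
    | zero => simpa using hy
    | succ n ih =>
      have e : (fun x => (y x : ℂ) ^ (2 * (n + 1) + 1)) =
          fun x => (y x : ℂ) ^ (2 * n + 1) * ((y x : ℂ) * (y x : ℂ)) := by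
        funext x
        ring
      rw [e, show 2 * (n + 1) + 1 = 2 * n + 1 + (1 + 1) by ring]
      exact hT.mul ih (hT.mul hy hy)
  have hs : ExtSymbol 2 (fun x => ((σ * y x ^ 2 : ℝ) : ℂ)) := by
    refine ((hT.extSymbol (hT.mul hy hy)).const_mul (σ : ℂ)).congr fun x _ => ?_
    push_cast
    ring
  refine hT.hasTermExp_of_sum (G := fun n x =>
    ((binom n 0 / n.factorial * σ ^ n : ℝ) : ℂ) * (y x : ℂ) ^ (2 * n + 1)) (fun n => ?_)
    fun N => ?_
  · exact hT.hasTermExp_of_le (hT.hasTermExp_of_mem (hT.const_mul _ (hpow n))) (by omega)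
  · refine (((hT.extSymbol hy).mul (extSymbol_binomRem hs (contDiffOn_const.mul (hy0.pow 2)) h1 h2
      0 N)).mono (by omega)).congr fun x _ => ?_
    simp only [binomRem, zero_add]
    push_cast
    rw [mul_sub, Finset.mul_sum]
    congr 1
    refine Finset.sum_congr rfl fun n _ => ?_
    ring

lemma contDiffOn_norm_inv : ContDiffOn ℝ ∞ (fun x : Plane => ‖x‖⁻¹) {0}ᶜ := fun _ hx =>
  ((contDiffAt_norm ℝ hx).inv (norm_ne_zero_iff.2 hx)).contDiffWithinAt

lemma contDiffOn_rho_inv : ContDiffOn ℝ ∞ (fun x : Plane => (rho x)⁻¹) {0}ᶜ :=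
  (contDiff_rho.inv fun _ => (rho_pos _).ne').contDiffOn

lemma hasTermExp_rhoInv : HasTermExp IsHomog 1 rhoInv := by
  refine (hasTermExp_binom isTermClass_isHomog isHomog_normInv contDiffOn_norm_inv 1
    (fun x _ => by
      have := sq_nonneg ‖x‖⁻¹
      linarith) fun x hx => ?_).congr fun x hx => ?_
  · have h := inv_le_one_of_one_le₀ hx
    have h0 : 0 ≤ ‖x‖⁻¹ := by positivity
    constructor <;> nlinarith
  · rw [rhoInv, rho_inv_eq hx]

lemma IsRhoTerm.of_angular {n : ℕ} {a : Plane → ℂ} (ha : IsAngular a) :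
    IsRhoTerm n (fun x => rhoInv x ^ n * a x) :=
  ⟨a, ha, by
    funext x
    simp [rhoInv]⟩

lemma IsRhoTerm.exists_eq {n : ℕ} {h : Plane → ℂ} (hh : IsRhoTerm n h) :
    ∃ a, IsAngular a ∧ h = fun x => rhoInv x ^ n * a x := by
  obtain ⟨a, ha, rfl⟩ := hh
  refine ⟨a, ha, ?_⟩
  funext x
  simp [rhoInv]

lemma IsRhoTerm.hasTermExp {n : ℕ} {h : Plane → ℂ} (hh : IsRhoTerm n h) :
    HasTermExp IsHomog n h := by
  obtain ⟨a, ha, rfl⟩ := hh.exists_eq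
  have h1 := isTermClass_isHomog.hasTermExp_pow (IsHomog.const 1) hasTermExp_rhoInv n
  simpa using isTermClass_isHomog.hasTermExp_mul h1
    (isTermClass_isHomog.hasTermExp_of_mem (isAngular_iff.1 ha))

lemma isTermClass_isRhoTerm : IsTermClass IsRhoTerm where
  extSymbol hh := hh.hasTermExp.extSymbol
  zero n := ⟨fun _ => 0, isAngular_iff.2 (IsHomog.const 0), by simp⟩
  add hh hk := by
    obtain ⟨a, ha, rfl⟩ := hh
    obtain ⟨b, hb, rfl⟩ := hk
    refine ⟨fun x => a x + b x, isAngular_iff.2 ((isAngular_iff.1 ha).add (isAngular_iff.1 hb)), ?_⟩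
    funext x
    ring
  const_mul c hh := by
    obtain ⟨a, ha, rfl⟩ := hh
    refine ⟨fun x => c * a x, isAngular_iff.2 ((isAngular_iff.1 ha).const_mul c), ?_⟩
    funext x
    ring
  mul hh hk := by
    obtain ⟨a, ha, rfl⟩ := hh
    obtain ⟨b, hb, rfl⟩ := hk
    refine ⟨fun x => a x * b x, isAngular_iff.2 ((isAngular_iff.1 ha).mul (isAngular_iff.1 hb)), ?_⟩
    funext x
    push_cast
    rw [pow_add]
    ring

lemma isRhoTerm_one : IsRhoTerm 0 (fun _ => 1) :=
  ⟨fun _ => 1, isAngular_iff.2 (IsHomog.const 1), by simp⟩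

lemma hasTermExp_normInv : HasTermExp IsRhoTerm 1 normInv := by
  have hq : IsRhoTerm 1 (fun x => (((rho x)⁻¹ : ℝ) : ℂ)) := by
    simpa [rhoInv] using IsRhoTerm.of_angular (n := 1) (isAngular_iff.2 (IsHomog.const 1))
  have hsq : ∀ x, (rho x)⁻¹ ^ 2 * (1 + ‖x‖ ^ 2) = 1 := fun x => by
    rw [← rho_sq, ← mul_pow, inv_mul_cancel₀ (rho_pos x).ne', one_pow]
  refine (hasTermExp_binom isTermClass_isRhoTerm hq contDiffOn_rho_inv (-1)
    (fun x hx => ?_) fun x hx => ?_).congr fun x hx => ?_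
  · have h := hsq x
    have h1 : 0 < ‖x‖ ^ 2 := by positivity
    have h2 : 0 < (rho x)⁻¹ ^ 2 := by
      have := rho_pos x
      positivity
    nlinarith
  · have h := hsq x
    have h1 : 1 ≤ ‖x‖ ^ 2 := one_le_pow₀ hx
    have h2 : 0 ≤ (rho x)⁻¹ ^ 2 := sq_nonneg _
    constructor <;> nlinarith
  · rw [normInv, norm_inv_eq hx]

lemma IsHomog.hasTermExp {n : ℕ} {h : Plane → ℂ} (hh : IsHomog n h) :
    HasTermExp IsRhoTerm n h := by
  -- the angular factor `|x|ⁿ h`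
  have ha : IsAngular (fun x => ((‖x‖ ^ n : ℝ) : ℂ) * h x) := by
    refine ⟨ContDiffOn.mul (Complex.ofRealCLM.contDiff.comp_contDiffOn fun x hx =>
      ((contDiffAt_norm ℝ hx).pow n).contDiffWithinAt) hh.smooth, fun r x hr hx => ?_⟩
    beta_reduce
    rw [hh.homog r x hr hx, norm_smul, Real.norm_of_nonneg hr.le, ← mul_assoc, ← Complex.ofReal_mul]
    congr 2
    rw [mul_pow, inv_pow]
    field_simp
  have h0 : HasTermExp IsRhoTerm 0 (fun x => ((‖x‖ ^ n : ℝ) : ℂ) * h x) := by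
    have := isTermClass_isRhoTerm.hasTermExp_of_mem (IsRhoTerm.of_angular (n := 0) ha)
    simpa using this
  have h1 := isTermClass_isRhoTerm.hasTermExp_pow isRhoTerm_one hasTermExp_normInv n
  refine (isTermClass_isRhoTerm.hasTermExp_mul h1 h0).congr fun x hx => ?_
  have : ((‖x‖ : ℝ) : ℂ) ≠ 0 := by exact_mod_cast norm_ne_zero_iff.2 hx
  simp only [normInv]
  push_cast
  rw [← mul_assoc, ← mul_pow, inv_mul_cancel₀ this, one_pow, one_mul]

lemma extSymbol_remainder {a : ℕ → Plane → ℂ} (hf : ContDiff ℝ ∞ f) (ha : ∀ k, IsAngular (a k))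
    (h : HasExpansion f a) (N : ℕ) : ExtSymbol N (remainder f a N) := by
  refine ⟨?_, fun m => ?_⟩
  · refine hf.contDiffOn.sub (ContDiffOn.sum fun k _ => ContDiffOn.mul ?_ (ha k).1)
    exact Complex.ofRealCLM.contDiff.comp_contDiffOn (contDiffOn_rho_inv.pow k)
  · obtain ⟨C, hC⟩ := h N m
    refine ⟨max C 0, le_max_right _ _, fun x hx => (hC x hx).trans ?_⟩
    exact mul_le_mul_of_nonneg_right (le_max_left _ _) (pow_nonneg (rho_inv_nonneg x) _)

/-- The symbols of the class are the smooth functions with an expansion into homogeneous terms. Unlike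
the terms `ρ⁻ⁿ a(θ)`, homogeneous terms are stable under differentiation. -/
lemma mem_symbolClass_iff : f ∈ symbolClass ↔ ContDiff ℝ ∞ f ∧ HasTermExp IsHomog 0 f := by
  constructor
  · rintro ⟨hf, a, ha, h⟩
    have h1 : HasTermExp IsRhoTerm 0 f := by
      refine ⟨fun k x => ((rho x)⁻¹ ^ k : ℝ) * a k x, fun k => ?_, fun N => ?_⟩
      · rw [zero_add]
        exact ⟨a k, ha k, rfl⟩
      · rw [zero_add]
        exact extSymbol_remainder hf ha h N
    exact ⟨hf, h1.trans isTermClass_isHomog IsRhoTerm.hasTermExp⟩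
  · rintro ⟨hf, h⟩
    obtain ⟨k, hk, hN⟩ := h.trans isTermClass_isRhoTerm IsHomog.hasTermExp
    simp only [zero_add] at hk hN
    choose a ha hka using hk
    refine ⟨hf, a, ha, fun N m => ?_⟩
    obtain ⟨C, hC, hb⟩ := (hN N).bound m
    refine ⟨C, fun x hx => ?_⟩
    have e : remainder f a N = fun x => f x - ∑ k_1 ∈ Finset.range N, k k_1 x := by
      funext x
      simp only [remainder, hka]
    rw [e]
    exact hb x hx

/-- Smooth functions on the plane that are symbols of order `-r`. -/
structure Symb (r : ℕ) (f : Plane → ℂ) : Prop where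
  smooth : ContDiff ℝ ∞ f
  extSymbol : ExtSymbol r f

variable {r s : ℕ}

lemma Symb.fderiv_apply (hf : Symb r f) (v : Plane) : Symb (r + 1) (fun x => fderiv ℝ f x v) :=
  ⟨(hf.smooth.fderiv_right (m := ∞) (by simp)).clm_apply contDiff_const, hf.extSymbol.fderiv_apply v⟩

/-- On the plane `ρ` and `⟨z⟩` are comparable, and the unit disc is compact. -/
lemma Symb.amp (hf : Symb r f) : Amp (fun z => jap z ^ (-(r : ℤ))) f := by
  refine ⟨fun _ => hf.smooth, fun m => ?_⟩
  obtain ⟨C, hC, h⟩ := hf.extSymbol.bound m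
  have hc : ContinuousOn (iteratedFDeriv ℝ m f) (Metric.closedBall 0 1) :=
    (hf.smooth.continuous_iteratedFDeriv (by exact_mod_cast le_top)).continuousOn
  obtain ⟨D, hD⟩ := (isCompact_closedBall (0 : Plane) 1).exists_bound_of_continuousOn hc
  refine ⟨(C + max D 0) * 2 ^ r, by positivity, fun _ x => ?_⟩
  beta_reduce
  rw [zpow_neg, zpow_natCast, ← inv_pow, mul_assoc, ← mul_pow, add_mul]
  have hj := jap_pos x
  rcases le_total 1 ‖x‖ with hx | hx
  · have h1 : (rho x)⁻¹ ≤ 2 * (jap x)⁻¹ := by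
      have := jap_le_two_mul_rho x
      have := rho_pos x
      rw [inv_le_comm₀ (by positivity) (by positivity), mul_inv, inv_inv]
      linarith
    have h2 : (rho x)⁻¹ ^ (r + m) ≤ (2 * (jap x)⁻¹) ^ r :=
      (pow_le_pow_of_le_one (rho_inv_nonneg x) (rho_inv_le_one x) (Nat.le_add_right r m)).trans
        (pow_le_pow_left₀ (rho_inv_nonneg x) h1 r)
    have h3 := (h x hx).trans (mul_le_mul_of_nonneg_left h2 hC)
    have h4 : 0 ≤ max D 0 * (2 * (jap x)⁻¹) ^ r := by positivity
    linarith
  · have h1 : 1 ≤ (2 * (jap x)⁻¹) ^ r := by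
      refine one_le_pow₀ ?_
      rw [← div_eq_mul_inv, one_le_div hj, jap]
      linarith
    have h2 : ‖iteratedFDeriv ℝ m f x‖ ≤ max D 0 :=
      (hD x (by simpa using hx)).trans (le_max_left _ _)
    have h3 : 0 ≤ C * (2 * (jap x)⁻¹) ^ r := by positivity
    nlinarith [le_max_right D 0]

lemma Symb.cb (hf : Symb r f) : CB f :=
  hf.amp.mono zero_le_one fun _ z => by
    rw [one_mul, ← zpow_zero (jap z)]
    exact jap_zpow_le_of_le z (by omega)

lemma Symb.pd (hf : Symb r f) (i : Fin 2) : Symb (r + 1) (pd i f) := hf.fderiv_apply _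

lemma Symb.of_mem (hf : f ∈ symbolClass) : Symb 0 f :=
  ⟨(mem_symbolClass_iff.1 hf).1, (mem_symbolClass_iff.1 hf).2.extSymbol⟩

lemma HasTermExp.fderiv_apply {j : ℕ} (hs : ContDiffOn ℝ ∞ f {0}ᶜ) (hf : HasTermExp IsHomog j f)
    (v : Plane) : HasTermExp IsHomog (j + 1) (fun x => fderiv ℝ f x v) := by
  obtain ⟨h, hh, hN⟩ := hf
  refine ⟨fun k x => fderiv ℝ (h k) x v, fun k => ?_, fun N => ?_⟩
  · rw [add_right_comm]
    exact (hh k).fderiv_apply v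
  · rw [add_right_comm]
    refine ((hN N).fderiv_apply v).congr fun x hx => ?_
    have d1 : DifferentiableAt ℝ f x := (contDiffAt_punctured hs hx).differentiableAt (by simp)
    have d2 : ∀ k ∈ Finset.range N, DifferentiableAt ℝ (h k) x := fun k _ =>
      (contDiffAt_punctured (hh k).smooth hx).differentiableAt (by simp)
    rw [fderiv_fun_sub d1 (DifferentiableAt.fun_sum d2), fderiv_fun_sum d2]
    simp

end Classical

/-! ### The asymptotic expansion of the Moyal product -/

section MoyalExpansion

open Filter

variable {f g : Plane → ℂ} {r s : ℕ}

/-- The bidifferential operators of the Moyal expansion: the powers of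
`i (∂₁ ⊗ ∂₀ - ∂₀ ⊗ ∂₁)`, followed by multiplication. -/
def bidiff : ℕ → (Plane → ℂ) → (Plane → ℂ) → Plane → ℂ
  | 0, f, g => fun w => f w * g w
  | n + 1, f, g => fun w =>
      Complex.I * (bidiff n (pd 1 f) (pd 0 g) w - bidiff n (pd 0 f) (pd 1 g) w)

lemma contDiff_fderiv_apply (hf : ContDiff ℝ ∞ f) (v : Plane) :
    ContDiff ℝ ∞ (fun w => fderiv ℝ f w v) :=
  (hf.fderiv_right (m := ∞) (by simp)).clm_apply contDiff_const

lemma contDiff_pd (hf : ContDiff ℝ ∞ f) (i : Fin 2) : ContDiff ℝ ∞ (pd i f) :=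
  contDiff_fderiv_apply hf _

lemma contDiff_bidiff (n : ℕ) (hf : ContDiff ℝ ∞ f) (hg : ContDiff ℝ ∞ g) :
    ContDiff ℝ ∞ (bidiff n f g) := by
  induction n generalizing f g with
  | zero => exact hf.mul hg
  | succ n ih =>
    exact contDiff_const.mul ((ih (contDiff_pd hf 1) (contDiff_pd hg 0)).sub
      (ih (contDiff_pd hf 0) (contDiff_pd hg 1)))

lemma pd_fderiv_apply (hf : ContDiff ℝ ∞ f) (i : Fin 2) (v : Plane) :
    pd i (fun w => fderiv ℝ f w v) = fun w => fderiv ℝ (pd i f) w v :=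
  funext fun w => fderiv_fderiv_apply_comm hf w v (basisVec i)

lemma fderiv_bidiff (n : ℕ) (hf : ContDiff ℝ ∞ f) (hg : ContDiff ℝ ∞ g) (w v : Plane) :
    fderiv ℝ (bidiff n f g) w v =
      bidiff n (fun z => fderiv ℝ f z v) g w + bidiff n f (fun z => fderiv ℝ g z v) w := by
  induction n generalizing f g with
  | zero =>
    have h1 := (hf.differentiable (by simp) w).hasFDerivAt
    have h2 := (hg.differentiable (by simp) w).hasFDerivAt
    have h3 : fderiv ℝ (bidiff 0 f g) w = _ := (h1.mul h2).fderiv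
    rw [h3]
    simp [bidiff]
    ring
  | succ n ih =>
    have hd : ∀ i j, DifferentiableAt ℝ (bidiff n (pd i f) (pd j g)) w := fun i j =>
      (contDiff_bidiff n (contDiff_pd hf i) (contDiff_pd hg j)).differentiable (by simp) w
    have h3 : fderiv ℝ (bidiff (n + 1) f g) w = _ :=
      (((hd 1 0).hasFDerivAt.sub (hd 0 1).hasFDerivAt).const_mul Complex.I).fderiv
    rw [h3]
    simp only [smul_apply, sub_apply, smul_eq_mul, bidiff,
      ih (contDiff_pd hf _) (contDiff_pd hg _), pd_fderiv_apply hf, pd_fderiv_apply hg]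
    ring

lemma hasTermExp_bidiff (n : ℕ) (hf : ContDiff ℝ ∞ f) (hg : ContDiff ℝ ∞ g)
    (ef : HasTermExp IsHomog r f) (eg : HasTermExp IsHomog s g) :
    HasTermExp IsHomog (r + s + 2 * n) (bidiff n f g) := by
  induction n generalizing f g r s with
  | zero =>
    have h := isTermClass_isHomog.hasTermExp_mul ef eg
    rwa [Nat.mul_zero, Nat.add_zero]
  | succ n ih =>
    have h : ∀ i j, HasTermExp IsHomog (r + s + 2 * (n + 1)) (bidiff n (pd i f) (pd j g)) :=
      fun i j => by
        have := ih (contDiff_pd hf i) (contDiff_pd hg j) (ef.fderiv_apply hf.contDiffOn _)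
          (eg.fderiv_apply hg.contDiffOn _)
        rwa [show r + 1 + (s + 1) + 2 * n = r + s + 2 * (n + 1) by omega] at this
    have h1 := isTermClass_isHomog.hasTermExp_const_mul Complex.I (isTermClass_isHomog.hasTermExp_add
      (h 1 0) (isTermClass_isHomog.hasTermExp_const_mul (-1) (h 0 1)))
    simpa only [bidiff, sub_eq_add_neg, neg_one_mul] using h1

/-- The remainder of order `N` of the Moyal product as a power series in the parameter. -/
def moyalRem (N : ℕ) (c : ℝ) (f g : Plane → ℂ) (w : Plane) : ℂ :=
  moyal c f g w - ∑ n ∈ Finset.range N, ((c ^ n / n.factorial : ℝ) : ℂ) * bidiff n f g w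

/-- The remainders obey the same differential equation in the parameter as the Moyal product, with the
order lowered by one. -/
lemma hasDerivAt_moyalRem (N : ℕ) (hf : CB f) (hg : CB g) (w : Plane) (c : ℝ) :
    HasDerivAt (fun c => moyalRem (N + 1) c f g w) (Complex.I *
      (moyalRem N c (pd 1 f) (pd 0 g) w - moyalRem N c (pd 0 f) (pd 1 g) w)) c := by
  have h1 : ∀ n, HasDerivAt (fun c : ℝ => ((c ^ n / n.factorial : ℝ) : ℂ) * bidiff n f g w)
      (((n * c ^ (n - 1) / n.factorial : ℝ) : ℂ) * bidiff n f g w) c := fun n =>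
    (((hasDerivAt_pow n c).div_const _).ofReal_comp).mul_const _
  have h2 := (hasDerivAt_moyal hf hg w c).sub (HasDerivAt.fun_sum (u := Finset.range (N + 1))
    fun n _ => h1 n)
  refine HasDerivAt.congr_deriv (f := fun c => moyalRem (N + 1) c f g w) h2 ?_
  rw [Finset.sum_range_succ']
  have e : ∀ n : ℕ, ((((n + 1 : ℕ) : ℝ) * c ^ (n + 1 - 1) / (n + 1).factorial : ℝ) : ℂ) *
      bidiff (n + 1) f g w = Complex.I * (((c ^ n / n.factorial : ℝ) : ℂ) *
        bidiff n (pd 1 f) (pd 0 g) w - ((c ^ n / n.factorial : ℝ) : ℂ) *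
        bidiff n (pd 0 f) (pd 1 g) w) := fun n => by
    have e1 : ((n + 1 : ℕ) : ℝ) * c ^ (n + 1 - 1) / (n + 1).factorial = c ^ n / n.factorial := by
      rw [Nat.factorial_succ, Nat.add_sub_cancel]
      push_cast
      field_simp
    rw [e1]
    simp only [bidiff]
    ring
  simp only [e, ← Finset.mul_sum, Finset.sum_sub_distrib, moyalRem]
  simp
  ring

lemma moyalRem_zero_param (N : ℕ) (hg : CB g) (w : Plane) : moyalRem (N + 1) 0 f g w = 0 := by
  simp [moyalRem, Finset.sum_range_succ', moyal_zero hg, bidiff]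

/-- Each step of the induction integrates over the parameter from `0`, and gains two orders of decay
from the derivatives of `f` and `g`. -/
lemma exists_norm_moyalRem_le (N : ℕ) (hf : Symb r f) (hg : Symb s g) (R : ℝ) :
    ∃ C, 0 ≤ C ∧ ∀ c ∈ Set.Icc (-R) R, ∀ w,
      ‖moyalRem N c f g w‖ ≤ C * jap w ^ (-((r + s + 2 * N : ℕ) : ℤ)) := by
  induction N generalizing f g r s with
  | zero =>
    obtain ⟨C, hC, h⟩ := exists_norm_moyal_le (ι := Unit) (lam := fun _ => 1) (mu := fun _ => 1)
      (fun _ => zero_le_one) (fun _ => zero_le_one)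
      (hf.amp.congr_weight fun _ _ => (one_mul _).symm)
      (hg.amp.congr_weight fun _ _ => (one_mul _).symm) R
    refine ⟨C, hC, fun c hc w => ?_⟩
    have h1 := h () w c hc
    rw [one_mul, one_mul] at h1
    rw [moyalRem, Finset.range_zero, Finset.sum_empty, sub_zero,
      show (-((r + s + 2 * 0 : ℕ) : ℤ)) = -(r : ℤ) + -(s : ℤ) by push_cast; ring]
    exact h1
  | succ N ih =>
    obtain ⟨C, hC, h⟩ := ih (hf.pd 1) (hg.pd 0)
    obtain ⟨D, hD, h'⟩ := ih (hf.pd 0) (hg.pd 1)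
    refine ⟨(C + D) * |R|, by positivity, fun c hc w => ?_⟩
    rw [show r + 1 + (s + 1) + 2 * N = r + s + 2 * (N + 1) by omega] at h h'
    have h0 : (0 : ℝ) ∈ Set.Icc (-R) R := ⟨by linarith [hc.1, hc.2], by linarith [hc.1, hc.2]⟩
    have hj := jap_zpow_nonneg w (-((r + s + 2 * (N + 1) : ℕ) : ℤ))
    have h1 := (convex_Icc (-R) R).norm_image_sub_le_of_norm_hasDerivWithin_le
      (C := (C + D) * jap w ^ (-((r + s + 2 * (N + 1) : ℕ) : ℤ)))
      (fun c _ => (hasDerivAt_moyalRem N hf.cb hg.cb w c).hasDerivWithinAt) (fun c hc => ?_) h0 hc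
    · rw [moyalRem_zero_param N hg.cb, sub_zero, sub_zero, Real.norm_eq_abs] at h1
      have h2 : |c| ≤ |R| := (abs_le.2 hc).trans (le_abs_self R)
      calc _ ≤ _ := h1
        _ ≤ (C + D) * jap w ^ (-((r + s + 2 * (N + 1) : ℕ) : ℤ)) * |R| := by gcongr
        _ = _ := by ring
    · rw [norm_mul, Complex.norm_I, one_mul, add_mul]
      exact (norm_sub_le _ _).trans (add_le_add (h c hc w) (h' c hc w))

lemma contDiff_moyalRem (N : ℕ) (c : ℝ) (hf : CB f) (hg : CB g) :
    ContDiff ℝ ∞ (moyalRem N c f g) :=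
  (contDiff_moyal c hf hg).sub (ContDiff.sum fun n _ =>
    contDiff_const.mul (contDiff_bidiff n (hf.smooth ()) (hg.smooth ())))

lemma fderiv_moyalRem (N : ℕ) (c : ℝ) (hf : CB f) (hg : CB g) (w v : Plane) :
    fderiv ℝ (moyalRem N c f g) w v = moyalRem N c (fun z => fderiv ℝ f z v) g w +
      moyalRem N c f (fun z => fderiv ℝ g z v) w := by
  have hb := fun n => (contDiff_bidiff n (hf.smooth ()) (hg.smooth ())).differentiable (by simp) w
  have h1 : DifferentiableAt ℝ (moyal c f g) w :=
    (contDiff_moyal c hf hg).differentiable (by simp) w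
  have h2 : HasFDerivAt (moyalRem N c f g) _ w := h1.hasFDerivAt.sub
    (HasFDerivAt.fun_sum (u := Finset.range N) fun n _ =>
      (hb n).hasFDerivAt.const_mul ((c ^ n / n.factorial : ℝ) : ℂ))
  rw [h2.fderiv]
  simp only [sub_apply, sum_apply, smul_apply, smul_eq_mul, fderiv_moyal_apply c hf hg,
    fderiv_bidiff _ (hf.smooth ()) (hg.smooth ()), mul_add, Finset.sum_add_distrib, moyalRem]
  ring

/-- The remainders of the Moyal expansion are symbols of decreasing order. -/
lemma extSymbol_moyalRem (N : ℕ) (c : ℝ) (hf : Symb r f) (hg : Symb s g) :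
    ExtSymbol (r + s + 2 * N) (moyalRem N c f g) := by
  refine ⟨(contDiff_moyalRem N c hf.cb hg.cb).contDiffOn, fun m => ?_⟩
  induction m generalizing f g r s with
  | zero =>
    obtain ⟨C, hC, h⟩ := exists_norm_moyalRem_le N hf hg |c|
    refine ExtBound.zero_of_le hC fun x _ => (h c ⟨neg_abs_le c, le_abs_self c⟩ x).trans ?_
    rw [zpow_neg, zpow_natCast, ← inv_pow]
    have := rho_pos x
    have := inv_anti₀ this (rho_le_jap x)
    have := jap_pos x
    gcongr
  | succ m ih =>
    refine ExtBound.succ (contDiff_moyalRem N c hf.cb hg.cb).contDiffOn fun v => ?_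
    have h1 := ih (hf.fderiv_apply v) hg
    have h2 := ih hf (hg.fderiv_apply v)
    rw [show r + 1 + s + 2 * N = r + s + 2 * N + 1 by omega] at h1
    rw [show r + (s + 1) + 2 * N = r + s + 2 * N + 1 by omega] at h2
    refine (ExtBound.add (contDiff_moyalRem N c (hf.fderiv_apply v).cb hg.cb).contDiffOn
      (contDiff_moyalRem N c hf.cb (hg.fderiv_apply v).cb).contDiffOn h1 h2).congr fun x _ => ?_
    rw [fderiv_moyalRem N c hf.cb hg.cb]

/-- The class of symbols is closed under the Moyal product. -/
lemma moyal_mem_symbolClass (c : ℝ) (hf : f ∈ symbolClass) (hg : g ∈ symbolClass) :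
    moyal c f g ∈ symbolClass := by
  have sf := Symb.of_mem hf
  have sg := Symb.of_mem hg
  refine mem_symbolClass_iff.2 ⟨contDiff_moyal c sf.cb sg.cb,
    isTermClass_isHomog.hasTermExp_of_sum
      (G := fun n w => ((c ^ n / n.factorial : ℝ) : ℂ) * bidiff n f g w) (fun n => ?_) fun N => ?_⟩
  · refine isTermClass_isHomog.hasTermExp_const_mul _ (isTermClass_isHomog.hasTermExp_of_le
      (hasTermExp_bidiff n sf.smooth sg.smooth (mem_symbolClass_iff.1 hf).2
        (mem_symbolClass_iff.1 hg).2) (by omega))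
  · exact (extSymbol_moyalRem N c sf sg).mono (by omega)

end MoyalExpansion

/-! ### The algebra of star-functions -/

section Algebra

variable {ħ : ℝ}

lemma one_mem_symbolClass : (fun _ => 1 : Plane → ℂ) ∈ symbolClass :=
  mem_symbolClass_iff.2 ⟨contDiff_const, isTermClass_isHomog.hasTermExp_of_mem (IsHomog.const 1)⟩

lemma cb_symbolClass (f : symbolClass) : CB f.1 := (Symb.of_mem f.2).cb

/-- The Moyal product as a bilinear map on the class of symbols. -/
def moyalMap (c : ℝ) : symbolClass →ₗ[ℂ] symbolClass →ₗ[ℂ] symbolClass :=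
  LinearMap.mk₂ ℂ (fun f g => ⟨moyal c f.1 g.1, moyal_mem_symbolClass c f.2 g.2⟩)
    (fun f f' g => Subtype.ext (funext fun w => moyal_add_left c (cb_symbolClass f).zpow
      (cb_symbolClass f').zpow (cb_symbolClass g).zpow w))
    (fun b f g => Subtype.ext (funext fun w => moyal_const_mul_left c b (cb_symbolClass f).zpow
      (cb_symbolClass g).zpow w))
    (fun f g g' => Subtype.ext (funext fun w => moyal_add_right c (cb_symbolClass f).zpow
      (cb_symbolClass g).zpow (cb_symbolClass g').zpow w))
    (fun b f g => Subtype.ext (funext fun w => moyal_const_mul_right c b (cb_symbolClass f).zpow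
      (cb_symbolClass g).zpow w))

/-- The correspondence `f ↦ :f_*:_K` as a linear map. -/
def starFunMap (ħ : ℝ) (K : Matrix (Fin 2) (Fin 2) ℂ) : symbolClass →ₗ[ℂ] GenFun where
  toFun f := starFun ħ K (cb_symbolClass f)
  map_add' f g := LinearMap.ext fun φ => by
    rw [LinearMap.add_apply, starFun_apply, starFun_apply, starFun_apply,
      ← MeasureTheory.integral_add ((cb_symbolClass f).integrable_mul _)
        ((cb_symbolClass g).integrable_mul _)]
    simp [add_mul]
  map_smul' c f := LinearMap.ext fun φ => by
    rw [RingHom.id_apply, LinearMap.smul_apply, starFun_apply, starFun_apply, smul_eq_mul,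
      ← MeasureTheory.integral_const_mul]
    simp [mul_assoc]

lemma starFunMap_apply (ħ : ℝ) (K : Matrix (Fin 2) (Fin 2) ℂ) (f : symbolClass) :
    starFunMap ħ K f = starFun ħ K (cb_symbolClass f) := rfl

lemma starFunMap_injective (ħ : ℝ) (K : Matrix (Fin 2) (Fin 2) ℂ) :
    Function.Injective (starFunMap ħ K) := fun f g h =>
  Subtype.ext (starFun_injective K (cb_symbolClass f) (cb_symbolClass g) h)

lemma hasMoyalValue_moyal (ħ : ℝ) {f g : Plane → ℂ} (hf : CB f) (hg : CB g) (w : Plane) :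
    HasMoyalValue ħ f g w (moyal (ħ / 2) f g w) := by
  have h := (hasOscIntegral_moyal (ħ / 2) hf.zpow hg.zpow w).const_mul
    (1 / (2 * (Real.pi : ℂ)) ^ 2)
  exact h

lemma isStarFunction_iff_starFunMap (hħ : ħ ≠ 0) (K : Matrix (Fin 2) (Fin 2) ℂ) (f : symbolClass)
    {F : GenFun} : IsStarFunction ħ K f.1 F ↔ F = starFunMap ħ K f :=
  isStarFunction_iff hħ K (cb_symbolClass f)

lemma hasOscIntegral_starFunMap_moyalMap (hħ : ħ ≠ 0) {K : Matrix (Fin 2) (Fin 2) ℂ}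
    (hK : K.IsSymm) (f g : symbolClass) (φ : testSpace) :
    HasOscIntegral (V := (Plane × Plane) × (Plane × Plane)) (fun z =>
      (1 / (2 * (Real.pi : ℂ) * ħ) ^ 4) *
        (f.1 z.1.1 * (planeWave ħ z.1.2 z.1.1)⁻¹ * (g.1 z.2.1 * (planeWave ħ z.2.2 z.2.1)⁻¹) *
          ∫ w, starFormula ħ K (starExp ħ K z.1.2) (starExp ħ K z.2.2) w * φ.1 w))
      (starFunMap ħ K (moyalMap (ħ / 2) f g) φ) :=
  hasOscIntegral_starProduct hħ hK (cb_symbolClass f) (cb_symbolClass g) φ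

lemma isStarProduct_iff (hħ : ħ ≠ 0) {K : Matrix (Fin 2) (Fin 2) ℂ} (hK : K.IsSymm)
    (f g : symbolClass) {H : GenFun} :
    IsStarProduct ħ K (starFunMap ħ K f) (starFunMap ħ K g) H ↔
      H = starFunMap ħ K (moyalMap (ħ / 2) f g) := by
  constructor
  · rintro ⟨f', hf', g', hg', hF, hG, h⟩
    have e1 : f = ⟨f', hf'⟩ := starFunMap_injective ħ K
      ((isStarFunction_iff_starFunMap hħ K ⟨f', hf'⟩).1 hF)
    have e2 : g = ⟨g', hg'⟩ := starFunMap_injective ħ K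
      ((isStarFunction_iff_starFunMap hħ K ⟨g', hg'⟩).1 hG)
    rw [e1, e2]
    exact LinearMap.ext fun φ => (h φ).unique
      (hasOscIntegral_starFunMap_moyalMap hħ hK ⟨f', hf'⟩ ⟨g', hg'⟩ φ)
  · rintro rfl
    exact ⟨f.1, f.2, g.1, g.2, (isStarFunction_iff_starFunMap hħ K f).2 rfl,
      (isStarFunction_iff_starFunMap hħ K g).2 rfl,
      hasOscIntegral_starFunMap_moyalMap hħ hK f g⟩

end Algebra

end StarAlg

end

theorem mainTheorem8 (ħ : ℝ) (hħ : 0 < ħ) (K : Matrix (Fin 2) (Fin 2) ℂ) (hK : K.IsSymm) :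
    ∃ (A : Submodule ℂ GenFun) (Q : symbolClass ≃ₗ[ℂ] A) (μ : A →ₗ[ℂ] A →ₗ[ℂ] A),
      -- `A` is the space of star-functions, and `Q` is the correspondence `f ↦ :f_*:_K`
      (A : Set GenFun) = starFunctions ħ K ∧
      (∀ (f : symbolClass) (F : GenFun), IsStarFunction ħ K f.1 F ↔ F = (Q f).1) ∧
      -- `μ` is the product `*_K`; it is associative, with unit the star-function of `1`
      (∀ (F G : A) (H : GenFun), IsStarProduct ħ K F.1 G.1 H ↔ H = (μ F G).1) ∧
      (∀ F G H : A, μ (μ F G) H = μ F (μ G H)) ∧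
      (∃ e : A, IsStarFunction ħ K (fun _ => 1) e.1 ∧ ∀ F : A, μ e F = F ∧ μ F e = F) ∧
      -- `f ↦ :f_*:_K` is inverted by passing to the Weyl ordered expression
      (∀ (f : symbolClass) (F : GenFun), IsStarFunction ħ 0 f.1 F ↔ Represents F f.1) ∧
      (∀ f : symbolClass, IsStarFunction ħ 0 f.1 (intertwiner ħ K 0 (Q f).1)) ∧
      (∀ (F : A) (f : symbolClass), Represents (intertwiner ħ K 0 F.1) f.1 ↔ Q.symm F = f) ∧
      -- the product is given by the Moyal product formula in integral form
      (∀ f g : symbolClass, ∃ h : symbolClass,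
        (∀ w : Plane, HasMoyalValue ħ f.1 g.1 w (h.1 w)) ∧ μ (Q f) (Q g) = Q h) := by
  have hħ' : ħ ≠ 0 := hħ.ne'
  have hc : ħ / 2 ≠ 0 := by positivity
  let Q := LinearEquiv.ofInjective (starFunMap ħ K) (starFunMap_injective ħ K)
  have hQ : ∀ f, (Q f).1 = starFunMap ħ K f := fun f => rfl
  let μ := ((moyalMap (ħ / 2)).compl₁₂ Q.symm.toLinearMap Q.symm.toLinearMap).compr₂ Q.toLinearMap
  have hμ : ∀ f g, μ (Q f) (Q g) = Q (moyalMap (ħ / 2) f g) := fun f g => by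
    simp [μ]
  refine ⟨LinearMap.range (starFunMap ħ K), Q, μ, ?_, fun f F => ?_, fun F G H => ?_,
    fun F G H => ?_, ⟨Q ⟨fun _ => 1, one_mem_symbolClass⟩, ?_, fun F => ?_⟩, fun f F => ?_,
    fun f => ?_, fun F f => ?_, fun f g => ⟨moyalMap (ħ / 2) f g, fun w => ?_, hμ f g⟩⟩
  · ext F
    constructor
    · rintro ⟨f, rfl⟩
      exact ⟨f.1, f.2, (isStarFunction_iff_starFunMap hħ' K f).2 rfl⟩
    · rintro ⟨f, hf, hF⟩
      exact ⟨⟨f, hf⟩, ((isStarFunction_iff_starFunMap hħ' K ⟨f, hf⟩).1 hF).symm⟩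
  · exact isStarFunction_iff_starFunMap hħ' K f
  · obtain ⟨f, rfl⟩ := Q.surjective F
    obtain ⟨g, rfl⟩ := Q.surjective G
    rw [hμ, hQ, hQ, hQ]
    exact isStarProduct_iff hħ' hK f g
  · obtain ⟨f, rfl⟩ := Q.surjective F
    obtain ⟨g, rfl⟩ := Q.surjective G
    obtain ⟨h, rfl⟩ := Q.surjective H
    simp only [hμ]
    congr 1
    exact Subtype.ext (funext fun w =>
      moyal_assoc hc (cb_symbolClass f) (cb_symbolClass g) (cb_symbolClass h) w)
  · exact (isStarFunction_iff_starFunMap hħ' K ⟨_, one_mem_symbolClass⟩).2 rfl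
  · obtain ⟨f, rfl⟩ := Q.surjective F
    rw [hμ, hμ]
    exact ⟨congrArg Q (Subtype.ext (funext fun w => moyal_one_left _ (cb_symbolClass f) w)),
      congrArg Q (Subtype.ext (funext fun w => moyal_one_right _ (cb_symbolClass f) w))⟩
  · rw [represents_iff ħ (cb_symbolClass f)]
    exact isStarFunction_iff_starFunMap hħ' 0 f
  · rw [hQ, starFunMap_apply, intertwiner_starFun]
    exact isStarFunction_starFun hħ' 0 (cb_symbolClass f)
  · obtain ⟨g, rfl⟩ := Q.surjective F
    rw [hQ, starFunMap_apply, intertwiner_starFun, represents_iff ħ (cb_symbolClass f),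
      Q.symm_apply_apply]
    exact ⟨fun h => starFunMap_injective ħ 0 h, fun h => by rw [h]⟩
  · exact hasMoyalValue_moyal ħ (cb_symbolClass f) (cb_symbolClass g) w
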